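/- There is a polynomial-time approximation scheme for the L-packing problem. An instance of this problem consists of a positive integer $N$, integers $h_L,w_L\in[0,N]$, and $n\ge 0$ items $i$ with positive integer width $w(i)$, height $h(i)$ and profit $p(i)$. Each item is declared either horizontal, in which case $w(i)>N/2$, or vertical, in which case $h(i)>N/2$. A packing selects a set of items and places each selected item $i$, without rotation, as an open axis-parallel rectangle $R(i)=(left(i),left(i)+w(i))\times(bottom(i),bottom(i)+h(i))$ with real coordinates, so that the rectangles are pairwise disjoint, the horizontal ones lie in the horizontal box $[0,N]\times[0,h_L]$, and the vertical ones lie in the vertical box $[0,w_L]\times[0,N]$. It is an L-packing if the horizontal items are packed in the bottom-right and the vertical items in the top-left of the L-shaped region $L=([0,N]\times[0,h_L])\cup([0,w_L]\times[0,N])$, that is, if every selected vertical item lies entirely to the left of or entirely above every selected horizontal item. The profit of a packing is the sum of the profits of the selected items. Precisely: there is an algorithm (a program for a random access machine over the integers, whose arithmetic operations are addition, subtraction and comparison at unit cost) which, given an instance and an integer $k\ge 1$, computes an L-packing with integer coordinates whose profit $p$ satisfies $p(Q)\le(1+\frac1k)\,p$ for every L-packing $Q$ of the instance. For every fixed $k$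 its number of steps is polynomial in the number $n$ of items: it is at most $C(n+1)^{C}$ with a constant $C$ that depends only on $k$. If moreover $h_L\le N/2$ or $w_L\le N/2$, the inequality holds even for all packings $Q$ that place the horizontal items in the horizontal box and the vertical items in the vertical box, without the condition on their relative position. -/

import Mathlib

namespace LPack

open Set

/-! ## The L-packing problem -/

/-- An instance: `n` items with positive integer widths, heights and profits, each of them declared
either horizontal (`i ∈ hor`, width `> N / 2`) or vertical (`i ∉ hor`, height `> N / 2`), and the
L-shaped region `([0, N] × [0, hL]) ∪ ([0, wL] × [0, N])` inside the knapsack `[0, N] × [0, N]`. -/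
structure Instance where
  n : ℕ
  N : ℕ
  hL : ℕ
  wL : ℕ
  w : Fin n → ℕ
  h : Fin n → ℕ
  p : Fin n → ℕ
  hor : Finset (Fin n)
  N_pos : 0 < N
  hL_le : hL ≤ N
  wL_le : wL ≤ N
  w_pos : ∀ i, 0 < w i
  h_pos : ∀ i, 0 < h i
  p_pos : ∀ i, 0 < p i
  wide : ∀ i, i ∈ hor → N < 2 * w i
  tall : ∀ i, i ∉ hor → N < 2 * h i

/-- A choice of items together with the (real) coordinates of their bottom-left corners; the
coordinates of items that are not chosen are irrelevant. -/
structure Placement (I : Instance) where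
  items : Finset (Fin I.n)
  left : Fin I.n → ℝ
  bottom : Fin I.n → ℝ

namespace Placement

variable {I : Instance}

def right (Q : Placement I) (i : Fin I.n) : ℝ := Q.left i + I.w i

def top (Q : Placement I) (i : Fin I.n) : ℝ := Q.bottom i + I.h i

/-- The open rectangle occupied by item `i`. -/
def rect (Q : Placement I) (i : Fin I.n) : Set (ℝ × ℝ) :=
  Ioo (Q.left i) (Q.right i) ×ˢ Ioo (Q.bottom i) (Q.top i)

def profit (Q : Placement I) : ℕ := ∑ i ∈ Q.items, I.p i

/-- The chosen items do not overlap, the horizontal ones lie in the horizontal box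
`[0, N] × [0, hL]`, and the vertical ones in the vertical box `[0, wL] × [0, N]`. -/
structure IsBoxPacking (Q : Placement I) : Prop where
  hor_box : ∀ i ∈ Q.items, i ∈ I.hor →
    Q.rect i ⊆ Icc (0 : ℝ) (I.N : ℝ) ×ˢ Icc (0 : ℝ) (I.hL : ℝ)
  ver_box : ∀ i ∈ Q.items, i ∉ I.hor →
    Q.rect i ⊆ Icc (0 : ℝ) (I.wL : ℝ) ×ˢ Icc (0 : ℝ) (I.N : ℝ)
  disj : ∀ i ∈ Q.items, ∀ j ∈ Q.items, i ≠ j → Disjoint (Q.rect i) (Q.rect j)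

/-- An L-packing: in addition the horizontal items are in the bottom-right and the vertical items
in the top-left part of the region, i.e. every vertical item lies entirely to the left of or
entirely above every horizontal item. -/
structure IsLPacking (Q : Placement I) : Prop extends IsBoxPacking Q where
  arranged : ∀ i ∈ Q.items, i ∈ I.hor → ∀ j ∈ Q.items, j ∉ I.hor →
    Q.right j ≤ Q.left i ∨ Q.top i ≤ Q.bottom j

end Placement

/-! ## Programs with a step count

A random access machine over the integers, programmed by structured code. A program uses finitely
many registers and arrays. The arithmetic operations are addition and subtraction only, each of
unit cost. So one step lengthens the largest number in memory by at most one bit (up to the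
constants written in the program), and a bound on the number of steps that is polynomial in the
number of input numbers also bounds the bit complexity by a polynomial in the length of the
input. -/

/-- Memory: registers, and arrays of unbounded size. -/
structure Store where
  reg : ℕ → ℤ
  arr : ℕ → ℤ → ℤ

inductive Expr where
  | const (c : ℤ)
  | reg (r : ℕ)
  /-- The entry of array `a` at the index given by the value of `e`. -/
  | read (a : ℕ) (e : Expr)
  | add (e f : Expr)
  | sub (e f : Expr)

def Expr.eval (σ : Store) : Expr → ℤ
  | .const c => c
  | .reg r => σ.reg r
  | .read a e => σ.arr a (e.eval σ)
  | .add e f => e.eval σ + f.eval σ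
  | .sub e f => e.eval σ - f.eval σ

/-- The number of operations and memory accesses made when the expression is evaluated. -/
def Expr.cost : Expr → ℕ
  | .const _ => 1
  | .reg _ => 1
  | .read _ e => e.cost + 1
  | .add e f => e.cost + f.cost + 1
  | .sub e f => e.cost + f.cost + 1

inductive Cmd where
  | skip
  /-- `reg r := e` -/
  | assign (r : ℕ) (e : Expr)
  /-- `arr a [e] := f` -/
  | write (a : ℕ) (e f : Expr)
  | seq (c d : Cmd)
  /-- `if e ≤ f then c else d` -/
  | branch (e f : Expr) (c d : Cmd)
  /-- `while e ≤ f do c` -/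
  | loop (e f : Expr) (c : Cmd)

def Store.setReg (σ : Store) (r : ℕ) (v : ℤ) : Store :=
  { σ with reg := Function.update σ.reg r v }

def Store.setArr (σ : Store) (a : ℕ) (z v : ℤ) : Store :=
  { σ with arr := Function.update σ.arr a (Function.update (σ.arr a) z v) }

/-- `Exec c σ t τ`: started in memory `σ`, the program `c` halts after `t` steps in memory `τ`. -/
inductive Exec : Cmd → Store → ℕ → Store → Prop where
  | skip (σ : Store) : Exec .skip σ 1 σ
  | assign (r : ℕ) (e : Expr) (σ : Store) :
      Exec (.assign r e) σ (e.cost + 1) (σ.setReg r (e.eval σ))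
  | write (a : ℕ) (e f : Expr) (σ : Store) :
      Exec (.write a e f) σ (e.cost + f.cost + 1) (σ.setArr a (e.eval σ) (f.eval σ))
  | seq {c d : Cmd} {σ τ ρ : Store} {s t : ℕ} :
      Exec c σ s τ → Exec d τ t ρ → Exec (.seq c d) σ (s + t) ρ
  | branch_true {e f : Expr} {c d : Cmd} {σ τ : Store} {t : ℕ} :
      e.eval σ ≤ f.eval σ → Exec c σ t τ →
      Exec (.branch e f c d) σ (e.cost + f.cost + 1 + t) τ
  | branch_false {e f : Expr} {c d : Cmd} {σ τ : Store} {t : ℕ} :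
      ¬ e.eval σ ≤ f.eval σ → Exec d σ t τ →
      Exec (.branch e f c d) σ (e.cost + f.cost + 1 + t) τ
  | loop_true {e f : Expr} {c : Cmd} {σ τ ρ : Store} {s t : ℕ} :
      e.eval σ ≤ f.eval σ → Exec c σ s τ → Exec (.loop e f c) τ t ρ →
      Exec (.loop e f c) σ (e.cost + f.cost + 1 + s + t) ρ
  | loop_false {e f : Expr} {c : Cmd} {σ : Store} :
      ¬ e.eval σ ≤ f.eval σ → Exec (.loop e f c) σ (e.cost + f.cost + 1) σ

/-! ## Input and output -/

/-- The array with entries `f 0, …, f (n - 1)`, and `0` elsewhere. -/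
def toArr {n : ℕ} (f : Fin n → ℕ) (z : ℤ) : ℤ :=
  if hz : 0 ≤ z ∧ z.toNat < n then (f ⟨z.toNat, hz.2⟩ : ℤ) else 0

/-- The initial memory. Registers `0, …, 4` hold `n`, `N`, `hL`, `wL` and the accuracy `k`
(standing for `ε = 1 / k`); arrays `0, …, 3` hold the widths, the heights, the profits, and the
indicator of the horizontal items; everything else is `0`. -/
def input (I : Instance) (k : ℕ) : Store where
  reg r := match r with
    | 0 => I.n
    | 1 => I.N
    | 2 => I.hL
    | 3 => I.wL
    | 4 => k
    | _ => 0
  arr a := match a with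
    | 0 => toArr I.w
    | 1 => toArr I.h
    | 2 => toArr I.p
    | 3 => toArr fun i => if i ∈ I.hor then 1 else 0
    | _ => fun _ => 0

/-- The placement read off the final memory: array `4` marks the chosen items by `1`, arrays `5`
and `6` hold the coordinates of the left and bottom sides. -/
def output (I : Instance) (σ : Store) : Placement I where
  items := Finset.univ.filter fun i => σ.arr 4 ((i : ℕ) : ℤ) = 1
  left i := (σ.arr 5 ((i : ℕ) : ℤ) : ℝ)
  bottom i := (σ.arr 6 ((i : ℕ) : ℤ) : ℝ)

end LPack

/-!
Call the long side of an item its key and the short side its size. The items of one class all cross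
the middle of the knapsack in the direction of their keys, so they are stacked in the other
direction.

*Normal form.* In an L-packing, each class can be stacked without gaps in descending order of the
keys, the horizontal items at the right, the vertical ones at the top: for items `i` and `j` of
different classes, this stacking needs that `i` fits beside the part of the other stack up to `j`,
or `j` beside the part of the other stack up to `i`, and in the given packing one of the two
follows from the position of the outermost items of the two parts (`Placement.IsLPacking.feas`). If
one of the boxes is thin, the same holds for every packing of the boxes
(`Placement.IsBoxPacking.feas_of_thin`). So the task is to find a set `M` of maximal profit that
satisfies the inequalities `Instance.Feas` (`Placement.isLPacking_of_feas`).

*Rounding.* In the two stacks of a feasible set, the tops of the items take too many values. At a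
loss of the fraction `1 / (k + 1)` of the profit, the tops can be lowered, in units of `1 / (n +
1)`, to sums of a bounded number of small multiples of item sizes (`exists_fits`). The argument
looks at the records of a stack, the items larger than all items below them. The part of the stack
that starts at a record of size `s` ends, before the next record, at a height of at most `n s`. If
the records have little profit, all of them are deleted, and the room left by a record suffices to
round the tops up to the next record to multiples of `s / (n + 1)`. If they have much profit, then
only every `(q + 1)`-st record is deleted, the room left by it allows to restart the stack at a
multiple of its size, and the segments between the records, which have a smaller share of the
profit, are treated recursively. Lowering tops preserves the inequalities of a feasible set, as
these only bound tops from above.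

*Search.* A partial packing is described by the last item and the top of each of the two stacks,
which for fixed `k` gives polynomially many vertices. An edge puts an item on one of the stacks.
The stack of class `c` is extended only if the last item of the other class fits beside it as it
is. Then so do all later items of the other class, which have smaller keys, so the items covered in
the stack of class `c` need not be remembered (`Trace.step`). Conversely, two rounded stacks give a
path (`reach_of_ladders`), because the inequality for the two last items always allows one of the
two stacks to be extended. A path of maximal profit is computed by relaxing all edges `n + 2` times
(`runs_search`).

*Running time.* `Runs B c σ Q` states that the program `c` started in `σ` halts with `Q`, within
the number of steps it takes if no loop makes more than `B` iterations. This number is polynomial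
in `B` for every program (`Cmd.polyBdd_bnd`), and `B` can be taken as the number of vertices, up to
smaller terms (`iterBound`).

*Memory.* Registers `0, …, 4` and arrays `0, …, 3` hold the input. The register `9` holds `n + 1`;
the registers `10, 11, 12` hold `N`, `hL`, `wL`, and the arrays `7, 8` the keys and sizes, all
multiplied by `n + 1`; the arrays `9, 10` hold the positions of the items in the orders of the two
classes. The array `11` is the list of positions (with register `14` for its length), the arrays
`12, …, 15` list the vertices (with register `16` for their number), and the arrays `16, 17` hold
the values and successors found by the search. The output is in the arrays `4, 5, 6`.
-/

namespace LPack

/-! ### Reasoning about programs -/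

@[simp] theorem Store.setReg_reg (σ : Store) (r : ℕ) (v : ℤ) (x : ℕ) :
    (σ.setReg r v).reg x = if x = r then v else σ.reg x := by
  simp [Store.setReg, Function.update_apply]

@[simp] theorem Store.setReg_arr (σ : Store) (r : ℕ) (v : ℤ) : (σ.setReg r v).arr = σ.arr := rfl

@[simp] theorem Store.setArr_reg (σ : Store) (a : ℕ) (z v : ℤ) : (σ.setArr a z v).reg = σ.reg := rfl

@[simp] theorem Store.setArr_arr (σ : Store) (a : ℕ) (z v : ℤ) (b : ℕ) (x : ℤ) :
    (σ.setArr a z v).arr b x = if b = a ∧ x = z then v else σ.arr b x := by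
  simp only [Store.setArr, Function.update_apply]
  by_cases h : b = a
  · subst h; simp [Function.update_apply]
  · simp [h]

attribute [simp] Expr.eval

/-- The registers that a program may write. -/
def Cmd.regs : Cmd → List ℕ
  | .skip => []
  | .assign r _ => [r]
  | .write _ _ _ => []
  | .seq c d => c.regs ++ d.regs
  | .branch _ _ c d => c.regs ++ d.regs
  | .loop _ _ c => c.regs

/-- The arrays that a program may write. -/
def Cmd.arrs : Cmd → List ℕ
  | .skip => []
  | .assign _ _ => []
  | .write a _ _ => [a]
  | .seq c d => c.arrs ++ d.arrs
  | .branch _ _ c d => c.arrs ++ d.arrs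
  | .loop _ _ c => c.arrs

/-- The memories agree outside the given registers and arrays. -/
structure Same (R A : List ℕ) (σ τ : Store) : Prop where
  reg : ∀ x, x ∉ R → τ.reg x = σ.reg x
  arr : ∀ a, a ∉ A → τ.arr a = σ.arr a

namespace Same

variable {R A : List ℕ} {σ τ ρ : Store}

theorem refl : Same R A σ σ := ⟨fun _ _ => rfl, fun _ _ => rfl⟩

theorem trans (h : Same R A σ τ) (h' : Same R A τ ρ) : Same R A σ ρ :=
  ⟨fun x hx => (h'.reg x hx).trans (h.reg x hx), fun a ha => (h'.arr a ha).trans (h.arr a ha)⟩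

theorem mono {R' A' : List ℕ} (h : Same R A σ τ) (hR : R ⊆ R') (hA : A ⊆ A') :
    Same R' A' σ τ :=
  ⟨fun x hx => h.reg x fun hx' => hx (hR hx'), fun a ha => h.arr a fun ha' => ha (hA ha')⟩

theorem append {R' A' : List ℕ} (h : Same R A σ τ) (h' : Same R' A' τ ρ) :
    Same (R ++ R') (A ++ A') σ ρ :=
  (h.mono (List.subset_append_left _ _) (List.subset_append_left _ _)).trans
    (h'.mono (List.subset_append_right _ _) (List.subset_append_right _ _))

end Same

/-- A program changes nothing outside the registers and arrays that occur in it as targets. -/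
theorem Exec.same {c : Cmd} {σ τ : Store} {t : ℕ} (h : Exec c σ t τ) : Same c.regs c.arrs σ τ := by
  induction h with
  | skip σ => exact .refl
  | assign r e σ =>
    refine ⟨fun x hx => ?_, fun _ _ => rfl⟩
    simp only [Cmd.regs, List.mem_singleton] at hx
    simp [hx]
  | write a e f σ =>
    refine ⟨fun _ _ => rfl, fun b hb => funext fun x => ?_⟩
    simp only [Cmd.arrs, List.mem_singleton] at hb
    simp [hb]
  | seq _ _ ih1 ih2 =>
    exact ih1.append ih2
  | branch_true _ _ ih => exact ih.mono (by simp [Cmd.regs]) (by simp [Cmd.arrs])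
  | branch_false _ _ ih => exact ih.mono (by simp [Cmd.regs]) (by simp [Cmd.arrs])
  | loop_true _ _ _ ih1 ih2 => exact Same.trans ih1 ih2
  | loop_false _ => exact .refl

/-- A bound for the number of steps of a program all of whose loops make at most `B` iterations. -/
def Cmd.bnd (B : ℕ) : Cmd → ℕ
  | .skip => 1
  | .assign _ e => e.cost + 1
  | .write _ e f => e.cost + f.cost + 1
  | .seq c d => c.bnd B + d.bnd B
  | .branch e f c d => e.cost + f.cost + 1 + (c.bnd B + d.bnd B)
  | .loop e f c => (B + 1) * (e.cost + f.cost + 1) + B * c.bnd B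

/-- Functions that are bounded by a polynomial, in the form used for the number of steps. -/
def PolyBdd (f : ℕ → ℕ) : Prop := ∃ a, ∀ n, f n ≤ a * (n + 1) ^ a

namespace PolyBdd

variable {f g : ℕ → ℕ}

theorem mono (hf : PolyBdd f) (h : ∀ n, g n ≤ f n) : PolyBdd g := by
  obtain ⟨a, ha⟩ := hf
  exact ⟨a, fun n => (h n).trans (ha n)⟩

theorem const (m : ℕ) : PolyBdd fun _ => m :=
  ⟨m, fun n => Nat.le_mul_of_pos_right _ (by positivity)⟩

theorem id : PolyBdd fun n => n := ⟨1, fun n => by simp⟩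

theorem add (hf : PolyBdd f) (hg : PolyBdd g) : PolyBdd fun n => f n + g n := by
  obtain ⟨a, ha⟩ := hf
  obtain ⟨b, hb⟩ := hg
  refine ⟨a + b, fun n => ?_⟩
  have h1 : (n + 1) ^ a ≤ (n + 1) ^ (a + b) := Nat.pow_le_pow_right (by omega) (by omega)
  have h2 : (n + 1) ^ b ≤ (n + 1) ^ (a + b) := Nat.pow_le_pow_right (by omega) (by omega)
  rw [add_mul]
  exact add_le_add ((ha n).trans (Nat.mul_le_mul_left _ h1))
    ((hb n).trans (Nat.mul_le_mul_left _ h2))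

theorem mul (hf : PolyBdd f) (hg : PolyBdd g) : PolyBdd fun n => f n * g n := by
  obtain ⟨a, ha⟩ := hf
  obtain ⟨b, hb⟩ := hg
  refine ⟨a * b + (a + b), fun n => ?_⟩
  calc f n * g n ≤ (a * (n + 1) ^ a) * (b * (n + 1) ^ b) := Nat.mul_le_mul (ha n) (hb n)
    _ = (a * b) * (n + 1) ^ (a + b) := by ring
    _ ≤ _ := Nat.mul_le_mul (by omega) (Nat.pow_le_pow_right (by omega) (by omega))

theorem pow (hf : PolyBdd f) : ∀ m, PolyBdd fun n => f n ^ m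
  | 0 => const 1
  | m + 1 => (pow hf m).mul hf

theorem comp (hf : PolyBdd f) (hg : PolyBdd g) : PolyBdd fun n => f (g n) := by
  obtain ⟨a, ha⟩ := hf
  exact ((const a).mul ((hg.add (const 1)).pow a)).mono fun n => ha (g n)

end PolyBdd

theorem Cmd.polyBdd_bnd (c : Cmd) : PolyBdd fun B => c.bnd B := by
  induction c with
  | skip => exact .const 1
  | assign _ e => exact .const _
  | write _ e f => exact .const _
  | seq c d ihc ihd => exact ihc.add ihd
  | branch e f c d ihc ihd => exact (PolyBdd.const _).add (ihc.add ihd)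
  | loop e f c ih =>
    exact ((PolyBdd.id.add (.const 1)).mul (.const _)).add (PolyBdd.id.mul ih)

/-- Total correctness: started in `σ`, the program halts in a memory with the property `Q`, within
the number of steps that it takes if no loop makes more than `B` iterations. -/
def Runs (B : ℕ) (c : Cmd) (σ : Store) (Q : Store → Prop) : Prop :=
  ∃ t τ, Exec c σ t τ ∧ t ≤ c.bnd B ∧ Q τ

/-- `for r := 0, …, b - 1 do c`, where the bound is the value of the register `b`. -/
def forLt (r b : ℕ) (c : Cmd) : Cmd :=
  .seq (.assign r (.const 0))
    (.loop (.add (.reg r) (.const 1)) (.reg b)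
      (.seq c (.assign r (.add (.reg r) (.const 1)))))

/-- Run `c` if all inequalities of the list hold. -/
def guard : List (Expr × Expr) → Cmd → Cmd
  | [], c => c
  | p :: l, c => .branch p.1 p.2 (guard l c) .skip

namespace Runs

variable {B : ℕ} {c d : Cmd} {σ : Store} {Q Q' : Store → Prop}

theorem imp (h : Runs B c σ Q) (hQ : ∀ τ, Q τ → Q' τ) : Runs B c σ Q' := by
  obtain ⟨t, τ, h1, h2, h3⟩ := h
  exact ⟨t, τ, h1, h2, hQ τ h3⟩

/-- Every postcondition can be strengthened by what the program leaves unchanged. -/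
theorem frame (h : Runs B c σ Q) : Runs B c σ fun τ => Q τ ∧ Same c.regs c.arrs σ τ := by
  obtain ⟨t, τ, h1, h2, h3⟩ := h
  exact ⟨t, τ, h1, h2, h3, h1.same⟩

theorem skip (h : Q σ) : Runs B .skip σ Q := ⟨1, σ, .skip σ, le_rfl, h⟩

theorem assign {r : ℕ} {e : Expr} (h : Q (σ.setReg r (e.eval σ))) : Runs B (.assign r e) σ Q :=
  ⟨_, _, .assign r e σ, le_rfl, h⟩

theorem write {a : ℕ} {e f : Expr} (h : Q (σ.setArr a (e.eval σ) (f.eval σ))) :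
    Runs B (.write a e f) σ Q :=
  ⟨_, _, .write a e f σ, le_rfl, h⟩

theorem seq (h : Runs B c σ fun τ => Runs B d τ Q) : Runs B (.seq c d) σ Q := by
  obtain ⟨t, τ, h1, h2, t', τ', h1', h2', h3⟩ := h
  exact ⟨_, τ', .seq h1 h1', add_le_add h2 h2', h3⟩

/-- Composition of two programs of which the first has been treated separately. -/
theorem seq_frame (h : Runs B c σ Q)
    (h' : ∀ τ, Q τ → Same c.regs c.arrs σ τ → Runs B d τ Q') : Runs B (.seq c d) σ Q' :=
  seq (h.frame.imp fun τ hτ => h' τ hτ.1 hτ.2)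

theorem branch {e f : Expr} (h1 : e.eval σ ≤ f.eval σ → Runs B c σ Q)
    (h2 : ¬ e.eval σ ≤ f.eval σ → Runs B d σ Q) : Runs B (.branch e f c d) σ Q := by
  by_cases h : e.eval σ ≤ f.eval σ
  · obtain ⟨t, τ, h3, h4, h5⟩ := h1 h
    exact ⟨_, τ, .branch_true h h3, by simp only [Cmd.bnd]; omega, h5⟩
  · obtain ⟨t, τ, h3, h4, h5⟩ := h2 h
    exact ⟨_, τ, .branch_false h h3, by simp only [Cmd.bnd]; omega, h5⟩

theorem guard {l : List (Expr × Expr)} (h1 : (∀ p ∈ l, p.1.eval σ ≤ p.2.eval σ) → Runs B c σ Q)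
    (h2 : (¬ ∀ p ∈ l, p.1.eval σ ≤ p.2.eval σ) → Q σ) : Runs B (guard l c) σ Q := by
  induction l with
  | nil => exact h1 (by simp)
  | cons p l ih =>
    refine branch (fun h => ih (fun h' => h1 ?_) (fun h' => h2 ?_)) (fun h => skip (h2 ?_))
    · simpa using ⟨h, by simpa using h'⟩
    · exact fun h'' => h' fun q hq => h'' q (by simp [hq])
    · exact fun h'' => h (h'' p (by simp))

/-- A counting loop runs through its invariant. In the body, everything outside the loop's own
registers and arrays is as before the loop. -/
theorem forLt {r b : ℕ} (m : ℕ) (hm : σ.reg b = m) (hmB : m ≤ B) (hrb : b ≠ r) (hb : b ∉ c.regs)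
    (hr : r ∉ c.regs) (Inv : ℕ → Store → Prop) (h0 : Inv 0 (σ.setReg r 0))
    (hstep : ∀ (i : ℕ) (σ' : Store), i < m → σ'.reg r = i → Same (r :: c.regs) c.arrs σ σ' →
      Inv i σ' → Runs B c σ' fun τ => Inv (i + 1) (τ.setReg r (i + 1))) :
    Runs B (forLt r b c) σ (Inv m) := by
  have loop : ∀ (j i : ℕ) (σ' : Store), i + j = m → σ'.reg r = i →
      Same (r :: c.regs) c.arrs σ σ' → Inv i σ' →
      ∃ t τ, Exec (.loop (.add (.reg r) (.const 1)) (.reg b)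
        (.seq c (.assign r (.add (.reg r) (.const 1))))) σ' t τ ∧
        t ≤ (j + 1) * 5 + j * (c.bnd B + 4) ∧ Inv m τ := by
    intro j
    induction j with
    | zero =>
      intro i σ' hij hi hs hI
      obtain rfl : i = m := by omega
      refine ⟨_, σ', .loop_false ?_, ?_, hI⟩
      · simp [hi, hs.reg b (by simp [hrb, hb]), hm]
      · simp [Expr.cost]
    | succ j ih =>
      intro i σ' hij hi hs hI
      obtain ⟨t, τ, h1, h2, h3⟩ := hstep i σ' (by omega) hi hs hI
      have hτr : τ.reg r = i := (h1.same.reg r hr).trans hi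
      obtain ⟨t', τ', h1', h2', h3'⟩ := ih (i + 1) (τ.setReg r (i + 1)) (by omega) (by simp)
        (hs.trans ⟨fun x hx => by
          simp only [List.mem_cons, not_or] at hx
          simp [hx.1, h1.same.reg x hx.2], h1.same.arr⟩) h3
      have hval : (Expr.add (.reg r) (.const 1)).eval τ = i + 1 := by simp [hτr]
      rw [← hval] at h1'
      refine ⟨_, τ', .loop_true ?_ (.seq h1 (.assign _ _ _)) h1', ?_, h3'⟩
      · simp [hi, hs.reg b (by simp [hrb, hb]), hm]; omega
      · simp only [Expr.cost]
        have : (j + 1 + 1) * 5 + (j + 1) * (c.bnd B + 4) =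
            (j + 1) * 5 + j * (c.bnd B + 4) + (c.bnd B + 4) + 5 := by ring
        omega
  obtain ⟨t, τ, h1, h2, h3⟩ := loop m 0 (σ.setReg r 0) (by simp) (by simp)
    ⟨fun x hx => by
      simp only [List.mem_cons, not_or] at hx
      simp [hx.1], fun _ _ => rfl⟩ h0
  refine ⟨_, τ, .seq (.assign _ _ _) h1, ?_, h3⟩
  simp only [LPack.forLt, Cmd.bnd, Expr.cost, Nat.reduceAdd]
  have e1 : (m + 1) * 5 ≤ (B + 1) * 5 := Nat.mul_le_mul_right _ (by omega)
  have e2 : m * (c.bnd B + 4) ≤ B * (c.bnd B + 4) := Nat.mul_le_mul_right _ hmB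
  omega

end Runs

end LPack

namespace LPack

/-! ### Rounding the positions in a stack -/

section Rounding

variable {α : Type*}

/-- The total of `f` over a list. -/
def total (f : α → ℕ) (L : List α) : ℕ := (L.map f).sum

@[simp] theorem total_nil (f : α → ℕ) : total f [] = 0 := rfl

@[simp] theorem total_cons (f : α → ℕ) (a : α) (L : List α) :
    total f (a :: L) = f a + total f L := by simp [total]

@[simp] theorem total_append (f : α → ℕ) (L L' : List α) :
    total f (L ++ L') = total f L + total f L' := by simp [total]

theorem total_le_card_mul {f : α → ℕ} {b : ℕ} {L : List α} (h : ∀ a ∈ L, f a ≤ b) :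
    total f L ≤ L.length * b := by
  induction L with
  | nil => simp
  | cons a L ih =>
    simp only [List.mem_cons, forall_eq_or_imp] at h
    have := ih h.2
    simp only [total_cons, List.length_cons]
    nlinarith [h.1]

/-- A part of the stack `L`, with sizes `sz`, is kept and placed anew. The stack starts at position
`x`, the new placement at `y`. The list `K` records the kept items with their new tops, which lie
in `T` and are not above the tops in the original stack. The new placement ends at or below `e`. -/
inductive Fits (sz : α → ℕ) (T : Set ℕ) : ℕ → ℕ → List α → List (α × ℕ) → ℕ → Prop
  | nil {x y e : ℕ} : y ≤ e → Fits sz T x y [] [] e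
  | skip {x y e : ℕ} {a : α} {L : List α} {K : List (α × ℕ)} :
      Fits sz T (x + sz a) y L K e → Fits sz T x y (a :: L) K e
  | keep {x y e s : ℕ} {a : α} {L : List α} {K : List (α × ℕ)} :
      y + sz a ≤ s → s ≤ x + sz a → s ∈ T → Fits sz T (x + sz a) s L K e →
      Fits sz T x y (a :: L) ((a, s) :: K) e

namespace Fits

variable {sz : α → ℕ} {T T' : Set ℕ} {x y e : ℕ} {L : List α} {K : List (α × ℕ)}

theorem anti (h : Fits sz T x y L K e) {y' : ℕ} (hy : y' ≤ y) : Fits sz T x y' L K e := by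
  induction h generalizing y' with
  | nil h => exact .nil (hy.trans h)
  | skip _ ih => exact .skip (ih hy)
  | keep h1 h2 h3 h4 _ => exact .keep (by omega) h2 h3 h4

theorem mono (h : Fits sz T x y L K e) (hT : T ⊆ T') : Fits sz T' x y L K e := by
  induction h with
  | nil h => exact .nil h
  | skip _ ih => exact .skip ih
  | keep h1 h2 h3 _ ih => exact .keep h1 h2 (hT h3) ih

theorem append {L' : List α} {K' : List (α × ℕ)} {b e' : ℕ} (h : Fits sz T x y L K e)
    (hb : e ≤ b) (h' : Fits sz T (x + total sz L) b L' K' e') :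
    Fits sz T x y (L ++ L') (K ++ K') e' := by
  induction h with
  | nil h => exact h'.anti (h.trans hb)
  | skip _ ih =>
    refine .skip (ih hb ?_)
    simpa [add_assoc] using h'
  | keep h1 h2 h3 _ ih =>
    refine .keep h1 h2 h3 (ih hb ?_)
    simpa [add_assoc] using h'

theorem shift (h : Fits sz T x y L K e) {c b : ℕ} (hb : b ≤ c) (hT : ∀ t ∈ T, b + t ∈ T') :
    Fits sz T' (c + x) (b + y) L (K.map fun k => (k.1, b + k.2)) (b + e) := by
  induction h with
  | nil h => exact .nil (by omega)
  | skip _ ih => exact .skip (by simpa [add_assoc] using ih)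
  | keep h1 h2 h3 _ ih =>
    exact .keep (by omega) (by omega) (hT _ h3) (by simpa [add_assoc] using ih)

end Fits

/-- Multiples of the sizes, with small factors. -/
def units (n : ℕ) (z : α → ℕ) : Set ℕ := {u | ∃ a m, m ≤ (n + 1) ^ 2 ∧ u = m * z a}

/-- Sums of at most `M` elements of `U`. -/
def sums (U : Set ℕ) (M : ℕ) : Set ℕ :=
  {s | ∃ l : List ℕ, l.length ≤ M ∧ (∀ u ∈ l, u ∈ U) ∧ l.sum = s}

theorem zero_mem_sums (U : Set ℕ) (M : ℕ) : 0 ∈ sums U M := ⟨[], by simp⟩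

theorem mem_sums_one {U : Set ℕ} {u : ℕ} (h : u ∈ U) : u ∈ sums U 1 := ⟨[u], by simpa⟩

theorem sums_mono {U : Set ℕ} {M M' : ℕ} (h : M ≤ M') : sums U M ⊆ sums U M' := by
  rintro s ⟨l, h1, h2, h3⟩
  exact ⟨l, h1.trans h, h2, h3⟩

theorem add_mem_sums {U : Set ℕ} {M M' s s' : ℕ} (h : s ∈ sums U M) (h' : s' ∈ sums U M') :
    s + s' ∈ sums U (M + M') := by
  obtain ⟨l, h1, h2, h3⟩ := h
  obtain ⟨l', h1', h2', h3'⟩ := h'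
  refine ⟨l ++ l', by simp; omega, ?_, by simp [h3, h3']⟩
  intro u hu
  rcases List.mem_append.1 hu with hu | hu
  exacts [h2 u hu, h2' u hu]

variable (n : ℕ) (z p : α → ℕ)

/-- The stack is cut at its records (items larger than all items below them): a block is a record
together with the items up to the next record. -/
def flat (bs : List (α × List α)) : List α := bs.flatMap fun b => b.1 :: b.2

@[simp] theorem flat_nil : flat ([] : List (α × List α)) = [] := rfl

@[simp] theorem flat_cons (b : α × List α) (bs : List (α × List α)) :
    flat (b :: bs) = b.1 :: (b.2 ++ flat bs) := by simp [flat]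

/-- The profit of the records. -/
def heads (bs : List (α × List α)) : ℕ := total (fun b => p b.1) bs

/-- The profit of the other items. -/
def tails (bs : List (α × List α)) : ℕ := total (fun b => total p b.2) bs

theorem total_flat (bs : List (α × List α)) : total p (flat bs) = heads p bs + tails p bs := by
  induction bs with
  | nil => rfl
  | cons b bs ih =>
    simp only [flat_cons, total_cons, total_append, ih, heads, tails]
    ring

/-- What is needed of a decomposition into blocks: each block of the stack that starts at position
`x` ends at a position of at most `n` times the size of its record. Sizes are scaled by `n + 1`. -/
def Grow : ℕ → List (α × List α) → Prop
  | _, [] => True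
  | x, b :: bs => b.2.length ≤ n ∧
      x + (n + 1) * z b.1 + total (fun a => (n + 1) * z a) b.2 ≤ n * ((n + 1) * z b.1) ∧
      Grow (x + (n + 1) * z b.1 + total (fun a => (n + 1) * z a) b.2) bs

/-- Every stack of at most `n` items has such a decomposition, at its records: if `c` items lie below
a record, they are not larger than it, and neither are the items up to the next record. -/
theorem exists_grow : ∀ (m : ℕ) (L : List α) (x c : ℕ), L.length ≤ m → c + L.length ≤ n →
    (∀ a ∈ L.head?, x ≤ c * ((n + 1) * z a)) → ∃ bs, flat bs = L ∧ Grow n z x bs := by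
  intro m
  induction m with
  | zero =>
    intro L x c hL _ _
    obtain rfl : L = [] := List.length_eq_zero_iff.1 (by omega)
    exact ⟨[], rfl, trivial⟩
  | succ m ih =>
    intro L x c hL hc hx
    cases L with
    | nil => exact ⟨[], rfl, trivial⟩
    | cons g R =>
      simp only [List.head?_cons, Option.mem_def, Option.some.injEq, forall_eq'] at hx
      set sz : α → ℕ := fun a => (n + 1) * z a with hsz
      set S := R.takeWhile (fun a => decide (sz a ≤ sz g)) with hS
      set R' := R.dropWhile (fun a => decide (sz a ≤ sz g)) with hR'
      have hsplit : S ++ R' = R := List.takeWhile_append_dropWhile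
      have hlen : S.length + R'.length = R.length := by
        rw [← List.length_append, hsplit]
      simp only [List.length_cons] at hL hc
      have hSle : ∀ a ∈ S, sz a ≤ sz g := by
        intro a ha
        simpa using List.mem_takeWhile_imp ha
      have htot : total sz S ≤ S.length * sz g := total_le_card_mul hSle
      have hend : x + sz g + total sz S ≤ (c + 1 + S.length) * sz g := by
        have : x ≤ c * sz g := hx
        nlinarith
      obtain ⟨bs, h1, h2⟩ := ih R' (x + sz g + total sz S) (c + 1 + S.length) (by omega)
        (by omega) (by
          intro a ha
          have hgt : sz g < sz a := by
            have h3 := List.head?_dropWhile_not (fun a => decide (sz a ≤ sz g)) R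
            rw [← hR', Option.mem_def.1 ha] at h3
            simpa using h3
          exact hend.trans (Nat.mul_le_mul_left _ hgt.le))
      refine ⟨(g, S) :: bs, by simp [h1, hsplit], by dsimp only; omega, ?_, h2⟩
      exact hend.trans (Nat.mul_le_mul_right _ (by omega))

/-- Once there is room for one unit `u` per item, the tops of all items can be rounded up to
multiples of `u`. -/
theorem exists_fits_multiples {u b : ℕ} (hu : 0 < u) {sz : α → ℕ} (L : List α) (x y : ℕ)
    (hy : y + L.length * u ≤ x) (hb : x + total sz L ≤ b * u) :
    ∃ K e, Fits sz {s | ∃ m, m ≤ b ∧ s = m * u} x y L K e ∧ e ≤ x + total sz L ∧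
      K.map Prod.fst = L ∧ (e = y ∨ ∃ m, m ≤ b ∧ e = m * u) := by
  induction L generalizing x y with
  | nil => exact ⟨[], y, .nil le_rfl, by simpa using hy, rfl, .inl rfl⟩
  | cons a L ih =>
    simp only [List.length_cons, total_cons, add_mul, one_mul] at hy hb
    obtain ⟨m, hm1, hm2⟩ : ∃ m, y + sz a ≤ m * u ∧ m * u ≤ y + sz a + u := by
      refine ⟨(y + sz a) / u + 1, ?_, ?_⟩
      · rw [mul_comm]; exact (Nat.lt_mul_div_succ _ hu).le
      · rw [add_mul, one_mul]; have := Nat.div_mul_le_self (y + sz a) u; omega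
    have hm : m ≤ b := Nat.le_of_mul_le_mul_right (by omega : m * u ≤ b * u) hu
    obtain ⟨K, e, h1, h2, h3, h4⟩ := ih (x + sz a) (m * u) (by omega) (by omega)
    refine ⟨(a, m * u) :: K, e, .keep hm1 (by omega) ⟨m, hm, rfl⟩ h1, ?_, by simp [h3], ?_⟩
    · simp only [total_cons]; omega
    · exact .inr (h4.elim (fun h => ⟨m, hm, h⟩) id)

variable {z}

theorem total_map_fst (K : List (α × ℕ)) :
    total p (K.map Prod.fst) = total (fun k => p k.1) K := by
  simp [total, Function.comp_def]

/-- If all records are deleted, the room they leave suffices to round all other tops to a few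
multiples of the sizes of the records. -/
theorem exists_fits_delete_heads (hz : ∀ a, 0 < z a) (bs : List (α × List α)) (x y : ℕ)
    (hxy : y ≤ x) (hy : y ∈ sums (units n z) 1) (hg : Grow n z x bs) :
    ∃ K e, Fits (fun a => (n + 1) * z a) (sums (units n z) 1) x y (flat bs) K e ∧
      e ≤ x + total (fun a => (n + 1) * z a) (flat bs) ∧ e ∈ sums (units n z) 1 ∧
      tails p bs = total (fun k => p k.1) K := by
  induction bs generalizing x y with
  | nil => exact ⟨[], y, .nil le_rfl, by simpa using hxy, hy, rfl⟩
  | cons b bs ih =>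
    obtain ⟨g, S⟩ := b
    obtain ⟨h1, h2, h3⟩ := hg
    dsimp only at h1 h2 h3
    have hmul : ∀ s, (∃ m, m ≤ n * (n + 1) ∧ s = m * z g) → s ∈ sums (units n z) 1 := by
      rintro s ⟨m, hm, rfl⟩
      exact mem_sums_one ⟨g, m, hm.trans (by nlinarith), rfl⟩
    obtain ⟨K, e, k1, k2, k3, k4⟩ := exists_fits_multiples (b := n * (n + 1)) (hz g)
      (sz := fun a => (n + 1) * z a) S (x + (n + 1) * z g) y
      (by nlinarith [Nat.mul_le_mul_right (z g) h1]) (by nlinarith)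
    have he : e ∈ sums (units n z) 1 := k4.elim (fun h => h ▸ hy) (hmul e)
    obtain ⟨K', e', l1, l2, l3, l4⟩ := ih _ e k2 he h3
    refine ⟨K ++ K', e', ?_, ?_, l3, ?_⟩
    · rw [flat_cons]
      exact .skip ((k1.mono hmul).append le_rfl l1)
    · simp only [flat_cons, total_cons, total_append]; omega
    · rw [total_append, ← l4, ← total_map_fst, k3]
      simp [tails]

/-- The profit of the records that are deleted when every `(q + 1)`-st record is deleted and `r`
records are kept before the first deletion. -/
def lost (q : ℕ) : ℕ → List (α × List α) → ℕ
  | _, [] => 0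
  | 0, b :: bs => p b.1 + lost q q bs
  | r + 1, _ :: bs => lost q r bs

/-- The `q + 1` ways to delete every `(q + 1)`-st record partition the records. -/
theorem sum_lost (q : ℕ) (bs : List (α × List α)) :
    ∑ r ∈ Finset.range (q + 1), lost p q r bs = heads p bs := by
  induction bs with
  | nil => simp [lost, heads]
  | cons b bs ih =>
    rw [Finset.sum_range_succ']
    rw [Finset.sum_range_succ] at ih
    simp only [lost]
    simp only [heads, total_cons] at ih ⊢
    omega

/-- One of these ways loses at most the average profit. -/
theorem exists_lost_le (q : ℕ) (bs : List (α × List α)) :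
    ∃ r ≤ q, (q + 1) * lost p q r bs ≤ heads p bs := by
  by_contra! h
  have : ∑ r ∈ Finset.range (q + 1), heads p bs <
      ∑ r ∈ Finset.range (q + 1), (q + 1) * lost p q r bs := by
    refine Finset.sum_lt_sum_of_nonempty (by simp) fun r hr => h r ?_
    simp at hr; omega
  rw [← Finset.mul_sum, sum_lost] at this
  simp at this

/-- If every `(q + 1)`-st record is deleted, the room left by a deleted record is used to start
again at a multiple of its size; the tops up to the next deleted record are reached from there in a
bounded number of steps, if the segments between the records are rounded recursively. -/
theorem exists_fits_delete_some (hz : ∀ a, 0 < z a) (q M B C : ℕ)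
    (ih : ∀ S : List α, S.length ≤ n → ∃ K e,
      Fits (fun a => (n + 1) * z a) (sums (units n z) M) 0 0 S K e ∧
      e ≤ total (fun a => (n + 1) * z a) S ∧ e ∈ sums (units n z) M ∧
      B * total p S ≤ B * total (fun k => p k.1) K + C * total p S)
    (bs : List (α × List α)) (r x y : ℕ) (hr : r ≤ q) (hxy : y ≤ x)
    (hy : y ∈ sums (units n z) ((q - r + 1) * (M + 1))) (hg : Grow n z x bs) :
    ∃ K e, Fits (fun a => (n + 1) * z a) (sums (units n z) ((q + 1) * (M + 1))) x y (flat bs) K e ∧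
      e ≤ x + total (fun a => (n + 1) * z a) (flat bs) ∧
      e ∈ sums (units n z) ((q + 1) * (M + 1)) ∧
      B * tails p bs + B * heads p bs ≤
        B * total (fun k => p k.1) K + C * tails p bs + B * lost p q r bs := by
  induction bs generalizing r x y with
  | nil =>
    refine ⟨[], y, .nil le_rfl, by simpa using hxy, sums_mono (Nat.mul_le_mul_right _ ?_) hy, ?_⟩
    · omega
    · simp [heads, tails]
  | cons b bs ih' =>
    obtain ⟨g, S⟩ := b
    obtain ⟨h1, h2, h3⟩ := hg
    dsimp only at h1 h2 h3
    set sz : α → ℕ := fun a => (n + 1) * z a with hsz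
    obtain ⟨K, e, k1, k2, k3, k4⟩ := ih S h1
    have hszg : sz g = (n + 1) * z g := rfl
    -- The segment is placed at the base `c`; the record is kept or not.
    have key : ∀ c r', r' ≤ q → c ≤ x + sz g →
        c + e ∈ sums (units n z) ((q - r' + 1) * (M + 1)) →
        (∀ t ∈ sums (units n z) M, c + t ∈ sums (units n z) ((q + 1) * (M + 1))) →
        ∃ K' e', Fits sz (sums (units n z) ((q + 1) * (M + 1))) (x + sz g) c
          (S ++ flat bs) K' e' ∧ e' ≤ x + total sz (flat ((g, S) :: bs)) ∧
          e' ∈ sums (units n z) ((q + 1) * (M + 1)) ∧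
          B * tails p ((g, S) :: bs) + B * heads p bs ≤
            B * total (fun k => p k.1) K' + C * tails p ((g, S) :: bs) + B * lost p q r' bs := by
      intro c r' hr' hc hce hct
      obtain ⟨K', e', l1, l2, l3, l4⟩ := ih' r' (x + sz g + total sz S) (c + e) hr' (by omega)
        hce h3
      have k1' := k1.shift hc hct
      refine ⟨_, e', (k1'.append le_rfl (by simpa using l1)), ?_, l3, ?_⟩
      · simp only [flat_cons, total_cons, total_append]; omega
      · have e1 : total (fun k : α × ℕ => p k.1) (K.map fun k => (k.1, c + k.2)) =
            total (fun k => p k.1) K := by simp [total, Function.comp_def]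
        rw [total_append, e1]
        simp only [tails, total_cons, mul_add] at l4 ⊢
        linarith
    cases r with
    | zero =>
      -- The new base is the multiple of `sz g` in the interval `[x, x + sz g)`.
      obtain ⟨m, hm1, hm2⟩ : ∃ m, x ≤ m * sz g ∧ m * sz g ≤ x + sz g := by
        rcases Nat.eq_zero_or_pos x with rfl | hx
        · exact ⟨0, by simp⟩
        · have hpos : 0 < sz g := Nat.mul_pos n.succ_pos (hz g)
          refine ⟨(x - 1) / sz g + 1, ?_, ?_⟩
          · have := Nat.lt_mul_div_succ (x - 1) hpos
            rw [mul_comm]; omega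
          · rw [add_mul, one_mul]; have := Nat.div_mul_le_self (x - 1) (sz g); omega
      have hmn : m ≤ n + 1 := by
        have hpos : 0 < sz g := Nat.mul_pos n.succ_pos (hz g)
        refine Nat.le_of_mul_le_mul_right (?_ : m * sz g ≤ (n + 1) * sz g) hpos
        rw [add_mul, one_mul]; simp only [hszg] at *; omega
      have hmU : m * sz g ∈ sums (units n z) 1 :=
        mem_sums_one ⟨g, m * (n + 1), by nlinarith, by simp only [hszg]; ring⟩
      obtain ⟨K', e', l1, l2, l3, l4⟩ := key (m * sz g) q le_rfl hm2
        (sums_mono (by simp; omega) (add_mem_sums hmU k3))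
        (fun t ht => sums_mono (by nlinarith) (add_mem_sums hmU ht))
      refine ⟨K', e', ?_, l2, l3, ?_⟩
      · rw [flat_cons]
        exact .skip (l1.anti (hxy.trans hm1))
      · simp only [heads, total_cons, lost, mul_add] at l4 ⊢
        linarith
    | succ r =>
      have hgU : sz g ∈ sums (units n z) 1 := mem_sums_one ⟨g, n + 1, by nlinarith, rfl⟩
      have hyg := add_mem_sums hy hgU
      have hqr : q - (r + 1) + 1 = q - r := by omega
      rw [hqr] at hyg
      have hqr' : (q - r) * (M + 1) ≤ q * (M + 1) := Nat.mul_le_mul_right _ (by omega)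
      obtain ⟨K', e', l1, l2, l3, l4⟩ := key (y + sz g) r (by omega) (by omega)
        (sums_mono (by nlinarith) (add_mem_sums hyg k3))
        (fun t ht => sums_mono (by nlinarith) (add_mem_sums hyg ht))
      refine ⟨(g, y + sz g) :: K', e', ?_, l2, l3, ?_⟩
      · rw [flat_cons]
        exact .keep le_rfl (by dsimp only; omega) (sums_mono (by nlinarith) hyg) l1
      · simp only [heads, total_cons, lost, mul_add] at l4 ⊢
        linarith

/-- The number of terms that suffice for recursion depth `D`. -/
def terms (q : ℕ) : ℕ → ℕ
  | 0 => 0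
  | D + 1 => (q + 1) * (terms q D + 1)

theorem terms_lt (q D : ℕ) : terms q D < 2 ^ ((q + 1) * D) := by
  induction D with
  | zero => simp [terms]
  | succ D ih =>
    have h : q + 2 ≤ 2 ^ (q + 1) := Nat.lt_two_pow_self
    rw [mul_add, pow_add, mul_one]
    simp only [terms]
    calc (q + 1) * (terms q D + 1) < (q + 2) * (terms q D + 1) := by nlinarith
      _ ≤ 2 ^ (q + 1) * 2 ^ ((q + 1) * D) := Nat.mul_le_mul h ih
      _ = _ := by ring

/-- At a loss of the fraction `1 / (q + 1) + 1 / D` of the profit, a stack can be rounded to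
boundedly many terms: either the records have at most the fraction `1 / D` of the profit, and all of
them are deleted, or every `(q + 1)`-st of them is deleted and the segments between them, which have
at most the fraction `1 - 1 / D`, are rounded with depth `D - 1`. -/
theorem exists_fits (hz : ∀ a, 0 < z a) (q D : ℕ) (L : List α) (hL : L.length ≤ n) :
    ∃ K e, Fits (fun a => (n + 1) * z a) (sums (units n z) (terms q D)) 0 0 L K e ∧
      e ≤ total (fun a => (n + 1) * z a) L ∧ e ∈ sums (units n z) (terms q D) ∧
      (q + 1) * D * total p L ≤
        (q + 1) * D * total (fun k => p k.1) K + (q + 1 + D) * total p L := by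
  induction D generalizing L with
  | zero =>
    have : ∀ x, Fits (fun a => (n + 1) * z a) (sums (units n z) (terms q 0)) x 0 L [] 0 := by
      clear hL
      induction L with
      | nil => exact fun x => .nil le_rfl
      | cons a L ih => exact fun x => .skip (ih _)
    exact ⟨[], 0, this 0, Nat.zero_le _, zero_mem_sums _ _, by simp⟩
  | succ D ih =>
    obtain ⟨bs, rfl, hbs⟩ := exists_grow n z L.length L 0 0 le_rfl (by omega) (by simp)
    rcases le_or_gt ((D + 1) * heads p bs) (total p (flat bs)) with h | h
    · obtain ⟨K, e, k1, k2, k3, k4⟩ := exists_fits_delete_heads n p hz bs 0 0 le_rfl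
        (zero_mem_sums _ _) hbs
      have h1 : 1 ≤ terms q (D + 1) := by simp only [terms]; nlinarith
      refine ⟨K, e, k1.mono (sums_mono h1), by simpa using k2, sums_mono h1 k3, ?_⟩
      rw [← k4]
      rw [total_flat] at h ⊢
      nlinarith [Nat.mul_le_mul_left (q + 1) h]
    · obtain ⟨r, hr, hlost⟩ := exists_lost_le p q bs
      obtain ⟨K, e, k1, k2, k3, k4⟩ := exists_fits_delete_some n p hz q (terms q D)
        ((q + 1) * D) (q + 1 + D) ih bs r 0 0 hr le_rfl (zero_mem_sums _ _) hbs
      refine ⟨K, e, k1, by simpa using k2, k3, ?_⟩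
      rw [total_flat] at h ⊢
      generalize heads p bs = G at *
      generalize tails p bs = S at *
      generalize lost p q r bs = l at *
      generalize total (fun k : α × ℕ => p k.1) K = k at *
      rcases Nat.eq_zero_or_pos D with rfl | hD
      · exfalso; omega
      · -- With `p = G + S` and `B = (q + 1) D`, `B` times the loss is at most `D G + (q + 1 + D) S`, and the
        -- case assumption `p < (D + 1) G`, that is `S < D G`, makes this small enough.
        refine Nat.le_of_mul_le_mul_left (?_ : D * _ ≤ D * _) hD
        zify at *
        have e1 := mul_le_mul_of_nonneg_left k4 (by positivity : (0 : ℤ) ≤ D + 1)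
        have e2 := mul_le_mul_of_nonneg_left hlost (by positivity : (0 : ℤ) ≤ D * (D + 1))
        have e3 : (0 : ℤ) ≤ (q + 1) * (D * G - S) := mul_nonneg (by positivity) (by linarith)
        nlinarith

end Rounding

end LPack

namespace LPack

open Set

/-! ### Feasible sets of items -/

namespace Instance

variable (I : Instance)

/-- The items of one of the two classes: `true` stands for the horizontal items. -/
def side (c : Bool) : Finset (Fin I.n) := if c then I.hor else I.horᶜ

/-- The class of an item. -/
def cls (i : Fin I.n) : Bool := decide (i ∈ I.hor)

/-- The long side of an item. -/
def key (i : Fin I.n) : ℕ := if i ∈ I.hor then I.w i else I.h i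

/-- The short side of an item, in whose direction the items of its class are stacked. -/
def size (i : Fin I.n) : ℕ := if i ∈ I.hor then I.h i else I.w i

/-- The thickness of the box of a class. -/
def cap (c : Bool) : ℕ := if c then I.hL else I.wL

/-- A number that orders the items by their long sides, with ties broken by the index. -/
def ord (i : Fin I.n) : ℕ := (I.n + 1) * I.key i + (I.n - i)

/-- The total thickness of the items of `M` of the class of `i` up to and including `i`, when they
are stacked in descending order. -/
def load (M : Finset (Fin I.n)) (i : Fin I.n) : ℕ :=
  ∑ a ∈ M with I.cls a = I.cls i ∧ I.ord i ≤ I.ord a, I.size a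

/-- The items of `M` form an L-packing when each class is stacked without gaps in descending order
of the long sides: the stacks fit into their boxes, and items of different classes do not meet. -/
structure Feas (M : Finset (Fin I.n)) : Prop where
  key_le : ∀ i ∈ M, I.key i ≤ I.N
  sum_le : ∀ c, ∑ i ∈ M ∩ I.side c, I.size i ≤ I.cap c
  cross : ∀ i ∈ M, ∀ j ∈ M, I.cls i ≠ I.cls j →
    I.load M j + I.key i ≤ I.N ∨ I.load M i + I.key j ≤ I.N

variable {I}

theorem mem_side {c : Bool} {i : Fin I.n} : i ∈ I.side c ↔ I.cls i = c := by
  cases c <;> simp [side, cls]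

theorem size_pos (i : Fin I.n) : 0 < I.size i := by
  unfold size; split_ifs
  exacts [I.h_pos i, I.w_pos i]

theorem lt_two_mul_key (i : Fin I.n) : I.N < 2 * I.key i := by
  unfold key; split_ifs with h
  exacts [I.wide i h, I.tall i h]

theorem cap_le (c : Bool) : I.cap c ≤ I.N := by
  cases c
  exacts [I.wL_le, I.hL_le]

theorem ord_injective : Function.Injective I.ord := by
  intro i j h
  have hi := i.2
  have hj := j.2
  unfold ord at h
  have hk : I.key i = I.key j := by
    by_contra hne
    rcases Nat.lt_or_gt_of_ne hne with h' | h'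
    · have := Nat.mul_le_mul_left (I.n + 1) (Nat.succ_le_of_lt h')
      rw [Nat.succ_eq_add_one, mul_add] at this; omega
    · have := Nat.mul_le_mul_left (I.n + 1) (Nat.succ_le_of_lt h')
      rw [Nat.succ_eq_add_one, mul_add] at this; omega
  rw [hk] at h
  exact Fin.ext (by omega)

theorem key_le_of_ord_le {i j : Fin I.n} (h : I.ord i ≤ I.ord j) : I.key i ≤ I.key j := by
  have hi := i.2
  have hj := j.2
  by_contra hne
  unfold ord at h
  have := Nat.mul_le_mul_left (I.n + 1) (Nat.succ_le_of_lt (not_le.1 hne))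
  rw [Nat.succ_eq_add_one, mul_add] at this
  omega

end Instance

namespace Placement

variable {I : Instance} (Q : Placement I)

/-- The coordinate of an item in the direction in which its class is stacked. -/
def across (c : Bool) (i : Fin I.n) : ℝ := if c then Q.bottom i else Q.left i

/-- The coordinate of an item in the direction of the long sides of its class. -/
def along (c : Bool) (i : Fin I.n) : ℝ := if c then Q.left i else Q.bottom i

variable {Q}

theorem Ioo_subset_Icc {a b c d : ℝ} (hab : a < b) : Ioo a b ⊆ Icc c d ↔ c ≤ a ∧ b ≤ d := by
  constructor
  · intro h
    have := closure_mono h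
    rw [closure_Ioo hab.ne, isClosed_Icc.closure_eq, Icc_subset_Icc_iff hab.le] at this
    exact this
  · rintro ⟨h1, h2⟩
    exact Ioo_subset_Icc_self.trans (Icc_subset_Icc h1 h2)

theorem left_lt_right (i : Fin I.n) : Q.left i < Q.right i := by
  have := I.w_pos i
  simp [right, this]

theorem bottom_lt_top (i : Fin I.n) : Q.bottom i < Q.top i := by
  have := I.h_pos i
  simp [top, this]

theorem rect_subset (i : Fin I.n) {a b c d : ℝ} : Q.rect i ⊆ Icc a b ×ˢ Icc c d ↔
    (a ≤ Q.left i ∧ Q.right i ≤ b) ∧ c ≤ Q.bottom i ∧ Q.top i ≤ d := by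
  unfold rect
  rw [prod_subset_prod_iff, Ioo_subset_Icc (left_lt_right i), Ioo_subset_Icc (bottom_lt_top i)]
  simp [Ioo_eq_empty_iff, left_lt_right i, bottom_lt_top i]

theorem rect_disjoint (i j : Fin I.n) : Disjoint (Q.rect i) (Q.rect j) ↔
    (Q.right i ≤ Q.left j ∨ Q.right j ≤ Q.left i) ∨
      (Q.top i ≤ Q.bottom j ∨ Q.top j ≤ Q.bottom i) := by
  have h1 := left_lt_right (Q := Q) i
  have h2 := left_lt_right (Q := Q) j
  have h3 := bottom_lt_top (Q := Q) i
  have h4 := bottom_lt_top (Q := Q) j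
  unfold rect
  rw [disjoint_prod, Ioo_disjoint_Ioo, Ioo_disjoint_Ioo]
  simp only [min_le_iff, le_max_iff, h1.not_ge, h2.not_ge, h3.not_ge, h4.not_ge, false_or,
    or_false]
  tauto

/-- The position of a packed item in its box. -/
theorem IsBoxPacking.bounds (hQ : Q.IsBoxPacking) {i : Fin I.n} (hi : i ∈ Q.items) :
    0 ≤ Q.along (I.cls i) i ∧ Q.along (I.cls i) i + I.key i ≤ I.N ∧
      0 ≤ Q.across (I.cls i) i ∧ Q.across (I.cls i) i + I.size i ≤ I.cap (I.cls i) := by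
  by_cases h : i ∈ I.hor
  · have := (rect_subset i).1 (hQ.hor_box i hi h)
    simp only [right, top] at this
    simp [Instance.cls, Instance.key, Instance.size, Instance.cap, along, across, h]
    tauto
  · have := (rect_subset i).1 (hQ.ver_box i hi h)
    simp only [right, top] at this
    simp [Instance.cls, Instance.key, Instance.size, Instance.cap, along, across, h]
    tauto

/-- Items of the same class do not overlap in the direction in which they are stacked, since in
the other direction they all cross the middle. -/
theorem IsBoxPacking.same (hQ : Q.IsBoxPacking) {i j : Fin I.n} (hi : i ∈ Q.items)
    (hj : j ∈ Q.items) (hij : i ≠ j) {c : Bool} (hci : I.cls i = c) (hcj : I.cls j = c) :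
    Q.across c i + I.size i ≤ Q.across c j ∨ Q.across c j + I.size j ≤ Q.across c i := by
  have h1 := hQ.bounds hi
  have h2 := hQ.bounds hj
  have h3 : (I.N : ℝ) < 2 * I.key i := by exact_mod_cast Instance.lt_two_mul_key i
  have h4 : (I.N : ℝ) < 2 * I.key j := by exact_mod_cast Instance.lt_two_mul_key j
  have h5 := (rect_disjoint i j).1 (hQ.disj i hi j hj hij)
  rw [hci] at h1
  rw [hcj] at h2
  cases c
  · have hi' : i ∉ I.hor := by simpa [Instance.cls] using hci
    have hj' : j ∉ I.hor := by simpa [Instance.cls] using hcj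
    simp only [along, across, Instance.key, Instance.size, hi', hj', if_false, right, top,
      Bool.false_eq_true] at *
    rcases h5 with h5 | h5 | h5
    · exact h5
    all_goals exfalso; linarith
  · have hi' : i ∈ I.hor := by simpa [Instance.cls] using hci
    have hj' : j ∈ I.hor := by simpa [Instance.cls] using hcj
    simp only [along, across, Instance.key, Instance.size, hi', hj', if_true, right, top] at *
    rcases h5 with (h5 | h5) | h5
    iterate 2 exfalso; linarith
    exact h5

/-- Items of different classes are separated in one of the two directions. -/
theorem IsBoxPacking.different (hQ : Q.IsBoxPacking) {i j : Fin I.n} (hi : i ∈ Q.items)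
    (hj : j ∈ Q.items) {c : Bool} (hci : I.cls i = c) (hcj : I.cls j = !c) :
    (Q.across c i + I.size i ≤ Q.along (!c) j ∨ Q.along (!c) j + I.key j ≤ Q.across c i) ∨
      (Q.across (!c) j + I.size j ≤ Q.along c i ∨ Q.along c i + I.key i ≤ Q.across (!c) j) := by
  have hij : i ≠ j := by
    rintro rfl
    cases c <;> simp_all
  have h5 := (rect_disjoint i j).1 (hQ.disj i hi j hj hij)
  cases c
  · have hi' : i ∉ I.hor := by simpa [Instance.cls] using hci
    have hj' : j ∈ I.hor := by simpa [Instance.cls] using hcj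
    simp only [along, across, Instance.key, Instance.size, hi', hj', if_false, if_true, right, top,
      Bool.false_eq_true, Bool.not_false] at *
    tauto
  · have hi' : i ∈ I.hor := by simpa [Instance.cls] using hci
    have hj' : j ∉ I.hor := by simpa [Instance.cls] using hcj
    simp only [along, across, Instance.key, Instance.size, hi', hj', if_false, if_true, right, top,
      Bool.false_eq_true, Bool.not_true] at *
    tauto

/-- Disjoint intervals to the right of `0` reach at least as far as their total length. -/
theorem exists_sum_le {ι : Type*} (S : Finset ι) (hS : S.Nonempty) (f : ι → ℝ)
    (len : ι → ℕ) (hlen : ∀ i ∈ S, 0 < len i) (h0 : ∀ i ∈ S, 0 ≤ f i)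
    (hd : ∀ i ∈ S, ∀ j ∈ S, i ≠ j → f i + len i ≤ f j ∨ f j + len j ≤ f i) :
    ∃ i ∈ S, ((∑ j ∈ S, len j : ℕ) : ℝ) ≤ f i + len i := by
  classical
  induction S using Finset.induction_on_max_value f with
  | empty => exact absurd hS (by simp)
  | insert a s ha hmax ih =>
    refine ⟨a, by simp, ?_⟩
    rw [Finset.sum_insert ha]
    rcases s.eq_empty_or_nonempty with rfl | hs
    · simpa using h0 a (by simp)
    · obtain ⟨j, hj, hsum⟩ := ih hs (fun i hi => hlen i (by simp [hi]))
        (fun i hi => h0 i (by simp [hi])) (fun i hi j hj => hd i (by simp [hi]) j (by simp [hj]))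
      have hja : f j + len j ≤ f a := by
        rcases hd j (by simp [hj]) a (by simp) (by rintro rfl; exact ha hj) with h | h
        · exact h
        · have : (0 : ℝ) < len a := by exact_mod_cast hlen a (by simp)
          linarith [hmax j hj]
      push_cast at hsum ⊢
      linarith

/-- In a packing, one of the items up to `i` in the order of the stack reaches at least as far as
`i` does when the items are stacked without gaps. Its long side is at least that of `i`. -/
theorem IsBoxPacking.exists_load_le (hQ : Q.IsBoxPacking) {i : Fin I.n} (hi : i ∈ Q.items)
    {c : Bool} (hc : I.cls i = c) : ∃ a ∈ Q.items, I.cls a = c ∧ I.ord i ≤ I.ord a ∧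
      (I.load Q.items i : ℝ) ≤ Q.across c a + I.size a := by
  obtain ⟨a, ha, h⟩ := exists_sum_le {a ∈ Q.items | I.cls a = I.cls i ∧ I.ord i ≤ I.ord a}
    ⟨i, by simp [hi]⟩ (Q.across c) I.size (fun a _ => Instance.size_pos a)
    (fun a ha => by
      simp only [Finset.mem_filter] at ha
      have := (hQ.bounds ha.1).2.2.1
      rwa [ha.2.1, hc] at this)
    (fun a ha b hb hab => by
      simp only [Finset.mem_filter] at ha hb
      exact hQ.same ha.1 hb.1 hab (ha.2.1.trans hc) (hb.2.1.trans hc))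
  simp only [Finset.mem_filter] at ha
  exact ⟨a, ha.1, ha.2.1.trans hc, ha.2.2, h⟩

/-- In any packing of the boxes, the stacks fit into their boxes. So only the inequalities on items
of different classes remain to be shown for L-packings and for packings with a thin box. -/
theorem IsBoxPacking.feas (hQ : Q.IsBoxPacking)
    (h : ∀ i ∈ Q.items, ∀ j ∈ Q.items, I.cls i ≠ I.cls j →
      I.load Q.items j + I.key i ≤ I.N ∨ I.load Q.items i + I.key j ≤ I.N) :
    I.Feas Q.items := by
  refine ⟨fun i hi => ?_, fun c => ?_, h⟩
  · have := hQ.bounds hi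
    have h2 : (I.key i : ℝ) ≤ I.N := by linarith
    exact_mod_cast h2
  · rcases (Q.items ∩ I.side c).eq_empty_or_nonempty with h0 | h0
    · simp [h0]
    · have hm : ∀ i ∈ Q.items ∩ I.side c, i ∈ Q.items ∧ I.cls i = c := by
        intro i hi
        rwa [Finset.mem_inter, Instance.mem_side] at hi
      obtain ⟨i, hi, hs⟩ := exists_sum_le _ h0 (Q.across c) I.size
        (fun a _ => Instance.size_pos a)
        (fun a ha => by
          have := (hQ.bounds (hm a ha).1).2.2.1
          rwa [(hm a ha).2] at this)
        (fun a ha b hb hab => hQ.same (hm a ha).1 (hm b hb).1 hab (hm a ha).2 (hm b hb).2)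
      have := (hQ.bounds (hm i hi).1).2.2.2
      rw [(hm i hi).2] at this
      exact_mod_cast hs.trans this

/-- The item reaching the load of `i` and the one reaching the load of `j` are separated as the
definition of an L-packing demands, and they are at least as long as `i` and `j`. -/
theorem IsLPacking.feas (hQ : Q.IsLPacking) : I.Feas Q.items := by
  refine hQ.toIsBoxPacking.feas ?_
  have key : ∀ i ∈ Q.items, ∀ j ∈ Q.items, I.cls i = true → I.cls j = false →
      I.load Q.items j + I.key i ≤ I.N ∨ I.load Q.items i + I.key j ≤ I.N := by
    intro i hi j hj hci hcj
    obtain ⟨a, ha, hca, hia, hla⟩ := hQ.exists_load_le hi hci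
    obtain ⟨b, hb, hcb, hjb, hlb⟩ := hQ.exists_load_le hj hcj
    have hba := hQ.bounds ha
    have hbb := hQ.bounds hb
    have hka : (I.key i : ℝ) ≤ I.key a := by exact_mod_cast Instance.key_le_of_ord_le hia
    have hkb : (I.key j : ℝ) ≤ I.key b := by exact_mod_cast Instance.key_le_of_ord_le hjb
    rw [hca] at hba
    rw [hcb] at hbb
    have ha' : a ∈ I.hor := by simpa [Instance.cls] using hca
    have hb' : b ∉ I.hor := by simpa [Instance.cls] using hcb
    have harr := hQ.arranged a ha ha' b hb hb'
    have hsa : I.size a = I.h a := by simp [Instance.size, ha']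
    have hsb : I.size b = I.w b := by simp [Instance.size, hb']
    simp only [across, along, if_true, Bool.false_eq_true, if_false, right, top, hsa, hsb] at *
    rcases harr with h | h
    · left
      have : (I.load Q.items j : ℝ) + I.key i ≤ I.N := by linarith
      exact_mod_cast this
    · right
      have : (I.load Q.items i : ℝ) + I.key j ≤ I.N := by linarith
      exact_mod_cast this
  intro i hi j hj hij
  cases hci : I.cls i <;> cases hcj : I.cls j
  · simp_all
  · exact (key j hj i hi hcj hci).symm
  · exact key i hi j hj hci hcj
  · simp_all

/-- Let `a` be the item that reaches the load of `i`, in a thin box. An item of the other class cannot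
end before `a` begins, because its long side exceeds `N / 2`. If the load of `i` and the long side
of `j` exceed `N`, then no item up to `j` can begin after the end of `a` either. So all these items
are beside `a`, and their sizes and the long side of `a` add up to at most `N`. -/
theorem IsBoxPacking.feas_of_thin (hQ : Q.IsBoxPacking) {c : Bool} (hc : 2 * I.cap c ≤ I.N) :
    I.Feas Q.items := by
  refine hQ.feas ?_
  have key : ∀ i ∈ Q.items, ∀ j ∈ Q.items, I.cls i = c → I.cls j = !c →
      I.load Q.items j + I.key i ≤ I.N ∨ I.load Q.items i + I.key j ≤ I.N := by
    intro i hi j hj hci hcj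
    obtain ⟨a, ha, hca, hia, hla⟩ := hQ.exists_load_le hi hci
    have hba := hQ.bounds ha
    rw [hca] at hba
    have hka : (I.key i : ℝ) ≤ I.key a := by exact_mod_cast Instance.key_le_of_ord_le hia
    by_contra! hcon
    have hcon2 : (I.N : ℝ) < I.load Q.items i + I.key j := by exact_mod_cast hcon.2
    have hcap : 2 * (I.cap c : ℝ) ≤ I.N := by exact_mod_cast hc
    -- No item up to `j` is before or after `a` in the direction of its own long side.
    have hbeside : ∀ b ∈ Q.items, I.cls b = (!c) → I.ord j ≤ I.ord b →
        Q.across (!c) b + I.size b ≤ Q.along c a ∨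
          Q.along c a + I.key a ≤ Q.across (!c) b := by
      intro b hb hcb hjb
      have hbb := hQ.bounds hb
      rw [hcb] at hbb
      have hkb : (I.key j : ℝ) ≤ I.key b := by exact_mod_cast Instance.key_le_of_ord_le hjb
      have hb2 : (I.N : ℝ) < 2 * I.key b := by exact_mod_cast Instance.lt_two_mul_key b
      rcases hQ.different ha hb hca hcb with (h | h) | h
      · exfalso; linarith
      · exfalso
        have : (0 : ℝ) ≤ I.size a := Nat.cast_nonneg _
        linarith
      · exact h
    set B : Finset (Fin I.n) := {b ∈ Q.items | I.cls b = I.cls j ∧ I.ord j ≤ I.ord b} with hB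
    have hBm : ∀ b ∈ B, b ∈ Q.items ∧ I.cls b = (!c) ∧ I.ord j ≤ I.ord b := by
      intro b hb
      rw [hB, Finset.mem_filter] at hb
      exact ⟨hb.1, hb.2.1.trans hcj, hb.2.2⟩
    obtain ⟨o, ho, hsum⟩ := exists_sum_le (Finset.insertNone B)
      ⟨none, Finset.mem_insertNone.2 (by simp)⟩
      (fun o : Option (Fin I.n) => o.elim (Q.along c a) (Q.across (!c)))
      (fun o : Option (Fin I.n) => o.elim (I.key a) I.size)
      (by
        rintro (_ | b) ho
        · have := Instance.lt_two_mul_key a; dsimp only [Option.elim]; omega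
        · exact Instance.size_pos b)
      (by
        rintro (_ | b) ho
        · exact hba.1
        · have hb := hBm b (by simpa using ho)
          have := (hQ.bounds hb.1).2.2.1
          rwa [hb.2.1] at this)
      (by
        rintro (_ | b) hb (_ | b') hb' hne
        · exact absurd rfl hne
        · have h := hBm b' (by simpa using hb')
          exact (hbeside b' h.1 h.2.1 h.2.2).symm
        · have h := hBm b (by simpa using hb)
          exact hbeside b h.1 h.2.1 h.2.2
        · have h := hBm b (by simpa using hb)
          have h' := hBm b' (by simpa using hb')
          exact hQ.same h.1 h'.1 (by rintro rfl; exact hne rfl) h.2.1 h'.2.1)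
    have hle : o.elim (Q.along c a) (Q.across (!c)) + (o.elim (I.key a) I.size : ℕ) ≤ (I.N : ℝ) := by
      rcases o with _ | b
      · exact hba.2.1
      · have hb := hBm b (by simpa using ho)
        have h1 := (hQ.bounds hb.1).2.2.2
        have h2 : (I.cap (!c) : ℝ) ≤ I.N := by exact_mod_cast Instance.cap_le _
        rw [hb.2.1] at h1
        exact h1.trans h2
    have htot : I.key a + I.load Q.items j ≤ I.N := by
      have h3 := hsum.trans hle
      rw [Finset.sum_insertNone] at h3
      exact_mod_cast h3
    have : I.key i ≤ I.key a := Instance.key_le_of_ord_le hia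
    omega
  intro i hi j hj hij
  by_cases hci : I.cls i = c
  · refine key i hi j hj hci ?_
    rw [← hci]; cases h1 : I.cls i <;> cases h2 : I.cls j <;> simp_all
  · have hcj : I.cls j = c := by
      cases h1 : I.cls i <;> cases h2 : I.cls j <;> cases c <;> simp_all
    refine (key j hj i hi hcj ?_).symm
    cases h1 : I.cls i <;> cases c <;> simp_all

/-- The stacks of a feasible set of items, one at the bottom right, the other at the top left. -/
theorem isLPacking_of_feas (h : I.Feas Q.items)
    (hacross : ∀ i ∈ Q.items, Q.across (I.cls i) i + I.size i = I.load Q.items i)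
    (halong : ∀ i ∈ Q.items, Q.along (I.cls i) i + I.key i = I.N) : Q.IsLPacking := by
  have hsize : ∀ i ∈ Q.items, I.size i ≤ I.load Q.items i := fun i hi =>
    Finset.single_le_sum (f := I.size) (fun _ _ => Nat.zero_le _) (by simp [hi])
  have hload : ∀ i ∈ Q.items, I.load Q.items i ≤ I.cap (I.cls i) := fun i hi =>
    (Finset.sum_le_sum_of_subset (by
      intro a ha
      simp only [Finset.mem_filter] at ha
      rw [Finset.mem_inter, Instance.mem_side]
      exact ⟨ha.1, ha.2.1⟩)).trans (h.sum_le (I.cls i))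
  have hstep : ∀ i ∈ Q.items, ∀ j, I.cls i = I.cls j → I.ord i < I.ord j →
      I.load Q.items j + I.size i ≤ I.load Q.items i := by
    intro i hi j hij hlt
    unfold Instance.load
    rw [add_comm, ← Finset.sum_insert (by simp [hlt])]
    refine Finset.sum_le_sum_of_subset ?_
    intro a ha
    simp only [Finset.mem_insert, Finset.mem_filter] at ha ⊢
    rcases ha with rfl | ⟨h1, h2, h3⟩
    · exact ⟨hi, rfl, le_rfl⟩
    · exact ⟨h1, h2.trans hij.symm, hlt.le.trans h3⟩
  have hbox : ∀ i ∈ Q.items, 0 ≤ Q.along (I.cls i) i ∧ Q.along (I.cls i) i + I.key i ≤ I.N ∧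
      0 ≤ Q.across (I.cls i) i ∧ Q.across (I.cls i) i + I.size i ≤ I.cap (I.cls i) := by
    intro i hi
    have h1 : (I.key i : ℝ) ≤ I.N := by exact_mod_cast h.key_le i hi
    have h2 : (I.size i : ℝ) ≤ I.load Q.items i := by exact_mod_cast hsize i hi
    have h3 : (I.load Q.items i : ℝ) ≤ I.cap (I.cls i) := by exact_mod_cast hload i hi
    have h4 := hacross i hi
    have h5 := halong i hi
    refine ⟨by linarith, h5.le, by linarith, by linarith⟩
  have harr : ∀ i ∈ Q.items, i ∈ I.hor → ∀ j ∈ Q.items, j ∉ I.hor →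
      Q.right j ≤ Q.left i ∨ Q.top i ≤ Q.bottom j := by
    intro i hi hih j hj hjh
    have h1 := hacross i hi
    have h2 := hacross j hj
    have h3 := halong i hi
    have h4 := halong j hj
    have h5 := h.cross i hi j hj (by simp [Instance.cls, hih, hjh])
    simp only [across, along, Instance.cls, Instance.key, Instance.size, hih, hjh, decide_true,
      decide_false, if_true, if_false, Bool.false_eq_true, right, top] at *
    rcases h5 with h5 | h5
    · left
      have : (I.load Q.items j : ℝ) + I.w i ≤ I.N := by exact_mod_cast h5
      linarith
    · right
      have : (I.load Q.items i : ℝ) + I.h j ≤ I.N := by exact_mod_cast h5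
      linarith
  refine ⟨⟨?_, ?_, ?_⟩, harr⟩
  · intro i hi hih
    have h1 := hbox i hi
    rw [rect_subset]
    simp only [across, along, Instance.cls, Instance.key, Instance.size, Instance.cap, hih,
      decide_true, if_true, right, top] at *
    tauto
  · intro i hi hih
    have h1 := hbox i hi
    rw [rect_subset]
    simp only [across, along, Instance.cls, Instance.key, Instance.size, Instance.cap, hih,
      decide_false, if_false, Bool.false_eq_true, right, top] at *
    tauto
  · have hsame : ∀ i ∈ Q.items, ∀ j ∈ Q.items, I.cls i = I.cls j → I.ord i < I.ord j →
        Q.across (I.cls i) j + I.size j ≤ Q.across (I.cls i) i := by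
      intro i hi j hj hij hlt
      have h1 := hacross i hi
      have h2 := hacross j hj
      have h3 : (I.load Q.items j : ℝ) + I.size i ≤ I.load Q.items i := by
        exact_mod_cast hstep i hi j hij hlt
      rw [← hij] at h2
      linarith
    intro i hi j hj hij
    rw [rect_disjoint]
    by_cases hih : i ∈ I.hor <;> by_cases hjh : j ∈ I.hor
    · have h1 := hsame i hi j hj
      have h2 := hsame j hj i hi
      simp only [across, Instance.cls, Instance.size, hih, hjh, decide_true, if_true, right, top,
        forall_true_left] at *
      rcases lt_or_gt_of_ne (fun h => hij (Instance.ord_injective h)) with h | h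
      · exact .inr (.inr (h1 h))
      · exact .inr (.inl (h2 h))
    · rcases harr i hi hih j hj hjh with h | h
      · exact .inl (.inr h)
      · exact .inr (.inl h)
    · rcases harr j hj hjh i hi hih with h | h
      · exact .inl (.inl h)
      · exact .inr (.inr h)
    · have h1 := hsame i hi j hj
      have h2 := hsame j hj i hi
      simp only [across, Instance.cls, Instance.size, hih, hjh, decide_false, if_false,
        Bool.false_eq_true, right, top, forall_true_left] at *
      rcases lt_or_gt_of_ne (fun h => hij (Instance.ord_injective h)) with h | h
      · exact .inl (.inr (h1 h))
      · exact .inl (.inl (h2 h))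

end Placement

end LPack

namespace LPack

/-! ### The graph of partial packings -/

/-- The array of the current items of a class. -/
def itemA (c : Bool) : ℕ := bif c then 12 else 13

/-- The array of the current tops of a class. -/
def topA (c : Bool) : ℕ := bif c then 14 else 15

/-- The array of the positions of the items in the order of a class. -/
def ordA (c : Bool) : ℕ := bif c then 9 else 10

/-- The register that holds the scaled thickness of the box of a class. -/
def capR (c : Bool) : ℕ := bif c then 11 else 12

/-- The preprocessed instance in memory. All lengths are scaled by `n + 1`. Index `n` stands for a
dummy item of size `0` that comes before all items of both classes, and index `n + 1` for one that
comes after them. An item is not available in the order of the other class: there, its position is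
that of the first dummy. -/
structure Ctx (I : Instance) (σ : Store) : Prop where
  key : ∀ a : Fin I.n, σ.arr 7 (a : ℕ) = (I.n + 1) * I.key a
  key_start : σ.arr 7 I.n = (I.n + 1) * I.N
  key_end : σ.arr 7 (I.n + 1) = 0
  size : ∀ a : Fin I.n, σ.arr 8 (a : ℕ) = (I.n + 1) * I.size a
  size_end : σ.arr 8 (I.n + 1) = 0
  ord : ∀ c, ∀ a : Fin I.n, σ.arr (ordA c) (a : ℕ) =
    if I.cls a = c then (I.ord a : ℤ) else (I.n + 1) * I.N + I.n + 1
  ord_start : ∀ c, σ.arr (ordA c) I.n = (I.n + 1) * I.N + I.n + 1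
  ord_end : ∀ c, σ.arr (ordA c) (I.n + 1) = 0
  profit : ∀ a : Fin I.n, σ.arr 2 (a : ℕ) = I.p a
  profit_end : σ.arr 2 (I.n + 1) = 0
  cap : ∀ c, σ.reg (capR c) = (I.n + 1) * I.cap c
  width : σ.reg 10 = (I.n + 1) * I.N

/-- The indices of the vertices. -/
def Vtx (σ : Store) (q : ℤ) : Prop := 0 ≤ q ∧ q < σ.reg 16

/-- From vertex `q`, the stack of class `c` is extended by an item. The last inequality says that
the current item of class `c` does not meet the present and the future items of the other class. -/
def Edge (σ : Store) (c : Bool) (q q' : ℤ) : Prop :=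
  σ.arr (itemA !c) q' = σ.arr (itemA !c) q ∧
  σ.arr (topA !c) q' = σ.arr (topA !c) q ∧
  σ.arr (ordA c) (σ.arr (itemA c) q') + 1 ≤ σ.arr (ordA c) (σ.arr (itemA c) q) ∧
  σ.arr (topA c) q + σ.arr 8 (σ.arr (itemA c) q') ≤ σ.arr (topA c) q' ∧
  σ.arr (topA c) q' ≤ σ.reg (capR c) ∧
  σ.arr (topA c) q + σ.arr 7 (σ.arr (itemA !c) q) ≤ σ.reg 10

/-- The profit of the item that is added when class `c` moves to the vertex `q`. -/
def gain (σ : Store) (c : Bool) (q : ℤ) : ℤ := σ.arr 2 (σ.arr (itemA c) q)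

/-- The vertices in memory: pairs of current items and pairs of current tops. They include the
vertex `0` where nothing is packed, and all combinations of tops from the set `T`. -/
structure Verts (I : Instance) (σ : Store) (T : Set ℤ) : Prop where
  range : ∀ c q, Vtx σ q → 0 ≤ σ.arr (itemA c) q ∧ σ.arr (itemA c) q ≤ I.n + 1
  pos : 0 < σ.reg 16
  start : ∀ c, σ.arr (itemA c) 0 = I.n ∧ σ.arr (topA c) 0 = 0
  complete : ∀ f g : Bool → ℤ, (∀ c, 0 ≤ f c ∧ f c ≤ I.n + 1) → (∀ c, g c ∈ T) →
    ∃ q, Vtx σ q ∧ ∀ c, σ.arr (itemA c) q = f c ∧ σ.arr (topA c) q = g c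

theorem index_cases {n : ℕ} {x : ℤ} (h : 0 ≤ x ∧ x ≤ n + 1) :
    (∃ a : Fin n, x = (a : ℕ)) ∨ x = n ∨ x = n + 1 := by
  obtain ⟨y, rfl⟩ := Int.eq_ofNat_of_zero_le h.1
  by_cases hy : y < n
  · exact .inl ⟨⟨y, hy⟩, rfl⟩
  · right; omega

/-- What is known of the set `M` that has been packed when the vertex `q` is reached. The inequalities
of `Instance.Feas` between items of different classes hold for all pairs except possibly the pair of
the two current items. A packed item that is no longer current does not meet the current item of
the other class (`resolved`), nor therefore any later one. -/
structure Trace (I : Instance) (σ : Store) (M : Finset (Fin I.n)) (q : ℤ) : Prop where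
  cur : ∀ c, ∀ a : Fin I.n, ((a : ℕ) : ℤ) = σ.arr (itemA c) q → a ∈ M ∧ I.cls a = c
  ord_le : ∀ a ∈ M, σ.arr (ordA (I.cls a)) (σ.arr (itemA (I.cls a)) q) ≤ I.ord a
  ord_le_start : ∀ c, σ.arr (ordA c) (σ.arr (itemA c) q) ≤ (I.n + 1) * I.N + I.n + 1
  key_le : ∀ a ∈ M, I.key a ≤ I.N
  sum_le : ∀ c, (I.n + 1 : ℤ) * (∑ a ∈ M ∩ I.side c, I.size a : ℕ) ≤ σ.arr (topA c) q
  le_cap : ∀ c, σ.arr (topA c) q ≤ (I.n + 1) * I.cap c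
  resolved : ∀ a ∈ M, ((a : ℕ) : ℤ) ≠ σ.arr (itemA (I.cls a)) q →
    (I.n + 1 : ℤ) * I.load M a + σ.arr 7 (σ.arr (itemA !(I.cls a)) q) ≤ (I.n + 1) * I.N
  cross : ∀ a ∈ M, ∀ b ∈ M, I.cls b = (!I.cls a) →
    (((a : ℕ) : ℤ) ≠ σ.arr (itemA (I.cls a)) q ∨ ((b : ℕ) : ℤ) ≠ σ.arr (itemA (I.cls b)) q) →
    I.load M b + I.key a ≤ I.N ∨ I.load M a + I.key b ≤ I.N

namespace Trace

variable {I : Instance} {σ : Store} {T : Set ℤ} {M : Finset (Fin I.n)} {q q' : ℤ} {c : Bool}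

theorem start (hC : Ctx I σ) (hV : Verts I σ T) : Trace I σ ∅ 0 where
  cur c a h := by
    rw [(hV.start c).1] at h
    have := a.2
    omega
  ord_le := by simp
  ord_le_start c := by rw [(hV.start c).1, hC.ord_start]
  key_le := by simp
  sum_le c := by simp [(hV.start c).2]
  le_cap c := by rw [(hV.start c).2]; positivity
  resolved := by simp
  cross := by simp

/-- At the end, everything that has been packed is feasible. -/
theorem feas (h : Trace I σ M q) (hq : ∀ c, σ.arr (itemA c) q = I.n + 1) : I.Feas M where
  key_le := h.key_le
  sum_le c := by
    have h1 := (h.sum_le c).trans (h.le_cap c)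
    have h2 := le_of_mul_le_mul_left h1 (by positivity)
    exact_mod_cast h2
  cross a ha b hb hab := by
    refine h.cross a ha b hb ?_ (.inl ?_)
    · cases h1 : I.cls a <;> cases h2 : I.cls b <;> simp_all
    · rw [hq]; have := a.2; omega

/-- The item added by an edge comes later in its class than all packed items. -/
theorem edge_item (hC : Ctx I σ) (h : Trace I σ M q) (he : Edge σ c q q')
    (hr : 0 ≤ σ.arr (itemA c) q' ∧ σ.arr (itemA c) q' ≤ I.n + 1) :
    σ.arr (itemA c) q' = I.n + 1 ∨ ∃ a : Fin I.n, σ.arr (itemA c) q' = (a : ℕ) ∧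
      I.cls a = c ∧ I.key a ≤ I.N ∧ (I.ord a : ℤ) < σ.arr (ordA c) (σ.arr (itemA c) q) := by
  have h1 := he.2.2.1
  have h2 := h.ord_le_start c
  rcases index_cases hr with ⟨a, ha⟩ | ha | ha
  · right
    rw [ha, hC.ord] at h1
    have hca : I.cls a = c := by
      by_contra hne
      rw [if_neg hne] at h1
      omega
    rw [if_pos hca] at h1
    refine ⟨a, ha, hca, ?_, by omega⟩
    by_contra hlt
    have h3 : (I.n + 1) * (I.N + 1) ≤ (I.n + 1) * I.key a := Nat.mul_le_mul_left _ (by omega)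
    have h4 : (I.ord a : ℤ) + 1 ≤ (I.n + 1) * I.N + I.n + 1 := h1.trans h2
    have h5 : I.ord a + 1 ≤ (I.n + 1) * I.N + I.n + 1 := by exact_mod_cast h4
    rw [mul_add] at h3
    unfold Instance.ord at h5
    omega
  · rw [ha, hC.ord_start] at h1; omega
  · exact .inl ha

/-- Along an edge, the long side of the current item does not increase. -/
theorem key_anti (hC : Ctx I σ) (h : Trace I σ M q) (he : Edge σ c q q')
    (hr : 0 ≤ σ.arr (itemA c) q' ∧ σ.arr (itemA c) q' ≤ I.n + 1)
    (hr' : 0 ≤ σ.arr (itemA c) q ∧ σ.arr (itemA c) q ≤ I.n + 1) :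
    σ.arr 7 (σ.arr (itemA c) q') ≤ σ.arr 7 (σ.arr (itemA c) q) := by
  rcases h.edge_item hC he hr with h1 | ⟨a, h1, h2, h3, h4⟩
  · rw [h1, hC.key_end]
    rcases index_cases hr' with ⟨b, hb⟩ | hb | hb
    · rw [hb, hC.key]; positivity
    · rw [hb, hC.key_start]; positivity
    · rw [hb, hC.key_end]
  · rw [h1, hC.key]
    rcases index_cases hr' with ⟨b, hb⟩ | hb | hb
    · have hcb := (h.cur c b hb.symm).2
      rw [hb, hC.ord, if_pos hcb] at h4
      rw [hb, hC.key]
      have : I.key a ≤ I.key b := Instance.key_le_of_ord_le (by omega)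
      gcongr
    · rw [hb, hC.key_start]
      gcongr
    · rw [hb, hC.ord_end] at h4; omega

/-- Along an edge, the packed set grows by the new item, which does not change the loads of the
items packed before. -/
theorem step (hC : Ctx I σ) (h : Trace I σ M q) (he : Edge σ c q q')
    (hr : ∀ c, 0 ≤ σ.arr (itemA c) q' ∧ σ.arr (itemA c) q' ≤ I.n + 1)
    (hr' : ∀ c, 0 ≤ σ.arr (itemA c) q ∧ σ.arr (itemA c) q ≤ I.n + 1)
    {M' : Finset (Fin I.n)} (hM' : ∀ a, a ∈ M' ↔ a ∈ M ∨ ((a : ℕ) : ℤ) = σ.arr (itemA c) q') :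
    Trace I σ M' q' := by
  have hitem := h.edge_item hC he (hr c)
  have hkey := h.key_anti hC he (hr c) (hr' c)
  obtain ⟨hx, ht, ho, hs, hcap, hres⟩ := he
  have hnew : ∀ a : Fin I.n, ((a : ℕ) : ℤ) = σ.arr (itemA c) q' → I.cls a = c ∧ I.key a ≤ I.N ∧
      (I.ord a : ℤ) < σ.arr (ordA c) (σ.arr (itemA c) q) ∧ a ∉ M := by
    intro a ha
    rcases hitem with h1 | ⟨a', h1, h2, h3, h4⟩
    · have := a.2; omega
    · obtain rfl : a = a' := Fin.ext (by omega)
      refine ⟨h2, h3, h4, fun haM => ?_⟩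
      have := h.ord_le a haM
      rw [h2] at this
      omega
  have hload : ∀ a ∈ M, I.load M' a = I.load M a := by
    intro a ha
    unfold Instance.load
    congr 1
    ext b
    simp only [Finset.mem_filter, hM']
    constructor
    · rintro ⟨hb | hb, h1, h2⟩
      · exact ⟨hb, h1, h2⟩
      · exfalso
        obtain ⟨h3, h4, h5, h6⟩ := hnew b hb
        have h7 := h.ord_le a ha
        rw [← h1, h3] at h7
        omega
    · rintro ⟨hb, h1, h2⟩
      exact ⟨.inl hb, h1, h2⟩
  have hload_le : ∀ a ∈ M, I.cls a = c →
      (I.n + 1 : ℤ) * I.load M a ≤ σ.arr (topA c) q := by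
    intro a ha hca
    refine le_trans ?_ (h.sum_le c)
    gcongr
    refine Finset.sum_le_sum_of_subset fun b hb => ?_
    simp only [Finset.mem_filter] at hb
    rw [Finset.mem_inter, Instance.mem_side]
    exact ⟨hb.1, hb.2.1.trans hca⟩
  have hother : ∀ a ∈ M', I.cls a = (!c) → a ∈ M := by
    intro a ha hca
    refine ((hM' a).1 ha).resolve_right fun ha' => ?_
    have h1 := (hnew a ha').1
    rw [h1] at hca
    cases c <;> simp at hca
  have hxy : ∀ c', c' = c ∨ c' = !c := by
    intro c'
    cases c' <;> cases c <;> simp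
  have hresolved : ∀ a ∈ M', ((a : ℕ) : ℤ) ≠ σ.arr (itemA (I.cls a)) q' →
      (I.n + 1 : ℤ) * I.load M' a + σ.arr 7 (σ.arr (itemA !(I.cls a)) q') ≤
        (I.n + 1) * I.N := by
    intro a ha hne
    rcases hxy (I.cls a) with hca | hca
    · rw [hca] at hne ⊢
      have haM : a ∈ M := ((hM' a).1 ha).resolve_right hne
      rw [hload a haM, hx]
      by_cases hcur : ((a : ℕ) : ℤ) = σ.arr (itemA c) q
      · have := hload_le a haM hca
        rw [hC.width] at hres
        linarith
      · have := h.resolved a haM (by rwa [hca])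
        rwa [hca] at this
    · have haM := hother a ha hca
      rw [hca, hx] at hne
      have := h.resolved a haM (by rwa [hca])
      rw [hca, Bool.not_not] at this ⊢
      rw [hload a haM]
      linarith
  have hcross : ∀ a ∈ M', ∀ b ∈ M', I.cls a = c → I.cls b = (!c) →
      (((a : ℕ) : ℤ) ≠ σ.arr (itemA c) q' ∨ ((b : ℕ) : ℤ) ≠ σ.arr (itemA !c) q') →
      I.load M' b + I.key a ≤ I.N ∨ I.load M' a + I.key b ≤ I.N := by
    intro a ha b hb hca hcb hne
    have hbM := hother b hb hcb
    by_cases hcur : ((a : ℕ) : ℤ) = σ.arr (itemA c) q'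
    · left
      have h1 := hresolved b hb (by rw [hcb]; exact hne.resolve_left fun h => h hcur)
      rw [hcb, Bool.not_not, ← hcur, hC.key, ← mul_add] at h1
      have := le_of_mul_le_mul_left h1 (by positivity)
      exact_mod_cast this
    · have haM : a ∈ M := ((hM' a).1 ha).resolve_right hcur
      by_cases hcur' : ((b : ℕ) : ℤ) = σ.arr (itemA !c) q'
      · right
        have h1 := hresolved a ha (by rw [hca]; exact hcur)
        rw [hca, ← hcur', hC.key, ← mul_add] at h1
        have := le_of_mul_le_mul_left h1 (by positivity)
        exact_mod_cast this
      · rw [hload a haM, hload b hbM]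
        refine h.cross a haM b hbM (by rw [hca, hcb]) (.inr ?_)
        rw [hcb, ← hx]
        exact hcur'
  refine ⟨?_, ?_, ?_, ?_, ?_, ?_, hresolved, ?_⟩
  · intro c' a ha
    rcases hxy c' with rfl | rfl
    · exact ⟨(hM' a).2 (.inr ha), (hnew a ha).1⟩
    · rw [hx] at ha
      obtain ⟨h1, h2⟩ := h.cur _ a ha
      exact ⟨(hM' a).2 (.inl h1), h2⟩
  · intro a ha
    rcases (hM' a).1 ha with haM | ha'
    · have h1 := h.ord_le a haM
      rcases hxy (I.cls a) with hca | hca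
      · rw [hca] at h1 ⊢; omega
      · rw [hca] at h1 ⊢; rwa [hx]
    · have hca := (hnew a ha').1
      rw [hca, ← ha', hC.ord, if_pos hca]
  · intro c'
    have := h.ord_le_start c'
    rcases hxy c' with rfl | rfl
    · omega
    · rwa [hx]
  · intro a ha
    rcases (hM' a).1 ha with haM | ha'
    exacts [h.key_le a haM, (hnew a ha').2.1]
  · intro c'
    have h1 := h.sum_le c'
    rcases hxy c' with rfl | rfl
    · rcases hitem with h2 | ⟨a, h2, h3, -, -⟩
      · have : M' = M := by
          ext b
          rw [hM', h2]
          have := b.2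
          refine or_iff_left ?_
          omega
        rw [h2, hC.size_end] at hs
        rw [this]
        linarith
      · have : M' ∩ I.side c' = insert a (M ∩ I.side c') := by
          ext b
          simp only [Finset.mem_inter, Finset.mem_insert, hM', h2, Instance.mem_side]
          constructor
          · rintro ⟨hb | hb, hb'⟩
            · exact .inr ⟨hb, hb'⟩
            · exact .inl (Fin.ext (by omega))
          · rintro (rfl | ⟨hb, hb'⟩)
            · exact ⟨.inr rfl, h3⟩
            · exact ⟨.inl hb, hb'⟩
        rw [this, Finset.sum_insert (by
          intro hmem
          exact (hnew a h2.symm).2.2.2 (Finset.mem_inter.1 hmem).1)]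
        rw [h2, hC.size] at hs
        push_cast at h1 ⊢
        linarith
    · have : M' ∩ I.side (!c) = M ∩ I.side (!c) := by
        ext b
        simp only [Finset.mem_inter, Instance.mem_side]
        exact ⟨fun hb => ⟨hother b hb.1 hb.2, hb.2⟩, fun hb => ⟨(hM' b).2 (.inl hb.1), hb.2⟩⟩
      rw [this, ht]
      exact h1
  · intro c'
    rcases hxy c' with rfl | rfl
    · rwa [hC.cap] at hcap
    · rw [ht]; exact h.le_cap _
  · intro a ha b hb hab hne
    rcases hxy (I.cls a) with hca | hca
    · rw [hca] at hab
      rw [hca, hab] at hne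
      exact hcross a ha b hb hca hab hne
    · rw [hca, Bool.not_not] at hab
      rw [hca, hab] at hne
      exact (hcross b hb a ha hab hca hne.symm).symm

end Trace

end LPack

namespace LPack

/-! ### Paths and feasible sets -/

variable {I : Instance} {σ : Store} {T : Set ℤ}

/-- Whether class `c` has reached its last dummy item, as a number. -/
def ended (I : Instance) (σ : Store) (c : Bool) (q : ℤ) : ℕ :=
  if σ.arr (itemA c) q = I.n + 1 then 1 else 0

/-- Marking the current items after a step along an edge; the number of packed items and finished
classes increases. -/
theorem Trace.exists_step {M : Finset (Fin I.n)} {q q' : ℤ} {c : Bool} (hC : Ctx I σ)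
    (hV : Verts I σ T) (h : Trace I σ M q) (he : Edge σ c q q') (hq : Vtx σ q) (hq' : Vtx σ q') :
    ∃ M', Trace I σ M' q' ∧ (∑ a ∈ M', I.p a : ℕ) = (∑ a ∈ M, I.p a : ℕ) + gain σ c q' ∧
      M.card + ended I σ true q + ended I σ false q + 1 ≤
        M'.card + ended I σ true q' + ended I σ false q' ∧
      ∀ a, a ∈ M' ↔ a ∈ M ∨ ∃ c, ((a : ℕ) : ℤ) = σ.arr (itemA c) q' := by
  have hr := fun c => hV.range c q' hq'
  have hr' := fun c => hV.range c q hq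
  have hstep := fun (M' : Finset (Fin I.n)) (hM') => h.step hC he hr hr' (M' := M') hM'
  have hitem := h.edge_item hC he (hr c)
  have hmark : ∀ a : Fin I.n, (a ∈ M ∨ ∃ c, ((a : ℕ) : ℤ) = σ.arr (itemA c) q') ↔
      a ∈ M ∨ ((a : ℕ) : ℤ) = σ.arr (itemA c) q' := by
    intro a
    constructor
    · rintro (ha | ⟨c', ha⟩)
      · exact .inl ha
      · by_cases hc : c' = c
        · subst hc; exact .inr ha
        · obtain rfl : c' = !c := by cases c' <;> cases c <;> simp_all
          rw [he.1] at ha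
          exact .inl (h.cur _ a ha).1
    · rintro (ha | ha)
      exacts [.inl ha, .inr ⟨c, ha⟩]
  have hsame : ended I σ (!c) q' = ended I σ (!c) q := by rw [ended, ended, he.1]
  have hcount : ∀ q, ended I σ true q + ended I σ false q =
      ended I σ c q + ended I σ (!c) q := by
    intro q; cases c <;> simp [add_comm]
  have hne : ended I σ c q = 0 := by
    refine if_neg fun h1 => ?_
    have h2 := he.2.2.1
    rw [h1, hC.ord_end] at h2
    rcases hitem with h3 | ⟨a, h3, h4, -, -⟩
    · rw [h3, hC.ord_end] at h2; omega
    · rw [h3, hC.ord, if_pos h4] at h2; omega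
  rcases hitem with h1 | ⟨a, h1, h2, -, h3⟩
  · have hM : ∀ a : Fin I.n, a ∈ M ↔ a ∈ M ∨ ((a : ℕ) : ℤ) = σ.arr (itemA c) q' := by
      intro a
      have := a.2
      refine (or_iff_left ?_).symm
      omega
    refine ⟨M, hstep M hM, ?_, ?_, fun a => by rw [hmark]; exact hM a⟩
    · simp [gain, h1, hC.profit_end]
    · have : ended I σ c q' = 1 := if_pos h1
      have e1 := hcount q
      have e2 := hcount q'
      omega
  · have hM : ∀ b : Fin I.n, b ∈ insert a M ↔ b ∈ M ∨ ((b : ℕ) : ℤ) = σ.arr (itemA c) q' := by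
      intro b
      rw [Finset.mem_insert, or_comm, h1]
      simp [Fin.ext_iff]
    have haM : a ∉ M := by
      intro ha
      have := h.ord_le a ha
      rw [h2] at this
      omega
    refine ⟨insert a M, hstep _ hM, ?_, ?_, fun a => by rw [hmark]; exact hM a⟩
    · rw [Finset.sum_insert haM, gain, h1, hC.profit]
      push_cast; ring
    · rw [Finset.card_insert_of_notMem haM]
      have e1 := hcount q
      have e2 := hcount q'
      omega

/-- There is a path of at most `d` edges with total gain `g` from the vertex `q` to the end. -/
inductive Reach (I : Instance) (σ : Store) : ℕ → ℤ → ℤ → Prop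
  | fin {d : ℕ} {q : ℤ} : (∀ c, σ.arr (itemA c) q = I.n + 1) → Reach I σ d q 0
  | step {d : ℕ} {q q' g : ℤ} {c : Bool} : Vtx σ q' → Edge σ c q q' → Reach I σ d q' g →
      Reach I σ (d + 1) q (g + gain σ c q')

theorem Reach.mono {d d' : ℕ} {q g : ℤ} (h : Reach I σ d q g) (hd : d ≤ d') : Reach I σ d' q g := by
  induction h generalizing d' with
  | fin h => exact .fin h
  | step h1 h2 _ ih =>
    obtain ⟨d', rfl⟩ : ∃ m, d' = m + 1 := ⟨d' - 1, by omega⟩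
    exact .step h1 h2 (ih (by omega))

/-- The items of a class that remain to be packed, and their tops, when the stack has come to item
`z` and position `s`. The list ends with the last dummy item. -/
def Ladder (I : Instance) (σ : Store) (T : Set ℤ) (c : Bool) : ℤ → ℤ → List (ℤ × ℤ) → Prop
  | z, _, [] => z = I.n + 1
  | z, s, k :: K => σ.arr (ordA c) k.1 + 1 ≤ σ.arr (ordA c) z ∧ s + σ.arr 8 k.1 ≤ k.2 ∧
      k.2 ≤ σ.reg (capR c) ∧ (0 ≤ k.1 ∧ k.1 ≤ I.n + 1) ∧ k.2 ∈ T ∧ Ladder I σ T c k.1 k.2 K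

/-- Two placements, one for each class, that do not interfere give a path: as the current items of
the two classes do not meet, the class can move on whose current item is separated from all future
items of the other class. -/
theorem reach_of_ladders (hC : Ctx I σ) (hV : Verts I σ T) (d : ℕ) (q : ℤ)
    (K : Bool → List (ℤ × ℤ)) (hT : ∀ c, σ.arr (topA c) q ∈ T)
    (hd : (K true).length + (K false).length = d)
    (hK : ∀ c, Ladder I σ T c (σ.arr (itemA c) q) (σ.arr (topA c) q) (K c))
    (hq : Vtx σ q) (hle : ∀ c, σ.arr (topA c) q ≤ σ.reg 10)
    (hcompat : ∀ c, ∀ k ∈ (σ.arr (itemA c) q, σ.arr (topA c) q) :: K c,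
      ∀ l ∈ (σ.arr (itemA !c) q, σ.arr (topA !c) q) :: K (!c),
        l.2 + σ.arr 7 k.1 ≤ σ.reg 10 ∨ k.2 + σ.arr 7 l.1 ≤ σ.reg 10) :
    Reach I σ d q (((K true).map fun k => σ.arr 2 k.1).sum +
      ((K false).map fun k => σ.arr 2 k.1).sum) := by
  induction d generalizing q K with
  | zero =>
    have h1 : K true = [] := List.length_eq_zero_iff.1 (by omega)
    have h2 : K false = [] := List.length_eq_zero_iff.1 (by omega)
    rw [h1, h2]
    refine .fin fun c => ?_
    have := hK c
    cases c
    · rwa [h2] at this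
    · rwa [h1] at this
  | succ d ih =>
    have hmove : ∀ c, K (!c) = [] → σ.arr (topA c) q + σ.arr 7 (σ.arr (itemA !c) q) ≤ σ.reg 10 := by
      intro c h1
      have h2 := hK (!c)
      rw [h1] at h2
      rw [show σ.arr (itemA !c) q = I.n + 1 from h2, hC.key_end, add_zero]
      exact hle c
    obtain ⟨c, hne, hres⟩ : ∃ c, K c ≠ [] ∧
        σ.arr (topA c) q + σ.arr 7 (σ.arr (itemA !c) q) ≤ σ.reg 10 := by
      by_cases h1 : K true = []
      · exact ⟨false, fun h2 => by simp [h1, h2] at hd, hmove false h1⟩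
      · by_cases h2 : K false = []
        · exact ⟨true, h1, hmove true h2⟩
        · rcases hcompat true _ List.mem_cons_self _ List.mem_cons_self with h3 | h3
          · exact ⟨false, h2, h3⟩
          · exact ⟨true, h1, h3⟩
    obtain ⟨k, K', hk⟩ := List.exists_cons_of_ne_nil hne
    have hKc := hK c
    rw [hk] at hKc
    obtain ⟨l1, l2, l3, l4, l5, l6⟩ := hKc
    obtain ⟨q', hq', hpos⟩ := hV.complete
      (fun c' => if c' = c then k.1 else σ.arr (itemA c') q)
      (fun c' => if c' = c then k.2 else σ.arr (topA c') q)
      (fun c' => by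
        split_ifs
        exacts [l4, hV.range c' q hq])
      (fun c' => by
        split_ifs
        exacts [l5, hT c'])
    have hnc : (!c) ≠ c := by cases c <;> simp
    have hpc := hpos c
    have hpc' := hpos (!c)
    simp only [if_true, hnc, if_false] at hpc hpc'
    have hedge : Edge σ c q q' := by
      refine ⟨hpc'.1, hpc'.2, ?_, ?_, ?_, hres⟩
      · rw [hpc.1]; exact l1
      · rw [hpc.1, hpc.2]; exact l2
      · rw [hpc.2]; exact l3
    have hcc : ∀ c', c' = c ∨ c' = !c := by intro c'; cases c' <;> cases c <;> simp
    have hupd : ∀ c', Function.update K c K' c' = if c' = c then K' else K c' := by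
      intro c'; rw [Function.update_apply]
    have hlen : (Function.update K c K' true).length + (Function.update K c K' false).length = d := by
      cases c <;> simp [hk] at hd ⊢ <;> omega
    have hr := ih q' (Function.update K c K')
      (fun c' => by rcases hcc c' with rfl | rfl; exacts [hpc.2 ▸ l5, hpc'.2 ▸ hT _]) hlen
      (fun c' => by
        rcases hcc c' with rfl | rfl
        · rw [hupd, if_pos rfl, hpc.1, hpc.2]; exact l6
        · rw [hupd, if_neg hnc, hpc'.1, hpc'.2]; exact hK _) hq'
      (fun c' => by
        rcases hcc c' with rfl | rfl
        · rw [hpc.2]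
          refine l3.trans ?_
          rw [hC.cap, hC.width]
          have := Instance.cap_le (I := I) c'
          gcongr
        · rw [hpc'.2]; exact hle _)
      (fun c' k' hk' l hl => by
        have hsub : ∀ c', (σ.arr (itemA c') q', σ.arr (topA c') q') :: Function.update K c K' c' ⊆
            (σ.arr (itemA c') q, σ.arr (topA c') q) :: K c' := by
          intro c'
          rcases hcc c' with rfl | rfl
          · rw [hupd, if_pos rfl, hpc.1, hpc.2, hk]
            exact fun x hx => List.mem_cons_of_mem _ hx
          · rw [hupd, if_neg hnc, hpc'.1, hpc'.2]
            exact fun x hx => hx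
        exact hcompat c' k' (hsub c' hk') l (hsub _ hl))
    convert Reach.step hq' hedge hr using 1
    rw [gain, hpc.1]
    cases c <;> simp [hk] <;> ring

/-- The list of a placement, closed by the last dummy item. -/
def closeUp (n : ℕ) : ℕ → List (Fin n × ℕ) → List (ℤ × ℤ)
  | y, [] => [((n : ℤ) + 1, (y : ℤ))]
  | _, k :: K => (((k.1 : ℕ) : ℤ), (k.2 : ℤ)) :: closeUp n k.2 K

theorem length_closeUp (n y : ℕ) (K : List (Fin n × ℕ)) :
    (closeUp n y K).length = K.length + 1 := by
  induction K generalizing y with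
  | nil => rfl
  | cons k K ih => simp [closeUp, ih]

theorem mem_closeUp {n y : ℕ} {K : List (Fin n × ℕ)} {k : ℤ × ℤ} (h : k ∈ closeUp n y K) :
    (∃ l ∈ K, k = (((l.1 : ℕ) : ℤ), (l.2 : ℤ))) ∨
      k.1 = n + 1 ∧ (k.2 = y ∨ ∃ l ∈ K, k.2 = (l.2 : ℤ)) := by
  induction K generalizing y with
  | nil =>
    simp only [closeUp, List.mem_singleton] at h
    subst h
    exact .inr ⟨rfl, .inl rfl⟩
  | cons l K ih =>
    rcases List.mem_cons.1 h with h | h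
    · exact .inl ⟨l, by simp, h⟩
    · rcases ih h with ⟨l', h1, h2⟩ | ⟨h1, h2⟩
      · exact .inl ⟨l', by simp [h1], h2⟩
      · refine .inr ⟨h1, .inr ?_⟩
        rcases h2 with h2 | ⟨l', h2, h3⟩
        · exact ⟨l, by simp, h2⟩
        · exact ⟨l', by simp [h2], h3⟩

theorem sum_closeUp (hC : Ctx I σ) (y : ℕ) (K : List (Fin I.n × ℕ)) :
    ((closeUp I.n y K).map fun k => σ.arr 2 k.1).sum = (total (fun k => I.p k.1) K : ℕ) := by
  induction K generalizing y with
  | nil => simp [closeUp, hC.profit_end]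
  | cons k K ih => simp [closeUp, ih, hC.profit]

theorem Fits.length_le {α : Type*} {sz : α → ℕ} {S : Set ℕ} {x y e : ℕ} {L : List α}
    {K : List (α × ℕ)} (h : Fits sz S x y L K e) : K.length ≤ L.length := by
  induction h with
  | nil _ => simp
  | skip _ ih => simp; omega
  | keep _ _ _ _ ih => simpa using ih

/-- The tops of the kept items are not above their original tops. -/
theorem Fits.le_bound {α : Type*} {sz : α → ℕ} {S : Set ℕ} {x y e : ℕ} {L : List α}
    {K : List (α × ℕ)} (h : Fits sz S x y L K e) (bound : α → ℕ)
    (hb : ∀ pre a post, L = pre ++ a :: post → x + total sz pre + sz a ≤ bound a) :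
    ∀ k ∈ K, k.1 ∈ L ∧ k.2 ≤ bound k.1 := by
  have tail : ∀ {x a} {L : List α}, (∀ pre b post, a :: L = pre ++ b :: post →
      x + total sz pre + sz b ≤ bound b) → ∀ pre b post, L = pre ++ b :: post →
      x + sz a + total sz pre + sz b ≤ bound b := by
    intro x a L h pre b post hL
    have := h (a :: pre) b post (by simp [hL])
    simp only [total_cons] at this
    omega
  induction h with
  | nil _ => simp
  | skip _ ih =>
    intro k hk
    obtain ⟨h1, h2⟩ := ih (tail hb) k hk
    exact ⟨List.mem_cons_of_mem _ h1, h2⟩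
  | keep _ h2 _ _ ih =>
    intro k hk
    rcases List.mem_cons.1 hk with rfl | hk
    · refine ⟨by simp, h2.trans ?_⟩
      simpa using hb [] _ _ rfl
    · obtain ⟨h1, h2⟩ := ih (tail hb) k hk
      exact ⟨List.mem_cons_of_mem _ h1, h2⟩

/-- A rounded stack is a possible continuation of its class from the first dummy item. -/
theorem Fits.ladder (hC : Ctx I σ) {c : Bool} {S : Set ℕ} (hS : ∀ s ∈ S, (s : ℤ) ∈ T) {x y e : ℕ}
    {L : List (Fin I.n)} {K : List (Fin I.n × ℕ)}
    (h : Fits (fun a => (I.n + 1) * I.size a) S x y L K e)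
    (hL : L.Pairwise fun a b => I.ord b < I.ord a) (hc : ∀ a ∈ L, I.cls a = c)
    (hx : x + total (fun a => (I.n + 1) * I.size a) L ≤ (I.n + 1) * I.cap c) (z : ℤ)
    (hz : ∀ a ∈ L, (I.ord a : ℤ) + 1 ≤ σ.arr (ordA c) z) (hz' : 1 ≤ σ.arr (ordA c) z)
    (hy : y ≤ (I.n + 1) * I.cap c) (hyT : (y : ℤ) ∈ T) :
    Ladder I σ T c z y (closeUp I.n y K) := by
  have hcap := hC.cap c
  induction h generalizing z with
  | nil _ =>
    refine ⟨?_, ?_, ?_, by dsimp only; omega, hyT, rfl⟩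
    · dsimp only; rw [hC.ord_end]; omega
    · dsimp only; rw [hC.size_end]; omega
    · rw [hcap]; dsimp only; exact_mod_cast hy
  | skip _ ih =>
    simp only [total_cons] at hx
    rw [List.pairwise_cons] at hL
    exact ih hL.2 (fun a ha => hc a (by simp [ha])) (by omega) z
      (fun a ha => hz a (by simp [ha])) hz' hy hyT
  | @keep x y e s a L K h1 h2 h3 _ ih =>
    simp only [total_cons] at hx
    rw [List.pairwise_cons] at hL
    have hca := hc a (by simp)
    have hord : σ.arr (ordA c) (a : ℕ) = I.ord a := by rw [hC.ord, if_pos hca]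
    have ha := a.2
    refine ⟨?_, ?_, ?_, by dsimp only; omega, hS s h3, ?_⟩
    · dsimp only; rw [hord]; exact hz a (by simp)
    · dsimp only; rw [hC.size]; exact_mod_cast h1
    · rw [hcap]; dsimp only; norm_cast; omega
    · refine ih hL.2 (fun a ha => hc a (by simp [ha])) (by omega) _ (fun b hb => ?_) ?_ (by omega)
        (hS s h3)
      · rw [hord]; have := hL.1 b hb; omega
      · rw [hord, Instance.ord]; omega

theorem exists_sorted (S : Finset (Fin I.n)) : ∃ L : List (Fin I.n), L.Nodup ∧
    L.Pairwise (fun a b => I.ord b < I.ord a) ∧ ∀ a, a ∈ L ↔ a ∈ S := by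
  induction S using Finset.induction_on_min_value I.ord with
  | empty => exact ⟨[], by simp⟩
  | insert a S ha hmin ih =>
    obtain ⟨L, h1, h2, h3⟩ := ih
    refine ⟨L ++ [a], ?_, ?_, ?_⟩
    · rw [List.nodup_append]
      refine ⟨h1, by simp, ?_⟩
      intro x hx y hy
      rw [List.mem_singleton] at hy
      subst hy
      rintro rfl
      exact ha ((h3 x).1 hx)
    · rw [List.pairwise_append]
      refine ⟨h2, by simp, ?_⟩
      intro x hx y hy
      rw [List.mem_singleton] at hy
      subst hy
      have hx' := (h3 x).1 hx
      refine lt_of_le_of_ne (hmin x hx') fun h => ?_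
      rw [Instance.ord_injective h] at ha
      exact ha hx'
    · intro b; simp [h3, or_comm]

theorem total_eq_sum {n : ℕ} (f : Fin n → ℕ) {L : List (Fin n)} (hL : L.Nodup) {S : Finset (Fin n)}
    (hS : ∀ a, a ∈ L ↔ a ∈ S) : total f L = ∑ a ∈ S, f a := by
  have : S = L.toFinset := by ext a; simp [hS]
  rw [this, List.sum_toFinset _ hL, total]

/-- A feasible set yields a path from the vertex `0` to the end with nearly its profit: rounding with
`q + 1 = D = 2 k + 2` loses the fraction `2 / (2 k + 2)` of the profit. -/
theorem exists_reach (hC : Ctx I σ) (hV : Verts I σ T) (k : ℕ)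
    (hT : ∀ s ∈ sums (units I.n I.size) (terms (2 * k + 1) (2 * k + 2)), (s : ℤ) ∈ T)
    {M : Finset (Fin I.n)} (hM : I.Feas M) :
    ∃ g : ℕ, Reach I σ (I.n + 2) 0 g ∧ k * ∑ a ∈ M, I.p a ≤ (k + 1) * g := by
  have side : ∀ c, ∃ K : List (Fin I.n × ℕ), Ladder I σ T c I.n 0 (closeUp I.n 0 K) ∧
      K.length ≤ (M ∩ I.side c).card ∧
      k * ∑ a ∈ M ∩ I.side c, I.p a ≤ (k + 1) * total (fun k => I.p k.1) K ∧
      ∀ l ∈ K, l.1 ∈ M ∧ I.cls l.1 = c ∧ l.2 ≤ (I.n + 1) * I.load M l.1 := by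
    intro c
    obtain ⟨L, h1, h2, h3⟩ := exists_sorted (M ∩ I.side c)
    have hlen : L.length = (M ∩ I.side c).card := by
      rw [← List.toFinset_card_of_nodup h1]
      congr 1
      ext a; simp [h3]
    have hmem : ∀ a ∈ L, a ∈ M ∧ I.cls a = c := by
      intro a ha
      rwa [h3, Finset.mem_inter, Instance.mem_side] at ha
    have hcard : (M ∩ I.side c).card ≤ I.n := by
      simpa using Finset.card_le_univ (M ∩ I.side c)
    obtain ⟨K, e, k1, -, -, k4⟩ := exists_fits I.n I.p (z := I.size) Instance.size_pos (2 * k + 1)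
      (2 * k + 2) L (by omega)
    have hscale : ∀ L : List (Fin I.n), total (fun a => (I.n + 1) * I.size a) L =
        (I.n + 1) * total I.size L := fun L => by
      simp [total, List.sum_map_mul_left]
    have htot : total (fun a => (I.n + 1) * I.size a) L ≤ (I.n + 1) * I.cap c := by
      rw [hscale, total_eq_sum I.size h1 h3]
      exact Nat.mul_le_mul_left _ (hM.sum_le c)
    refine ⟨K, ?_, ?_, ?_, ?_⟩
    · refine k1.ladder hC hT h2 (fun a ha => (hmem a ha).2) (by simpa using htot) _ ?_ ?_
        (Nat.zero_le _) (hT 0 (zero_mem_sums _ _))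
      · intro a ha
        rw [hC.ord_start]
        have h4 : (I.n + 1) * I.key a ≤ (I.n + 1) * I.N :=
          Nat.mul_le_mul_left _ (hM.key_le a (hmem a ha).1)
        have h5 : I.ord a + 1 ≤ (I.n + 1) * I.N + I.n + 1 := by unfold Instance.ord; omega
        exact_mod_cast h5
      · rw [hC.ord_start]
        have : (0 : ℤ) ≤ (I.n + 1) * I.N := by positivity
        omega
    · exact hlen ▸ k1.length_le
    · rw [← total_eq_sum I.p h1 h3]
      refine Nat.le_of_mul_le_mul_left (?_ : 4 * (k + 1) * _ ≤ 4 * (k + 1) * _) (by omega)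
      nlinarith [k4]
    · have := k1.le_bound (fun a => (I.n + 1) * I.load M a) ?_
      · intro l hl
        obtain ⟨h4, h5⟩ := this l hl
        exact ⟨(hmem _ h4).1, (hmem _ h4).2, h5⟩
      · rintro pre a post rfl
        rw [hscale, zero_add, ← mul_add]
        refine Nat.mul_le_mul_left _ ?_
        have h4 : (pre ++ [a]).Nodup := h1.sublist (by simp)
        have h5 := total_eq_sum I.size h4 (S := (pre ++ [a]).toFinset)
          (by simp [or_comm])
        simp only [total_append, total_cons, total_nil, add_zero] at h5
        rw [h5]
        refine Finset.sum_le_sum_of_subset fun b hb => ?_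
        have hb' : b ∈ pre ∨ b = a := by simpa [or_comm] using hb
        have hb'' := hmem b (by simp; tauto)
        have ha'' := hmem a (by simp)
        rw [Finset.mem_filter]
        refine ⟨hb''.1, hb''.2.trans ha''.2.symm, ?_⟩
        rcases hb' with hb' | rfl
        · rw [List.pairwise_append] at h2
          exact (h2.2.2 b hb' a (by simp)).le
        · exact le_rfl
  choose K hK1 hK2 hK3 hK4 using side
  refine ⟨total (fun k => I.p k.1) (K true) + total (fun k => I.p k.1) (K false), ?_, ?_⟩
  · have h0 := hV.start
    have hlast : ∀ c, ∀ l ∈ K c, (l.2 : ℤ) ≤ (I.n + 1) * I.cap c := by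
      intro c l hl
      obtain ⟨h1, h2, h3⟩ := hK4 c l hl
      have h4 : I.load M l.1 ≤ I.cap c := by
        refine le_trans (Finset.sum_le_sum_of_subset fun b hb => ?_) (hM.sum_le c)
        rw [Finset.mem_filter] at hb
        rw [Finset.mem_inter, Instance.mem_side]
        exact ⟨hb.1, hb.2.1.trans h2⟩
      exact_mod_cast h3.trans (Nat.mul_le_mul_left _ h4)
    have hcapN : ∀ c, ((I.n : ℤ) + 1) * I.cap c ≤ (I.n + 1) * I.N := by
      intro c
      have := Instance.cap_le (I := I) c
      gcongr
    -- What the entries of the two lists look like.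
    have hgood : ∀ c, ∀ k ∈ (((I.n : ℕ) : ℤ), (0 : ℤ)) :: closeUp I.n 0 (K c),
        k = ((I.n : ℤ), 0) ∨ (∃ a ∈ M, I.cls a = c ∧ k.1 = (a : ℕ) ∧
          k.2 ≤ (I.n + 1) * I.load M a ∧ k.2 ≤ (I.n + 1) * I.N) ∨
        k.1 = I.n + 1 ∧ k.2 ≤ (I.n + 1) * I.N := by
      intro c k hk
      rcases List.mem_cons.1 hk with rfl | hk
      · exact .inl rfl
      · rcases mem_closeUp hk with ⟨l, hl, rfl⟩ | ⟨h1, h2 | ⟨l, hl, h2⟩⟩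
        · obtain ⟨h1, h2, h3⟩ := hK4 c l hl
          refine .inr (.inl ⟨l.1, h1, h2, rfl, by dsimp only; exact_mod_cast h3,
            (hlast c l hl).trans (hcapN c)⟩)
        · refine .inr (.inr ⟨h1, ?_⟩)
          rw [h2]; positivity
        · exact .inr (.inr ⟨h1, h2 ▸ (hlast c l hl).trans (hcapN c)⟩)
    have hkeyN : ∀ a ∈ M, ((I.n : ℤ) + 1) * I.key a ≤ (I.n + 1) * I.N := by
      intro a ha
      have := hM.key_le a ha
      gcongr
    have hr := reach_of_ladders hC hV _ 0 (fun c => closeUp I.n 0 (K c))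
      (fun c => by rw [(h0 c).2]; exact hT 0 (zero_mem_sums _ _)) rfl
      (fun c => by rw [(h0 c).1, (h0 c).2]; exact hK1 c) ⟨le_rfl, hV.pos⟩
      (fun c => by rw [(h0 c).2, hC.width]; positivity)
      (fun c k hk l hl => by
        rw [(h0 c).1, (h0 c).2] at hk
        rw [(h0 (!c)).1, (h0 (!c)).2] at hl
        rw [hC.width]
        have hk' := hgood c k hk
        have hl' := hgood (!c) l hl
        rcases hk' with rfl | ⟨a, ha, hca, hk1, hk2, hk3⟩ | ⟨hk1, hk2⟩
        · right
          rcases hl' with rfl | ⟨b, hb, hcb, hl1, hl2, hl3⟩ | ⟨hl1, hl2⟩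
          · simp [hC.key_start]
          · rw [hl1, hC.key, zero_add]; exact hkeyN b hb
          · rw [hl1, hC.key_end, zero_add]; positivity
        · rcases hl' with rfl | ⟨b, hb, hcb, hl1, hl2, hl3⟩ | ⟨hl1, hl2⟩
          · left; rw [hk1, hC.key, zero_add]; exact hkeyN a ha
          · rw [hk1, hl1, hC.key, hC.key]
            have hne : I.cls a ≠ I.cls b := by rw [hca, hcb]; cases c <;> simp
            rcases hM.cross a ha b hb hne with h | h
            · left
              have : ((I.n : ℤ) + 1) * (I.load M b + I.key a) ≤ (I.n + 1) * I.N := by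
                gcongr; exact_mod_cast h
              linarith
            · right
              have : ((I.n : ℤ) + 1) * (I.load M a + I.key b) ≤ (I.n + 1) * I.N := by
                gcongr; exact_mod_cast h
              linarith
          · right; rw [hl1, hC.key_end, add_zero]; exact hk3
        · left
          rw [hk1, hC.key_end, add_zero]
          rcases hl' with rfl | ⟨b, hb, hcb, hl1, hl2, hl3⟩ | ⟨hl1, hl2⟩
          · positivity
          · exact hl3
          · exact hl2)
    rw [sum_closeUp hC, sum_closeUp hC] at hr
    push_cast
    refine hr.mono ?_
    rw [length_closeUp, length_closeUp]
    have h1 := hK2 true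
    have h2 := hK2 false
    have h3 : (M ∩ I.side true).card + (M ∩ I.side false).card ≤ I.n := by
      rw [← Finset.card_union_of_disjoint]
      · simpa using Finset.card_le_univ (M ∩ I.side true ∪ M ∩ I.side false)
      · rw [Finset.disjoint_left]
        intro a ha hb
        simp only [Finset.mem_inter, Instance.mem_side] at ha hb
        rw [ha.2] at hb
        simp at hb
    omega
  · have h1 : ∑ a ∈ M, I.p a = ∑ a ∈ M ∩ I.side true, I.p a + ∑ a ∈ M ∩ I.side false, I.p a := by
      rw [← Finset.sum_union]
      · congr 1
        ext a
        simp only [Finset.mem_union, Finset.mem_inter, Instance.mem_side]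
        cases I.cls a <;> simp
      · rw [Finset.disjoint_left]
        intro a ha hb
        simp only [Finset.mem_inter, Instance.mem_side] at ha hb
        rw [ha.2] at hb
        simp at hb
    rw [h1, mul_add, mul_add]
    exact add_le_add (hK3 true) (hK3 false)

end LPack

namespace LPack

/-! ### Preprocessing -/

/-- Execute a list of programs one after the other. -/
def block : List Cmd → Cmd
  | [] => .skip
  | c :: l => .seq c (block l)

/-- `reg r := reg r + e` -/
def incr (r : ℕ) (e : Expr) : Cmd := .assign r (.add (.reg r) e)

/-- `arr a [z] := arr a [z] + e` -/
def addTo (a : ℕ) (z e : Expr) : Cmd := .write a z (.add (.read a z) e)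

namespace Runs

variable {B : ℕ} {c : Cmd} {l : List Cmd} {σ : Store} {Q Q' : Store → Prop}

theorem nil (h : Q σ) : Runs B (block []) σ Q := .skip h

theorem cons (h : Runs B c σ fun τ => Runs B (block l) τ Q) : Runs B (block (c :: l)) σ Q := .seq h

theorem cons_frame (h : Runs B c σ Q)
    (h' : ∀ τ, Q τ → Same c.regs c.arrs σ τ → Runs B (block l) τ Q') :
    Runs B (block (c :: l)) σ Q' := .seq_frame h h'

theorem incr {r : ℕ} {e : Expr} (h : Q (σ.setReg r (σ.reg r + e.eval σ))) :
    Runs B (incr r e) σ Q := .assign h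

theorem addTo {a : ℕ} {z e : Expr}
    (h : Q (σ.setArr a (z.eval σ) (σ.arr a (z.eval σ) + e.eval σ))) :
    Runs B (addTo a z e) σ Q := .write h

end Runs

theorem toArr_coe {n : ℕ} (f : Fin n → ℕ) (a : Fin n) : toArr f (a : ℕ) = f a := by
  simp [toArr]

theorem toArr_nonneg {n : ℕ} (f : Fin n → ℕ) (z : ℤ) : 0 ≤ toArr f z := by
  unfold toArr; split_ifs <;> simp

theorem toArr_eq_zero {n : ℕ} (f : Fin n → ℕ) {z : ℤ} (h : (n : ℤ) ≤ z) : toArr f z = 0 := by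
  refine dif_neg ?_
  omega

/-- Scale the dimensions of the region, by repeated addition. Register `9` is set to `n + 1`,
register `13` to the position of unavailable items. -/
def scaleBox : Cmd := block
  [.assign 9 (.add (.reg 0) (.const 1)),
   forLt 5 9 (block [incr 10 (.reg 1), incr 11 (.reg 2), incr 12 (.reg 3)]),
   .assign 13 (.add (.reg 10) (.reg 9))]

/-- Scale the long side (array `kA`) and the short side (array `sA`) of the item in register `5`,
and compute its position in the order of its class (array `oA`). -/
def prepItem (kA sA oA oA' : ℕ) : Cmd := block
  [forLt 6 9 (block [addTo 7 (.reg 5) (.read kA (.reg 5)), addTo 8 (.reg 5) (.read sA (.reg 5))]),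
   .write oA (.reg 5) (.sub (.add (.read 7 (.reg 5)) (.reg 0)) (.reg 5)),
   .write oA' (.reg 5) (.reg 13)]

/-- Build the arrays `7, …, 10` described in `Ctx`. The entries for the second dummy item are `0` from
the start. -/
def prepare : Cmd := block
  [scaleBox,
   forLt 5 0 (.branch (.const 1) (.read 3 (.reg 5)) (prepItem 0 1 9 10) (prepItem 1 0 10 9)),
   .write 7 (.reg 0) (.reg 10), .write 9 (.reg 0) (.reg 13), .write 10 (.reg 0) (.reg 13)]

variable {I : Instance} {B k : ℕ}

theorem runs_scaleBox (hB : I.n + 3 ≤ B) : Runs B scaleBox (input I k) fun τ =>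
    τ.reg 9 = I.n + 1 ∧ τ.reg 10 = (I.n + 1) * I.N ∧ τ.reg 11 = (I.n + 1) * I.hL ∧
      τ.reg 12 = (I.n + 1) * I.wL ∧ τ.reg 13 = (I.n + 1) * I.N + I.n + 1 := by
  refine .cons (.assign ?_)
  refine .cons_frame (.forLt (I.n + 1) (by simp [input]) (by omega) (by decide) (by decide)
    (by decide) (fun i τ => τ.reg 10 = i * I.N ∧ τ.reg 11 = i * I.hL ∧ τ.reg 12 = i * I.wL)
    ?_ ?_) ?_
  · simp [input]
  · intro i σ' hi hr hs hI
    have h1 : σ'.reg 1 = I.N := hs.reg 1 (by decide)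
    have h2 : σ'.reg 2 = I.hL := hs.reg 2 (by decide)
    have h3 : σ'.reg 3 = I.wL := hs.reg 3 (by decide)
    refine .cons (.incr ?_)
    refine .cons (.incr ?_)
    refine .cons (.incr ?_)
    refine .nil ?_
    simp [hI, h1, h2, h3]
    refine ⟨by ring, by ring, by ring⟩
  · intro τ hI hs
    have h9 : τ.reg 9 = I.n + 1 := by rw [hs.reg 9 (by decide)]; simp [input]
    refine .cons (.assign ?_)
    refine .nil ?_
    simp [hI, h9]
    ring

theorem runs_prepItem (hB : I.n + 3 ≤ B) {σ : Store} {kA sA oA oA' K S : ℕ} {i : ℤ}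
    (hk : kA ≠ 7 ∧ kA ≠ 8) (hs : sA ≠ 7 ∧ sA ≠ 8) (ho : oA ≠ 7 ∧ oA ≠ 8 ∧ oA ≠ oA')
    (ho' : oA' ≠ 7 ∧ oA' ≠ 8) (h5 : σ.reg 5 = i) (h0 : σ.reg 0 = I.n) (h9 : σ.reg 9 = I.n + 1)
    (hK : σ.arr kA i = K) (hS : σ.arr sA i = S) (h7 : σ.arr 7 i = 0) (h8 : σ.arr 8 i = 0) :
    Runs B (prepItem kA sA oA oA') σ fun τ =>
      (∀ z, τ.arr 7 z = if z = i then ((I.n : ℤ) + 1) * K else σ.arr 7 z) ∧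
      (∀ z, τ.arr 8 z = if z = i then ((I.n : ℤ) + 1) * S else σ.arr 8 z) ∧
      (∀ z, τ.arr oA z = if z = i then ((I.n : ℤ) + 1) * K + I.n - i else σ.arr oA z) ∧
      (∀ z, τ.arr oA' z = if z = i then σ.reg 13 else σ.arr oA' z) := by
  refine .cons_frame (.forLt (I.n + 1) (by simp [h9]) (by omega) (by decide)
    (by simp [block, addTo, Cmd.regs])
    (by simp [block, addTo, Cmd.regs])
    (fun j τ => (∀ z, τ.arr 7 z = if z = i then (j : ℤ) * K else σ.arr 7 z) ∧
      (∀ z, τ.arr 8 z = if z = i then (j : ℤ) * S else σ.arr 8 z)) ?_ ?_) ?_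
  · constructor <;> intro z <;> by_cases hz : z = i <;> simp [hz, h7, h8]
  · intro j σ' hj hr hsame hI
    have e5 : σ'.reg 5 = i := by rw [hsame.reg 5 (by simp [block, addTo, Cmd.regs])]; exact h5
    have eK : σ'.arr kA i = K := by
      rw [hsame.arr kA (by simp [block, addTo, Cmd.arrs, hk])]; exact hK
    have eS : σ'.arr sA i = S := by
      rw [hsame.arr sA (by simp [block, addTo, Cmd.arrs, hs])]; exact hS
    refine .cons (.addTo ?_)
    refine .cons (.addTo ?_)
    refine .nil ?_
    constructor
    · intro z
      by_cases hz : z = i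
      · simp [e5, eK, hz, hI.1]; ring
      · simp [e5, hz, hI.1]
    · intro z
      by_cases hz : z = i
      · simp [e5, eS, hs, hz, hI.2]; ring
      · simp [e5, hz, hI.2]
  · intro τ hI hsame
    have e5 : τ.reg 5 = i := by rw [hsame.reg 5 (by simp [forLt, block, addTo, Cmd.regs])]; exact h5
    have e0 : τ.reg 0 = I.n := by
      rw [hsame.reg 0 (by simp [forLt, block, addTo, Cmd.regs])]; exact h0
    have e13 : τ.reg 13 = σ.reg 13 := hsame.reg 13 (by simp [forLt, block, addTo, Cmd.regs])
    have eo : τ.arr oA = σ.arr oA :=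
      hsame.arr oA (by simp [forLt, block, addTo, Cmd.arrs, ho])
    have eo' : τ.arr oA' = σ.arr oA' :=
      hsame.arr oA' (by simp [forLt, block, addTo, Cmd.arrs, ho'])
    refine .cons (.write ?_)
    refine .cons (.write ?_)
    refine .nil ?_
    refine ⟨?_, ?_, ?_, ?_⟩
    · intro z
      simp [ho.1.symm, ho'.1.symm, hI.1]
    · intro z
      simp [ho.2.1.symm, ho'.2.symm, hI.2]
    · intro z
      by_cases hz : z = i
      · simp [ho.2.2, hz, e5, e0, hI.1]
      · simp [ho.2.2, hz, e5, eo]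
    · intro z
      by_cases hz : z = i
      · simp [hz, e5, e13]
      · simp [ho.2.2.symm, hz, e5, eo']

theorem runs_prepare (hB : I.n + 3 ≤ B) : Runs B prepare (input I k) fun τ =>
    Ctx I τ ∧ τ.reg 9 = I.n + 1 := by
  refine .cons_frame (runs_scaleBox hB) ?_
  rintro σ ⟨h9, h10, h11, h12, h13⟩ hs0
  have a0 : σ.arr 0 = toArr I.w := hs0.arr 0 (by decide)
  have a1 : σ.arr 1 = toArr I.h := hs0.arr 1 (by decide)
  have a2 : σ.arr 2 = toArr I.p := hs0.arr 2 (by decide)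
  have a3 : σ.arr 3 = toArr fun i => if i ∈ I.hor then 1 else 0 := hs0.arr 3 (by decide)
  have r0 : σ.reg 0 = I.n := hs0.reg 0 (by decide)
  have z7 : σ.arr 7 = fun _ => 0 := hs0.arr 7 (by decide)
  have z8 : σ.arr 8 = fun _ => 0 := hs0.arr 8 (by decide)
  have z9 : σ.arr 9 = fun _ => 0 := hs0.arr 9 (by decide)
  have z10 : σ.arr 10 = fun _ => 0 := hs0.arr 10 (by decide)
  refine .cons_frame (.forLt I.n r0 (by omega) (by decide) (by decide) (by decide)
    (fun i τ => (∀ a : Fin I.n, (a : ℕ) < i →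
      τ.arr 7 (a : ℕ) = (I.n + 1) * I.key a ∧ τ.arr 8 (a : ℕ) = (I.n + 1) * I.size a ∧
      ∀ c, τ.arr (ordA c) (a : ℕ) =
        if I.cls a = c then (I.ord a : ℤ) else (I.n + 1) * I.N + I.n + 1) ∧
      ∀ z : ℤ, (i : ℤ) ≤ z → τ.arr 7 z = 0 ∧ τ.arr 8 z = 0 ∧ ∀ c, τ.arr (ordA c) z = 0) ?_ ?_) ?_
  · refine ⟨by simp, fun z _ => ?_⟩
    simp only [Store.setReg_arr, z7, z8, true_and]
    intro c; cases c
    · exact congrFun z10 z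
    · exact congrFun z9 z
  · intro i σ' hi hr hs hI
    have e0 : σ'.reg 0 = I.n := by rw [hs.reg 0 (by decide), r0]
    have e9 : σ'.reg 9 = I.n + 1 := by rw [hs.reg 9 (by decide), h9]
    have e13 : σ'.reg 13 = (I.n + 1) * I.N + I.n + 1 := by rw [hs.reg 13 (by decide), h13]
    obtain ⟨h7, h8, hA⟩ := hI.2 i le_rfl
    set a : Fin I.n := ⟨i, hi⟩ with ha
    have w0 : σ'.arr 0 i = I.w a := by
      rw [hs.arr 0 (by decide), a0]; exact toArr_coe I.w a
    have w1 : σ'.arr 1 i = I.h a := by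
      rw [hs.arr 1 (by decide), a1]; exact toArr_coe I.h a
    have w3 : σ'.arr 3 i = if a ∈ I.hor then 1 else 0 := by
      rw [hs.arr 3 (by decide), a3]
      refine (toArr_coe _ a).trans ?_
      split_ifs <;> rfl
    have hord : ∀ K : ℕ, I.key a = K → ((I.n : ℤ) + 1) * K + I.n - i = I.ord a := by
      rintro K rfl
      have hsub : ((I.n - (a : ℕ) : ℕ) : ℤ) = I.n - i := Nat.cast_sub hi.le
      rw [Instance.ord, Nat.cast_add, hsub]
      push_cast
      ring
    have hfin : ∀ (c : Bool) (τ : Store), I.cls a = c →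
        (∀ z, τ.arr 7 z = if z = (i : ℤ) then ((I.n : ℤ) + 1) * I.key a else σ'.arr 7 z) →
        (∀ z, τ.arr 8 z = if z = (i : ℤ) then ((I.n : ℤ) + 1) * I.size a else σ'.arr 8 z) →
        (∀ z, τ.arr (ordA c) z = if z = (i : ℤ) then (I.ord a : ℤ) else σ'.arr (ordA c) z) →
        (∀ z, τ.arr (ordA !c) z = if z = (i : ℤ) then σ'.reg 13 else σ'.arr (ordA !c) z) →
        (∀ b : Fin I.n, (b : ℕ) < i + 1 →
          τ.arr 7 (b : ℕ) = (I.n + 1) * I.key b ∧ τ.arr 8 (b : ℕ) = (I.n + 1) * I.size b ∧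
          ∀ c, τ.arr (ordA c) (b : ℕ) =
            if I.cls b = c then (I.ord b : ℤ) else (I.n + 1) * I.N + I.n + 1) ∧
        ∀ z : ℤ, ((i + 1 : ℕ) : ℤ) ≤ z →
          τ.arr 7 z = 0 ∧ τ.arr 8 z = 0 ∧ ∀ c, τ.arr (ordA c) z = 0 := by
      intro c τ hc t7 t8 t9 t10
      have hcc : ∀ c', c' = c ∨ c' = !c := by intro c'; cases c' <;> cases c <;> simp
      constructor
      · intro b hb
        by_cases hbi : (b : ℕ) = i
        · obtain rfl : b = a := Fin.ext hbi
          refine ⟨by rw [t7, if_pos (by simp [hbi])], by rw [t8, if_pos (by simp [hbi])], ?_⟩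
          intro c'
          rcases hcc c' with rfl | rfl
          · rw [t9, if_pos (by simp [hbi]), if_pos hc]
          · rw [t10, if_pos (by simp [hbi]), if_neg (by rw [hc]; cases c <;> simp), e13]
        · have hne : ((b : ℕ) : ℤ) ≠ i := by exact_mod_cast hbi
          obtain ⟨f1, f2, f3⟩ := hI.1 b (by omega)
          refine ⟨by rw [t7, if_neg hne, f1], by rw [t8, if_neg hne, f2], ?_⟩
          intro c'
          rcases hcc c' with rfl | rfl
          · rw [t9, if_neg hne, f3]
          · rw [t10, if_neg hne, f3]
      · intro z hz
        have hne : z ≠ i := by push_cast at hz; omega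
        obtain ⟨f1, f2, f3⟩ := hI.2 z (by push_cast at hz; omega)
        refine ⟨by rw [t7, if_neg hne, f1], by rw [t8, if_neg hne, f2], ?_⟩
        intro c'
        rcases hcc c' with rfl | rfl
        · rw [t9, if_neg hne, f3]
        · rw [t10, if_neg hne, f3]
    refine .branch (fun hb => ?_) (fun hb => ?_)
    · have hmem : a ∈ I.hor := by
        by_contra hmem
        simp [hr, w3, hmem] at hb
      have hkey : I.key a = I.w a := if_pos hmem
      have hsize : I.size a = I.h a := if_pos hmem
      refine (runs_prepItem hB (by decide) (by decide) (by decide) (by decide) hr e0 e9 w0 w1 h7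
        h8).imp ?_
      rintro τ ⟨t1, t2, t3, t4⟩
      exact hfin true _ (by simp [Instance.cls, hmem]) (by rw [hkey]; exact t1)
        (by rw [hsize]; exact t2) (by rw [← hord _ hkey]; exact t3) t4
    · have hmem : a ∉ I.hor := by
        intro hmem
        simp [hr, w3, hmem] at hb
      have hkey : I.key a = I.h a := if_neg hmem
      have hsize : I.size a = I.w a := if_neg hmem
      refine (runs_prepItem hB (by decide) (by decide) (by decide) (by decide) hr e0 e9 w1 w0 h7
        h8).imp ?_
      rintro τ ⟨t1, t2, t3, t4⟩
      exact hfin false _ (by simp [Instance.cls, hmem]) (by rw [hkey]; exact t1)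
        (by rw [hsize]; exact t2) (by rw [← hord _ hkey]; exact t3) t4
  · intro τ hI hs
    have e0 : τ.reg 0 = I.n := by rw [hs.reg 0 (by decide), r0]
    have e13 : τ.reg 13 = (I.n + 1) * I.N + I.n + 1 := by rw [hs.reg 13 (by decide), h13]
    have e10 : τ.reg 10 = (I.n + 1) * I.N := by rw [hs.reg 10 (by decide), h10]
    have e11 : τ.reg 11 = (I.n + 1) * I.hL := by rw [hs.reg 11 (by decide), h11]
    have e12 : τ.reg 12 = (I.n + 1) * I.wL := by rw [hs.reg 12 (by decide), h12]
    have e9 : τ.reg 9 = I.n + 1 := by rw [hs.reg 9 (by decide), h9]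
    have e2 : τ.arr 2 = toArr I.p := by rw [hs.arr 2 (by decide), a2]
    have hne : ∀ a : Fin I.n, ((a : ℕ) : ℤ) ≠ I.n := fun a => by have := a.2; omega
    obtain ⟨f7, f8, f9⟩ := hI.2 (I.n + 1) (by omega)
    refine .cons (.write ?_)
    refine .cons (.write ?_)
    refine .cons (.write ?_)
    refine .nil ⟨?_, by simpa using e9⟩
    have hlt := fun a : Fin I.n => hI.1 a a.2
    constructor
    · intro a; simp [e0, hne a, hlt a]
    · simp [e0, e10]
    · simp [e0, f7]
    · intro a; simp [hlt a]
    · simp [f8]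
    · intro c a
      have := (hlt a).2.2 c
      cases c
      · simpa [ordA, e0, hne a] using this
      · simpa [ordA, e0, hne a] using this
    · intro c
      cases c
      · simp [ordA, e0, e13]
      · simp [ordA, e0, e13]
    · intro c
      have := f9 c
      cases c
      · simpa [ordA, e0] using this
      · simpa [ordA, e0] using this
    · intro a; simp [e2, toArr_coe]
    · simpa [e2] using toArr_eq_zero I.p (by omega)
    · intro c
      cases c
      · simp [capR, e12, Instance.cap]
      · simp [capR, e11, Instance.cap]
    · simp [e10]

end LPack

namespace LPack

/-! ### The list of positions and the list of vertices -/

/-- The value `s` occurs in the list in array `11`, whose length is in register `14`. -/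
def Has (σ : Store) (s : ℤ) : Prop := ∃ z : ℤ, 0 ≤ z ∧ z < σ.reg 14 ∧ σ.arr 11 z = s

/-- The list in array `11` has been extended. -/
def Ext (σ τ : Store) : Prop :=
  σ.reg 14 ≤ τ.reg 14 ∧ ∀ z, z < σ.reg 14 → τ.arr 11 z = σ.arr 11 z

theorem Ext.trans {σ τ ρ : Store} (h : Ext σ τ) (h' : Ext τ ρ) : Ext σ ρ :=
  ⟨h.1.trans h'.1, fun z hz => (h'.2 z (hz.trans_le h.1)).trans (h.2 z hz)⟩

theorem Has.ext {σ τ : Store} {s : ℤ} (h : Has σ s) (he : Ext σ τ) : Has τ s := by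
  obtain ⟨z, h1, h2, h3⟩ := h
  exact ⟨z, h1, h2.trans_le he.1, (he.2 z h2).trans h3⟩

/-- Put the multiples of all widths and heights into the list, whose entry `0` is `0` from the
start. -/
def genUnits : Cmd := block
  [.assign 14 (.const 1),
   forLt 5 0 (block
    [.assign 20 (.const 0), .assign 21 (.const 0),
     forLt 6 9 (forLt 7 9 (block
      [incr 20 (.read 0 (.reg 5)), incr 21 (.read 1 (.reg 5)),
       .write 11 (.reg 14) (.reg 20), .write 11 (.add (.reg 14) (.const 1)) (.reg 21),
       incr 14 (.const 2)]))])]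

variable {I : Instance} {B k : ℕ} {σ : Store}

theorem runs_genUnits (hB : I.n + 3 ≤ B) (h0 : σ.reg 0 = I.n) (h9 : σ.reg 9 = I.n + 1)
    (hw : ∀ a : Fin I.n, σ.arr 0 (a : ℕ) = I.w a) (hh : ∀ a : Fin I.n, σ.arr 1 (a : ℕ) = I.h a)
    (h11 : σ.arr 11 0 = 0) : Runs B genUnits σ fun τ =>
      τ.reg 14 = (1 + 2 * (I.n * (I.n + 1) ^ 2) : ℕ) ∧ Has τ 0 ∧
      ∀ u ∈ units I.n I.size, Has τ u := by
  have hzero : Has (σ.setReg 14 1) 0 := ⟨0, by simp [h11]⟩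
  refine .cons (.assign ?_)
  refine .cons_frame (.forLt I.n (by simp [h0]) (by omega) (by decide) (by decide)
    (by decide) (fun i τ => τ.reg 14 = (1 + 2 * (i * (I.n + 1) ^ 2) : ℕ) ∧ Has τ 0 ∧
      ∀ a : Fin I.n, (a : ℕ) < i → ∀ c : ℕ, c ≤ (I.n + 1) ^ 2 →
        Has τ (c * I.w a) ∧ Has τ (c * I.h a)) ?_ ?_) ?_
  · refine ⟨by simp, ?_, by simp⟩
    simpa [Has] using hzero
  · intro i σ1 hi hr hs ⟨hI1, hI2, hI3⟩
    have e9 : σ1.reg 9 = I.n + 1 := by rw [hs.reg 9 (by decide)]; simp [h9]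
    set a : Fin I.n := ⟨i, hi⟩ with ha
    have ew : σ1.arr 0 i = I.w a := by rw [hs.arr 0 (by decide)]; exact hw a
    have eh : σ1.arr 1 i = I.h a := by rw [hs.arr 1 (by decide)]; exact hh a
    refine .cons (.assign ?_)
    refine .cons (.assign ?_)
    -- After `c` of the `(n + 1) ^ 2` inner steps.
    let G : ℕ → Store → Prop := fun c τ =>
      τ.reg 14 = (1 + 2 * (i * (I.n + 1) ^ 2 + c) : ℕ) ∧ τ.reg 20 = c * I.w a ∧
      τ.reg 21 = c * I.h a ∧ Ext σ1 τ ∧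
      ∀ c' : ℕ, c' ≤ c → Has τ (c' * I.w a) ∧ Has τ (c' * I.h a)
    refine .cons_frame (.forLt (I.n + 1) (by simp [e9]) (by omega) (by decide) (by decide)
      (by decide) (fun j τ => G (j * (I.n + 1)) τ) ?_ ?_) ?_
    · refine ⟨by simpa using hI1, by simp, by simp, ⟨by simp, by simp⟩, ?_⟩
      intro c' hc'
      obtain rfl : c' = 0 := by omega
      have : Has (((σ1.setReg 20 0).setReg 21 0).setReg 6 0) 0 := by simpa [Has] using hI2
      simpa using this
    · intro j σ2 hj hr2 hs2 hG
      have e9' : σ2.reg 9 = I.n + 1 := by rw [hs2.reg 9 (by decide)]; simp [e9]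
      refine (Runs.forLt (I.n + 1) (by simp [e9']) (by omega) (by decide) (by decide)
        (by decide) (fun l τ => G (j * (I.n + 1) + l) τ) ?_ ?_).imp ?_
      · simpa [G, Has, Ext] using hG
      · intro l σ3 hl hr3 hs3 ⟨g1, g2, g3, g4, g5⟩
        have e5 : σ3.reg 5 = i := by
          rw [hs3.reg 5 (by decide), hs2.reg 5 (by decide)]; simp [hr]
        have ew' : σ3.arr 0 i = I.w a := by
          rw [hs3.arr 0 (by decide), hs2.arr 0 (by decide)]; exact ew
        have eh' : σ3.arr 1 i = I.h a := by
          rw [hs3.arr 1 (by decide), hs2.arr 1 (by decide)]; exact eh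
        refine .cons (.incr ?_)
        refine .cons (.incr ?_)
        refine .cons (.write ?_)
        refine .cons (.write ?_)
        refine .cons (.incr ?_)
        refine .nil ?_
        simp only [Expr.eval, Store.setReg_reg, Store.setReg_arr, Store.setArr_reg, reduceIte,
          Nat.reduceEqDiff, e5, ew', eh', g2, g3]
        generalize hτ : Store.setReg _ 7 _ = τ
        have hpos : (0 : ℤ) ≤ σ3.reg 14 := by rw [g1]; positivity
        have t14 : τ.reg 14 = σ3.reg 14 + 2 := by simp [← hτ]
        have t20 : τ.reg 20 = (j * (I.n + 1) + l : ℕ) * I.w a + I.w a := by simp [← hτ]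
        have t21 : τ.reg 21 = (j * (I.n + 1) + l : ℕ) * I.h a + I.h a := by simp [← hτ]
        have tn : τ.arr 11 (σ3.reg 14) = (j * (I.n + 1) + l : ℕ) * I.w a + I.w a := by simp [← hτ]
        have tn' : τ.arr 11 (σ3.reg 14 + 1) = (j * (I.n + 1) + l : ℕ) * I.h a + I.h a := by
          simp [← hτ]
        have hext : Ext σ3 τ := by
          refine ⟨by omega, fun z hz => ?_⟩
          have hz1 : z ≠ σ3.reg 14 + 1 := by omega
          simp [← hτ, hz.ne, hz1]
        refine ⟨?_, ?_, ?_, g4.trans hext, ?_⟩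
        · rw [t14, g1]; push_cast; ring
        · rw [t20]; push_cast; ring
        · rw [t21]; push_cast; ring
        · intro c' hc'
          rcases Nat.lt_or_ge c' (j * (I.n + 1) + (l + 1)) with hlt | hge
          · have := g5 c' (by omega)
            exact ⟨this.1.ext hext, this.2.ext hext⟩
          · obtain rfl : c' = j * (I.n + 1) + l + 1 := by omega
            refine ⟨⟨σ3.reg 14, hpos, by omega, ?_⟩, ⟨σ3.reg 14 + 1, by omega, by omega, ?_⟩⟩
            · rw [tn]; push_cast; ring
            · rw [tn']; push_cast; ring
      · intro τ hτ
        have : (j + 1) * (I.n + 1) = j * (I.n + 1) + (I.n + 1) := by ring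
        rw [this]
        simpa [G, Has, Ext] using hτ
    · rintro τ ⟨g1, -, -, g4, g5⟩ -
      refine .nil ⟨?_, ?_, ?_⟩
      · have : (i + 1) * (I.n + 1) ^ 2 = i * (I.n + 1) ^ 2 + (I.n + 1) * (I.n + 1) := by ring
        rw [this]; simpa using g1
      · simpa [Has] using hI2.ext g4
      · intro b hb c hc
        by_cases hbi : (b : ℕ) = i
        · obtain rfl : b = a := Fin.ext hbi
          simpa [Has] using g5 c (by rwa [← sq])
        · have := hI3 b (by omega) c hc
          simpa [Has] using (⟨this.1.ext g4, this.2.ext g4⟩ : _ ∧ _)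
  · rintro τ ⟨h1, h2, h3⟩ -
    refine .nil ⟨h1, h2, ?_⟩
    rintro u ⟨a, m, hm, rfl⟩
    have := h3 a a.2 m hm
    unfold Instance.size
    split_ifs
    · exact_mod_cast this.2
    · exact_mod_cast this.1

/-- Add all sums of two elements to the list. -/
def double : Cmd := block
  [.assign 15 (.reg 14),
   forLt 7 15 (forLt 8 15 (block
    [.write 11 (.reg 14) (.add (.read 11 (.reg 7)) (.read 11 (.reg 8))), incr 14 (.const 1)]))]

theorem runs_double {m : ℕ} (hm : σ.reg 14 = m) (hB : m ≤ B) : Runs B double σ fun τ =>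
    τ.reg 14 = (m + m * m : ℕ) ∧ Ext σ τ ∧ ∀ s s', Has σ s → Has σ s' → Has τ (s + s') := by
  refine .cons (.assign ?_)
  -- After `c` steps.
  let G : ℕ → Store → Prop := fun c τ => τ.reg 14 = (m + c : ℕ) ∧ Ext σ τ
  refine .cons_frame (.forLt m (by simp [hm]) hB (by decide) (by decide) (by decide)
    (fun i τ => G (i * m) τ ∧ ∀ i' j' : ℕ, i' < i → j' < m →
      Has τ (σ.arr 11 i' + σ.arr 11 j')) ?_ ?_) ?_
  · simp [G, Ext, hm]
  · intro i σ1 hi hr hs ⟨hG, hI⟩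
    have e15 : σ1.reg 15 = m := by rw [hs.reg 15 (by decide)]; simp [hm]
    refine (Runs.forLt m e15 hB (by decide) (by decide) (by decide)
      (fun j τ => G (i * m + j) τ ∧ (∀ i' j' : ℕ, i' < i → j' < m →
        Has τ (σ.arr 11 i' + σ.arr 11 j')) ∧ ∀ j' < j, Has τ (σ.arr 11 i + σ.arr 11 j'))
      ?_ ?_).imp ?_
    · simpa [G, Has, Ext] using ⟨hG, hI⟩
    · intro j σ2 hj hr2 hs2 ⟨⟨g1, g2⟩, g3, g4⟩
      have e7 : σ2.reg 7 = i := by rw [hs2.reg 7 (by decide), hr]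
      have ei : σ2.arr 11 i = σ.arr 11 i := g2.2 i (by rw [hm]; exact_mod_cast hi)
      have ej : σ2.arr 11 j = σ.arr 11 j := g2.2 j (by rw [hm]; exact_mod_cast hj)
      refine .cons (.write ?_)
      refine .cons (.incr ?_)
      refine .nil ?_
      simp only [Expr.eval, e7, hr2, ei, ej]
      generalize hτ : Store.setReg _ 8 _ = τ
      have hpos : (0 : ℤ) ≤ σ2.reg 14 := by rw [g1]; positivity
      have t14 : τ.reg 14 = σ2.reg 14 + 1 := by simp [← hτ]
      have tn : τ.arr 11 (σ2.reg 14) = σ.arr 11 i + σ.arr 11 j := by simp [← hτ]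
      have hext : Ext σ2 τ := ⟨by omega, fun z hz => by simp [← hτ, hz.ne]⟩
      refine ⟨⟨?_, g2.trans hext⟩, fun i' j' hi' hj' => (g3 i' j' hi' hj').ext hext, ?_⟩
      · rw [t14, g1]; push_cast; ring
      · intro j' hj'
        rcases Nat.lt_or_ge j' j with hlt | hge
        · exact (g4 j' hlt).ext hext
        · obtain rfl : j' = j := by omega
          exact ⟨σ2.reg 14, hpos, by omega, tn⟩
    · intro τ ⟨hG', h1, h2⟩
      have : (i + 1) * m = i * m + m := by ring
      rw [this]
      have h3 : ∀ i' j' : ℕ, i' < i + 1 → j' < m → Has τ (σ.arr 11 i' + σ.arr 11 j') := by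
        intro i' j' hi' hj'
        rcases Nat.lt_or_ge i' i with hlt | hge
        · exact h1 i' j' hlt hj'
        · obtain rfl : i' = i := by omega
          exact h2 j' hj'
      exact ⟨by simpa [G, Ext] using hG', fun i' j' hi' hj' => by
        simpa [Has] using h3 i' j' hi' hj'⟩
  · rintro τ ⟨⟨h1, h2⟩, h3⟩ -
    refine .nil ⟨h1, h2, ?_⟩
    rintro s s' ⟨z, z1, z2, rfl⟩ ⟨z', z1', z2', rfl⟩
    obtain ⟨i, rfl⟩ := Int.eq_ofNat_of_zero_le z1
    obtain ⟨j, rfl⟩ := Int.eq_ofNat_of_zero_le z1'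
    exact h3 i j (by rw [hm] at z2; exact_mod_cast z2) (by rw [hm] at z2'; exact_mod_cast z2')

/-- The length of the list after `d` doublings. -/
def listSize (n : ℕ) : ℕ → ℕ
  | 0 => 1 + 2 * (n * (n + 1) ^ 2)
  | d + 1 => listSize n d + listSize n d * listSize n d

theorem listSize_mono (n : ℕ) : Monotone (listSize n) :=
  monotone_nat_of_le_succ fun _ => Nat.le_add_right _ _

/-- Compute the list of positions by `(2 k + 2) ^ 2` doublings; register `22` is set to `2 k + 2`.
After `d` doublings the list holds all sums of at most `2 ^ d` of its original entries. -/
def genSums : Cmd := block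
  [.assign 22 (.add (.add (.reg 4) (.reg 4)) (.const 2)), forLt 5 22 (forLt 6 22 double)]

theorem split_sums {U : Set ℕ} {M s : ℕ} (h : s ∈ sums U (2 * M)) :
    ∃ s1 ∈ sums U M, ∃ s2 ∈ sums U M, s = s1 + s2 := by
  obtain ⟨l, h1, h2, rfl⟩ := h
  refine ⟨(l.take M).sum, ⟨l.take M, by simp, fun u hu => h2 u (List.mem_of_mem_take hu), rfl⟩,
    (l.drop M).sum, ⟨l.drop M, by simp; omega, fun u hu => h2 u (List.mem_of_mem_drop hu), rfl⟩, ?_⟩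
  rw [← List.sum_append, List.take_append_drop]

theorem runs_genSums {U : Set ℕ} (hk : σ.reg 4 = k) (hB : 2 * k + 2 ≤ B)
    (hB' : listSize I.n ((2 * k + 2) * (2 * k + 2)) ≤ B) (hm : σ.reg 14 = listSize I.n 0)
    (h0 : Has σ 0) (hU : ∀ u ∈ U, Has σ (u : ℕ)) : Runs B genSums σ fun τ =>
      τ.reg 14 = listSize I.n ((2 * k + 2) * (2 * k + 2)) ∧
      ∀ s ∈ sums U (2 ^ ((2 * k + 2) * (2 * k + 2))), Has τ s := by
  let G : ℕ → Store → Prop := fun d τ => τ.reg 14 = listSize I.n d ∧ ∀ s ∈ sums U (2 ^ d), Has τ s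
  have hG0 : G 0 σ := by
    refine ⟨hm, ?_⟩
    rintro s ⟨l, h1, h2, rfl⟩
    rcases l with _ | ⟨u, _ | ⟨v, l⟩⟩
    · simpa using h0
    · simpa using hU u (h2 u (by simp))
    · simp at h1
  have hset : ∀ d r v τ, r ≠ 14 → G d τ → G d (τ.setReg r v) := by
    intro d r v τ hr h
    simpa [G, Has, hr.symm] using h
  refine .cons (.assign ?_)
  refine .cons_frame (.forLt (2 * k + 2) ?_ hB (by decide) (by decide) (by decide)
    (fun i τ => G (i * (2 * k + 2)) τ) ?_ ?_) ?_
  · simp [hk]; ring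
  · rw [zero_mul]
    exact hset _ _ _ _ (by decide) (hset _ _ _ _ (by decide) hG0)
  · intro i σ1 hi hr hs hG
    have e22 : σ1.reg 22 = (2 * k + 2 : ℕ) := by
      rw [hs.reg 22 (by decide)]; simp [hk]; ring
    refine (Runs.forLt (2 * k + 2) e22 hB (by decide) (by decide) (by decide)
      (fun j τ => G (i * (2 * k + 2) + j) τ) (hset _ _ _ _ (by decide) hG) ?_).imp ?_
    · intro j σ2 hj hr2 hs2 ⟨g1, g2⟩
      have hle : i * (2 * k + 2) + j ≤ (2 * k + 2) * (2 * k + 2) := by nlinarith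
      refine (runs_double g1 ((listSize_mono _ hle).trans hB')).imp ?_
      rintro τ ⟨t1, t2, t3⟩
      refine hset _ _ _ _ (by decide) ⟨t1, ?_⟩
      intro s hs
      rw [← add_assoc, pow_succ'] at hs
      obtain ⟨s1, h1, s2, h2, rfl⟩ := split_sums hs
      push_cast
      exact t3 _ _ (g2 s1 h1) (g2 s2 h2)
    · intro τ h
      have : (i + 1) * (2 * k + 2) = i * (2 * k + 2) + (2 * k + 2) := by ring
      rw [this]
      exact hset _ _ _ _ (by decide) h
  · exact fun τ h _ => .nil h

/-- List all vertices, with the vertex `0` where nothing is packed in front; register `24` is set to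
`n + 2`. -/
def genVerts : Cmd := block
  [.assign 24 (.add (.reg 9) (.const 1)), .write 12 (.const 0) (.reg 0),
   .write 13 (.const 0) (.reg 0), .assign 16 (.const 1),
   forLt 5 24 (forLt 6 24 (forLt 7 14 (forLt 8 14 (block
    [.write 12 (.reg 16) (.reg 5), .write 13 (.reg 16) (.reg 6),
     .write 14 (.reg 16) (.read 11 (.reg 7)), .write 15 (.reg 16) (.read 11 (.reg 8)),
     incr 16 (.const 1)]))))]

/-- The number of vertices, for positions from a list of length `m`. -/
def vertCount (n m : ℕ) : ℕ := 1 + (n + 2) * ((n + 2) * (m * m))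

/-- The state after `c` vertices have been listed, among them those with indices in `D`. -/
structure Listed (I : Instance) (S : ℤ → ℤ) (c : ℕ) (D : ℕ → ℕ → ℕ → ℕ → Prop) (τ : Store) :
    Prop where
  count : τ.reg 16 = (1 + c : ℕ)
  range : ∀ z, Vtx τ z → (0 ≤ τ.arr 12 z ∧ τ.arr 12 z ≤ I.n + 1) ∧
    0 ≤ τ.arr 13 z ∧ τ.arr 13 z ≤ I.n + 1
  start : τ.arr 12 0 = I.n ∧ τ.arr 13 0 = I.n ∧ τ.arr 14 0 = 0 ∧ τ.arr 15 0 = 0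
  done : ∀ i j a b, D i j a b → ∃ z, Vtx τ z ∧ τ.arr 12 z = i ∧ τ.arr 13 z = j ∧
    τ.arr 14 z = S a ∧ τ.arr 15 z = S b

theorem Listed.setReg {S : ℤ → ℤ} {c c' : ℕ} {D D' : ℕ → ℕ → ℕ → ℕ → Prop} {τ : Store}
    (h : Listed I S c D τ) {r : ℕ} (hr : r ≠ 16) (v : ℤ) (hc : c = c')
    (hD : ∀ i j a b, D' i j a b → D i j a b) : Listed I S c' D' (τ.setReg r v) := by
  subst hc
  refine ⟨?_, ?_, ?_, ?_⟩
  · simpa [hr.symm] using h.count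
  · simpa [Vtx, hr.symm] using h.range
  · simpa using h.start
  · intro i j a b hij
    simpa [Vtx, hr.symm] using h.done i j a b (hD i j a b hij)

theorem runs_genVerts {m : ℕ} (h0 : σ.reg 0 = I.n) (h9 : σ.reg 9 = I.n + 1) (hm : σ.reg 14 = m)
    (hB : I.n + 3 ≤ B) (hmB : m ≤ B) (h14 : σ.arr 14 0 = 0) (h15 : σ.arr 15 0 = 0) :
    Runs B genVerts σ fun τ => τ.reg 24 = I.n + 2 ∧ τ.reg 16 = vertCount I.n m ∧
      Verts I τ {s | Has σ s} := by
  refine .cons (.assign ?_)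
  refine .cons (.write ?_)
  refine .cons (.write ?_)
  refine .cons (.assign ?_)
  generalize hσ0 : Store.setReg _ 16 _ = σ0
  have e24 : σ0.reg 24 = (I.n + 2 : ℕ) := by simp [← hσ0, h9]; ring
  have e14 : σ0.reg 14 = m := by simp [← hσ0, hm]
  have e11 : σ0.arr 11 = σ.arr 11 := by ext z; simp [← hσ0]
  have hL0 : Listed I (σ.arr 11) 0 (fun _ _ _ _ => False) σ0 := by
    refine ⟨by simp [← hσ0], ?_, ?_, by simp⟩
    · rintro z ⟨hz1, hz2⟩
      obtain rfl : z = 0 := by simp [← hσ0] at hz2; omega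
      simp [← hσ0, h0]
    · simp [← hσ0, h0, h14, h15]
  refine .cons_frame (.forLt (I.n + 2) e24 (by omega) (by decide) (by decide) (by decide)
    (fun i τ => Listed I (σ.arr 11) (i * ((I.n + 2) * (m * m)))
      (fun i' j' a' b' => i' < i ∧ j' < I.n + 2 ∧ a' < m ∧ b' < m) τ)
    (hL0.setReg (by decide) _ (by simp) (by simp)) ?_) ?_
  · intro i σ1 hi r1 s1 L1
    refine (Runs.forLt (I.n + 2) (by rw [s1.reg 24 (by decide), e24]) (by omega) (by decide)
      (by decide) (by decide)
      (fun j τ => Listed I (σ.arr 11) (i * ((I.n + 2) * (m * m)) + j * (m * m))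
        (fun i' j' a' b' => (i' < i ∧ j' < I.n + 2 ∧ a' < m ∧ b' < m) ∨
          i' = i ∧ j' < j ∧ a' < m ∧ b' < m) τ)
      (L1.setReg (by decide) _ (by simp) (by simp)) ?_).imp ?_
    · intro j σ2 hj r2 s2 L2
      refine (Runs.forLt m (by rw [s2.reg 14 (by decide), s1.reg 14 (by decide), e14]) hmB
        (by decide) (by decide) (by decide)
        (fun a τ => Listed I (σ.arr 11) (i * ((I.n + 2) * (m * m)) + j * (m * m) + a * m)
          (fun i' j' a' b' => ((i' < i ∧ j' < I.n + 2 ∧ a' < m ∧ b' < m) ∨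
            i' = i ∧ j' < j ∧ a' < m ∧ b' < m) ∨ i' = i ∧ j' = j ∧ a' < a ∧ b' < m) τ)
        (L2.setReg (by decide) _ (by simp) (by simp)) ?_).imp ?_
      · intro a σ3 ha r3 s3 L3
        refine (Runs.forLt m (by
            rw [s3.reg 14 (by decide), s2.reg 14 (by decide), s1.reg 14 (by decide), e14]) hmB
          (by decide) (by decide) (by decide)
          (fun b τ => Listed I (σ.arr 11) (i * ((I.n + 2) * (m * m)) + j * (m * m) + a * m + b)
            (fun i' j' a' b' => (((i' < i ∧ j' < I.n + 2 ∧ a' < m ∧ b' < m) ∨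
              i' = i ∧ j' < j ∧ a' < m ∧ b' < m) ∨ i' = i ∧ j' = j ∧ a' < a ∧ b' < m) ∨
              i' = i ∧ j' = j ∧ a' = a ∧ b' < b) τ)
          (L3.setReg (by decide) _ (by simp) (by simp)) ?_).imp ?_
        · intro b σ4 hb r4 s4 L4
          have f5 : σ4.reg 5 = i := by
            rw [s4.reg 5 (by decide), s3.reg 5 (by decide), s2.reg 5 (by decide), r1]
          have f6 : σ4.reg 6 = j := by rw [s4.reg 6 (by decide), s3.reg 6 (by decide), r2]
          have f7 : σ4.reg 7 = a := by rw [s4.reg 7 (by decide), r3]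
          have f11 : σ4.arr 11 = σ.arr 11 := by
            rw [s4.arr 11 (by decide), s3.arr 11 (by decide), s2.arr 11 (by decide),
              s1.arr 11 (by decide), e11]
          have hpos : 0 < σ4.reg 16 := by rw [L4.count]; positivity
          refine .cons (.write ?_)
          refine .cons (.write ?_)
          refine .cons (.write ?_)
          refine .cons (.write ?_)
          refine .cons (.incr ?_)
          refine .nil ?_
          refine Listed.setReg (c := i * ((I.n + 2) * (m * m)) + j * (m * m) + a * m + b + 1)
            (D := fun i' j' a' b' => (((i' < i ∧ j' < I.n + 2 ∧ a' < m ∧ b' < m) ∨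
              i' = i ∧ j' < j ∧ a' < m ∧ b' < m) ∨ i' = i ∧ j' = j ∧ a' < a ∧ b' < m) ∨
              i' = i ∧ j' = j ∧ a' = a ∧ b' < b + 1) ?_ (by decide) _ (by ring) (by simp)
          simp only [Expr.eval, Store.setArr_reg, Store.setArr_arr, f5, f6, f7, r4, f11,
            Nat.reduceEqDiff, false_and, if_false]
          generalize hτ : Store.setReg _ 16 _ = τ
          have t16 : τ.reg 16 = σ4.reg 16 + 1 := by simp [← hτ]
          have t12 : ∀ z, τ.arr 12 z = if z = σ4.reg 16 then (i : ℤ) else σ4.arr 12 z := by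
            simp [← hτ]
          have t13 : ∀ z, τ.arr 13 z = if z = σ4.reg 16 then (j : ℤ) else σ4.arr 13 z := by
            simp [← hτ]
          have t14 : ∀ z, τ.arr 14 z = if z = σ4.reg 16 then σ.arr 11 a else σ4.arr 14 z := by
            simp [← hτ]
          have t15 : ∀ z, τ.arr 15 z = if z = σ4.reg 16 then σ.arr 11 b else σ4.arr 15 z := by
            simp [← hτ]
          refine ⟨?_, ?_, ?_, ?_⟩
          · rw [t16, L4.count]; push_cast; ring
          · rintro z ⟨z1, z2⟩
            rw [t12, t13]
            by_cases hz : z = σ4.reg 16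
            · simp only [hz, if_true]; omega
            · simp only [hz, if_false]
              exact L4.range z ⟨z1, by omega⟩
          · rw [t12, t13, t14, t15]
            simp only [hpos.ne, if_false]
            exact L4.start
          · intro i' j' a' b' hd
            have hd' : ((((i' < i ∧ j' < I.n + 2 ∧ a' < m ∧ b' < m) ∨
              i' = i ∧ j' < j ∧ a' < m ∧ b' < m) ∨ i' = i ∧ j' = j ∧ a' < a ∧ b' < m) ∨
              i' = i ∧ j' = j ∧ a' = a ∧ b' < b) ∨
              i' = i ∧ j' = j ∧ a' = a ∧ b' = b := by
              rcases hd with hd | ⟨h1, h2, h3, h4⟩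
              · exact .inl (.inl hd)
              · rcases Nat.lt_succ_iff_lt_or_eq.1 h4 with h5 | h5
                exacts [.inl (.inr ⟨h1, h2, h3, h5⟩), .inr ⟨h1, h2, h3, h5⟩]
            rcases hd' with hd' | ⟨rfl, rfl, rfl, rfl⟩
            · obtain ⟨z, ⟨z1, z2⟩, z3⟩ := L4.done i' j' a' b' hd'
              refine ⟨z, ⟨z1, by omega⟩, ?_⟩
              rw [t12, t13, t14, t15]
              simpa only [z2.ne, if_false] using z3
            · refine ⟨σ4.reg 16, ⟨hpos.le, by omega⟩, ?_⟩
              rw [t12, t13, t14, t15]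
              simp
        · intro τ hτ
          refine hτ.setReg (by decide) _ (by ring) ?_
          intro i' j' a' b' h
          omega
      · intro τ hτ
        refine hτ.setReg (by decide) _ (by ring) ?_
        intro i' j' a' b' h
        omega
    · intro τ hτ
      refine hτ.setReg (by decide) _ (by ring) ?_
      intro i' j' a' b' h
      omega
  · intro τ hL hs
    refine .nil ⟨?_, ?_, ?_⟩
    · rw [hs.reg 24 (by decide), e24]; push_cast; ring
    · rw [hL.count, vertCount]
    · refine ⟨?_, ?_, ?_, ?_⟩
      · intro c q hq
        cases c
        exacts [(hL.range q hq).2, (hL.range q hq).1]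
      · rw [hL.count]; positivity
      · intro c
        cases c
        exacts [⟨hL.start.2.1, hL.start.2.2.2⟩, ⟨hL.start.1, hL.start.2.2.1⟩]
      · intro f g hf hg
        have hf' : ∀ c, ∃ i : ℕ, i < I.n + 2 ∧ f c = i := by
          intro c
          obtain ⟨i, hi⟩ := Int.eq_ofNat_of_zero_le (hf c).1
          have := (hf c).2
          exact ⟨i, by omega, hi⟩
        have hg' : ∀ c, ∃ a : ℕ, a < m ∧ σ.arr 11 a = g c := by
          intro c
          obtain ⟨z, z1, z2, z3⟩ := hg c
          obtain ⟨a, rfl⟩ := Int.eq_ofNat_of_zero_le z1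
          rw [hm] at z2
          exact ⟨a, by exact_mod_cast z2, z3⟩
        choose i hi hi' using hf'
        choose a ha ha' using hg'
        obtain ⟨z, z1, z2, z3, z4, z5⟩ := hL.done (i true) (i false) (a true) (a false)
          ⟨hi true, hi false, ha true, ha false⟩
        refine ⟨z, z1, fun c => ?_⟩
        rw [hi', ← ha']
        cases c
        exacts [⟨z3, z5⟩, ⟨z2, z4⟩]

end LPack

namespace LPack

/-! ### The best path -/

/-- Array `16` holds, for each vertex from which the end has been found to be reachable, `1` plus
a lower bound for the gain of the path to the end along the successors in array `17`, and `0` for the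
other vertices. This program takes the edge of class `c` from the vertex in register `17` to that in
register `18` into account: it checks the conditions of `Edge`, that the end is reachable from the
latter vertex, and that the value improves. -/
def relax (c : Bool) : Cmd := guard
  [(.read (itemA !c) (.reg 18), .read (itemA !c) (.reg 17)),
   (.read (itemA !c) (.reg 17), .read (itemA !c) (.reg 18)),
   (.read (topA !c) (.reg 18), .read (topA !c) (.reg 17)),
   (.read (topA !c) (.reg 17), .read (topA !c) (.reg 18)),
   (.add (.read (ordA c) (.read (itemA c) (.reg 18))) (.const 1),
     .read (ordA c) (.read (itemA c) (.reg 17))),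
   (.add (.read (topA c) (.reg 17)) (.read 8 (.read (itemA c) (.reg 18))),
     .read (topA c) (.reg 18)),
   (.read (topA c) (.reg 18), .reg (capR c)),
   (.add (.read (topA c) (.reg 17)) (.read 7 (.read (itemA !c) (.reg 17))), .reg 10),
   (.const 1, .read 16 (.reg 18)),
   (.add (.read 16 (.reg 17)) (.const 1),
     .add (.read 16 (.reg 18)) (.read 2 (.read (itemA c) (.reg 18))))]
  (block
    [.write 16 (.reg 17) (.add (.read 16 (.reg 18)) (.read 2 (.read (itemA c) (.reg 18)))),
     .write 17 (.reg 17) (.reg 18)])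

/-- Give the value `1` to the vertices at the end, which are their own successors, then relax all
edges `n + 2` times. -/
def search : Cmd := block
  [forLt 17 16 (guard [(.reg 9, .read 12 (.reg 17)), (.reg 9, .read 13 (.reg 17))] (block
    [.write 16 (.reg 17) (.const 1), .write 17 (.reg 17) (.reg 17)])),
   forLt 5 24 (forLt 17 16 (forLt 18 16 (block [relax true, relax false])))]

variable {I : Instance} {B : ℕ} {σ σ0 : Store} {T : Set ℤ}

/-- The values `W` are justified by the successors `s`. In an edge, only an inequality can be demanded,
since the value of the successor may improve later. -/
def Sound (I : Instance) (σ : Store) (W s : ℤ → ℤ) : Prop :=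
  ∀ q, Vtx σ q → 1 ≤ W q →
    ((∀ c, σ.arr (itemA c) q = I.n + 1) ∧ W q = 1 ∧ s q = q) ∨
    ∃ c, Vtx σ (s q) ∧ Edge σ c q (s q) ∧ 1 ≤ W (s q) ∧ W q ≤ W (s q) + gain σ c (s q)

theorem runs_relax {c : Bool} {q q' : ℤ} (hs : Same [5, 17, 18] [16, 17] σ0 σ)
    (hsound : Sound I σ0 (σ.arr 16) (σ.arr 17)) (h17 : σ.reg 17 = q) (h18 : σ.reg 18 = q')
    (hq' : Vtx σ0 q') : Runs B (relax c) σ fun τ =>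
      Sound I σ0 (τ.arr 16) (τ.arr 17) ∧ (∀ z, σ.arr 16 z ≤ τ.arr 16 z) ∧
      (Edge σ0 c q q' → 1 ≤ σ.arr 16 q' → σ.arr 16 q' + gain σ0 c q' ≤ τ.arr 16 q) := by
  have e1 : ∀ c, σ.arr (itemA c) = σ0.arr (itemA c) := by
    intro c; cases c <;> exact hs.arr _ (by decide)
  have e2 : ∀ c, σ.arr (topA c) = σ0.arr (topA c) := by
    intro c; cases c <;> exact hs.arr _ (by decide)
  have e3 : σ.arr (ordA c) = σ0.arr (ordA c) := by
    cases c <;> exact hs.arr _ (by decide)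
  have e4 : σ.reg (capR c) = σ0.reg (capR c) := by
    cases c <;> exact hs.reg _ (by decide)
  have e5 : σ.arr 8 = σ0.arr 8 := hs.arr _ (by decide)
  have e6 : σ.arr 7 = σ0.arr 7 := hs.arr _ (by decide)
  have e7 : σ.arr 2 = σ0.arr 2 := hs.arr _ (by decide)
  have e8 : σ.reg 10 = σ0.reg 10 := hs.reg _ (by decide)
  refine .guard (fun h => ?_) (fun h => ?_)
  · simp only [List.mem_cons, List.not_mem_nil, or_false, forall_eq_or_imp, forall_eq, Expr.eval,
      h17, h18, e1, e2, e3, e4, e5, e6, e7, e8] at h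
    obtain ⟨h1, h1', h2, h2', h3, h4, h5, h6, h7, h8⟩ := h
    have hedge : Edge σ0 c q q' := ⟨le_antisymm h1 h1', le_antisymm h2 h2', h3, h4, h5, h6⟩
    have hne : q' ≠ q := by
      rintro rfl
      omega
    refine .cons (.write ?_)
    refine .cons (.write ?_)
    refine .nil ?_
    have hgain : σ0.arr 2 (σ0.arr (itemA c) q') = gain σ0 c q' := rfl
    rw [hgain] at h8
    simp only [Expr.eval, Store.setArr_reg, h17, h18, e1, e7, hgain]
    generalize hτ : Store.setArr _ 17 _ _ = τ
    have t16 : ∀ z, τ.arr 16 z = if z = q then σ.arr 16 q' + gain σ0 c q' else σ.arr 16 z := by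
      simp [← hτ]
    have t17 : ∀ z, τ.arr 17 z = if z = q then q' else σ.arr 17 z := by
      simp [← hτ]
    have hle : ∀ z, σ.arr 16 z ≤ τ.arr 16 z := by
      intro z
      rw [t16]
      split_ifs with hz
      · rw [hz]; omega
      · exact le_rfl
    refine ⟨?_, hle, fun _ _ => by rw [t16, if_pos rfl]⟩
    intro z hz hz1
    by_cases hzq : z = q
    · right
      subst hzq
      refine ⟨c, ?_⟩
      have u17 : τ.arr 17 z = q' := by rw [t17, if_pos rfl]
      have u16 : τ.arr 16 z = σ.arr 16 q' + gain σ0 c q' := by rw [t16, if_pos rfl]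
      have v16 : τ.arr 16 q' = σ.arr 16 q' := by rw [t16, if_neg hne]
      rw [u17, u16, v16]
      exact ⟨hq', hedge, h7, le_rfl⟩
    · rw [t16, if_neg hzq] at hz1
      rw [t16, if_neg hzq, t17, if_neg hzq]
      rcases hsound z hz hz1 with h | ⟨c', l1, l2, l3, l4⟩
      · exact .inl h
      · exact .inr ⟨c', l1, l2, l3.trans (hle _), l4.trans (by gcongr; exact hle _)⟩
  · refine ⟨hsound, fun z => le_rfl, fun hedge h1 => ?_⟩
    by_contra hlt
    refine h ?_
    simp only [List.mem_cons, List.not_mem_nil, or_false, forall_eq_or_imp, forall_eq, Expr.eval,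
      h17, h18, e1, e2, e3, e4, e5, e6, e7, e8]
    obtain ⟨l1, l2, l3, l4, l5, l6⟩ := hedge
    unfold gain at hlt
    exact ⟨l1.le, l1.ge, l2.le, l2.ge, l3, l4, l5, l6, h1, by omega⟩

theorem Reach.nonneg (hp : ∀ z, 0 ≤ σ.arr 2 z) {d : ℕ} {q g : ℤ} (h : Reach I σ d q g) : 0 ≤ g := by
  induction h with
  | fin _ => exact le_rfl
  | step _ _ _ ih => exact add_nonneg ih (hp _)

/-- After the search, the values are justified by the successors, and no path from a vertex is
better than its value: after `d` rounds, this holds for the paths of at most `d` edges. -/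
theorem runs_search (hV : Verts I σ T) (hp : ∀ z, 0 ≤ σ.arr 2 z) (h9 : σ.reg 9 = I.n + 1)
    (h24 : σ.reg 24 = I.n + 2) (hB : I.n + 3 ≤ B) {V : ℕ} (hv : σ.reg 16 = V) (hVB : V ≤ B)
    (h16 : ∀ z, σ.arr 16 z = 0) : Runs B search σ fun τ =>
      Sound I σ (τ.arr 16) (τ.arr 17) ∧
      ∀ q g, Vtx σ q → Reach I σ (I.n + 2) q g → g + 1 ≤ τ.arr 16 q := by
  have hcast : ∀ {j : ℕ}, j < V → Vtx σ j := fun hj => ⟨by positivity, by rw [hv]; exact_mod_cast hj⟩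
  refine .cons_frame (.forLt V hv hVB (by decide) (by decide) (by decide)
    (fun i τ =>
      (∀ q, Vtx σ q → 1 ≤ τ.arr 16 q →
        (∀ c, σ.arr (itemA c) q = I.n + 1) ∧ τ.arr 16 q = 1 ∧ τ.arr 17 q = q) ∧
      ∀ q, Vtx σ q → q < i → (∀ c, σ.arr (itemA c) q = I.n + 1) → τ.arr 16 q = 1) ?_ ?_) ?_
  · constructor
    · intro q _ h
      rw [Store.setReg_arr, h16] at h
      omega
    · intro q hq h
      have := hq.1
      push_cast at h
      omega
  · rintro i σ1 hi hr hs ⟨hI1, hI2⟩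
    have e9 : σ1.reg 9 = I.n + 1 := by rw [hs.reg 9 (by decide), h9]
    have e12 : σ1.arr 12 = σ.arr 12 := hs.arr 12 (by decide)
    have e13 : σ1.arr 13 = σ.arr 13 := hs.arr 13 (by decide)
    have hrange := fun c => hV.range c i (hcast hi)
    refine .guard (fun h => ?_) (fun h => ?_)
    · simp only [List.mem_cons, List.not_mem_nil, or_false, forall_eq_or_imp, forall_eq, Expr.eval,
        hr, e9, e12, e13] at h
      have hfin : ∀ c, σ.arr (itemA c) i = I.n + 1 := by
        intro c
        refine le_antisymm (hrange c).2 ?_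
        cases c
        exacts [h.2, h.1]
      refine .cons (.write ?_)
      refine .cons (.write ?_)
      refine .nil ?_
      constructor
      · intro q hq h1
        by_cases hqi : q = i
        · subst hqi
          exact ⟨hfin, by simp [hr], by simp [hr]⟩
        · have h1' : 1 ≤ σ1.arr 16 q := by simpa [hr, hqi] using h1
          simpa [hr, hqi] using hI1 q hq h1'
      · intro q hq hlt hf
        by_cases hqi : q = i
        · simp [hqi, hr]
        · simpa [hr, hqi] using hI2 q hq (by push_cast at hlt; omega) hf
    · refine ⟨fun q hq h1 => by simpa using hI1 q hq (by simpa using h1), fun q hq hlt hf => ?_⟩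
      by_cases hqi : q = i
      · refine absurd ?_ h
        subst hqi
        simp only [List.mem_cons, List.not_mem_nil, or_false, forall_eq_or_imp, forall_eq,
          Expr.eval, hr, e9, e12, e13]
        exact ⟨(hf true).ge, (hf false).ge⟩
      · exact hI2 q hq (by push_cast at hlt; omega) hf
  rintro σ1 ⟨hI1, hI2⟩ hs1
  refine .cons (.imp (.forLt (I.n + 2) (by rw [hs1.reg 24 (by decide), h24]; push_cast; ring)
    (by omega) (by decide) (by decide) (by decide)
    (fun d τ => Sound I σ (τ.arr 16) (τ.arr 17) ∧
      ∀ q g, Vtx σ q → Reach I σ d q g → g + 1 ≤ τ.arr 16 q) ?_ ?_) fun τ hτ => .nil hτ)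
  · refine ⟨fun q hq h => .inl (hI1 q hq h), fun q g hq h => ?_⟩
    cases h with
    | fin hf => exact (hI2 q hq (by rw [← hv]; exact hq.2) hf).ge
  rintro d σ2 hd hr2 hs2 ⟨hS2, hR2⟩
  have hs2' : Same [5, 17, 18] [16, 17] σ σ2 :=
    (hs1.mono (by decide) (by decide)).trans (hs2.mono (by decide) (by decide))
  refine .imp (.forLt V (by rw [hs2'.reg 16 (by decide), hv]) hVB (by decide) (by decide)
    (by decide) (fun i τ => Sound I σ (τ.arr 16) (τ.arr 17) ∧
      (∀ z, σ2.arr 16 z ≤ τ.arr 16 z) ∧ ∀ q, Vtx σ q → q < i → ∀ q', Vtx σ q' → ∀ c,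
        Edge σ c q q' → 1 ≤ σ2.arr 16 q' → σ2.arr 16 q' + gain σ c q' ≤ τ.arr 16 q) ?_ ?_) ?_
  · exact ⟨hS2, fun z => le_rfl, fun q hq h => absurd hq.1 (by push_cast at h; omega)⟩
  · rintro i σ3 hi hr3 hs3 ⟨hS3, hW3, hR3⟩
    have hs3' : Same [5, 17, 18] [16, 17] σ σ3 := hs2'.trans (hs3.mono (by decide) (by decide))
    refine .imp (.forLt V (by rw [hs3'.reg 16 (by decide), hv]) hVB (by decide) (by decide)
      (by decide) (fun j τ => Sound I σ (τ.arr 16) (τ.arr 17) ∧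
        (∀ z, σ3.arr 16 z ≤ τ.arr 16 z) ∧ ∀ q', Vtx σ q' → q' < j → ∀ c,
          Edge σ c i q' → 1 ≤ σ2.arr 16 q' → σ2.arr 16 q' + gain σ c q' ≤ τ.arr 16 i) ?_ ?_) ?_
    · exact ⟨hS3, fun z => le_rfl, fun q hq h => absurd hq.1 (by push_cast at h; omega)⟩
    · rintro j σ4 hj hr4 hs4 ⟨hS4, hW4, hR4⟩
      have hs4' : Same [5, 17, 18] [16, 17] σ σ4 := hs3'.trans (hs4.mono (by decide) (by decide))
      have h17 : σ4.reg 17 = i := by rw [hs4.reg 17 (by decide), hr3]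
      refine .cons_frame (runs_relax (c := true) hs4' hS4 h17 hr4 (hcast hj)) ?_
      rintro σ5 ⟨hS5, hW5, hR5⟩ hs5
      refine .cons (.imp (runs_relax (c := false)
        (hs4'.trans (hs5.mono (by decide) (by decide))) hS5
        (by rw [hs5.reg 17 (by decide), h17]) (by rw [hs5.reg 18 (by decide), hr4])
        (hcast hj)) ?_)
      rintro σ6 ⟨hS6, hW6, hR6⟩
      refine .nil ⟨hS6, fun z => (hW4 z).trans ((hW5 z).trans (hW6 z)), ?_⟩
      intro q' hq' hlt c he h1
      rw [Store.setReg_arr]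
      by_cases hqj : q' = j
      · subst hqj
        have l1 := (hW3 (j : ℤ)).trans (hW4 j)
        have l2 := hW5 (j : ℤ)
        cases c with
        | true =>
          have l3 := hR5 he (h1.trans l1)
          have l4 := hW6 (i : ℤ)
          omega
        | false =>
          have l3 := hR6 he (h1.trans (l1.trans l2))
          omega
      · have l3 := hR4 q' hq' (by push_cast at hlt; omega) c he h1
        have l4 := (hW5 (i : ℤ)).trans (hW6 i)
        omega
    · rintro τ ⟨hS, hW, hR⟩
      refine ⟨hS, fun z => (hW3 z).trans (hW z), fun q hq hlt q' hq' c he h1 => ?_⟩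
      rw [Store.setReg_arr]
      by_cases hqi : q = i
      · subst hqi
        exact hR q' hq' (by rw [← hv]; exact hq'.2) c he h1
      · exact (hR3 q hq (by push_cast at hlt; omega) q' hq' c he h1).trans (hW q)
  · rintro τ ⟨hS, hW, hR⟩
    refine ⟨hS, fun q g hq h => ?_⟩
    rw [Store.setReg_arr]
    cases h with
    | fin hf => exact (hR2 q 0 hq (.fin hf)).trans (hW q)
    | step hq' he h' =>
      rename_i q' g' c
      have l1 := hR2 q' g' hq' h'
      have l2 := h'.nonneg hp
      have l3 := hR q hq (by rw [← hv]; exact hq.2) q' hq' c he (by omega)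
      omega

end LPack

namespace LPack

/-! ### Reading off the packing -/

/-- Follow the successors from the vertex `0` for `n + 3` steps and mark the items on the way. -/
def extract : Cmd := block
  [.assign 24 (.add (.reg 24) (.const 1)),
   forLt 5 24 (block
    [.assign 19 (.read 17 (.reg 19)), .write 4 (.read 12 (.reg 19)) (.const 1),
     .write 4 (.read 13 (.reg 19)) (.const 1)])]

variable {I : Instance} {B : ℕ} {σ σ0 : Store} {T : Set ℤ}

/-- Every step marks an item or brings a class to its end, so the end of the path is reached. -/
theorem runs_extract (hC : Ctx I σ0) (hV : Verts I σ0 T) (hs : Same [5, 17, 18] [16, 17] σ0 σ)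
    (hsound : Sound I σ0 (σ.arr 16) (σ.arr 17)) (h1 : 1 ≤ σ.arr 16 0) (h24 : σ.reg 24 = I.n + 2)
    (h19 : σ.reg 19 = 0) (h4 : ∀ z, σ.arr 4 z = 0) (hB : I.n + 3 ≤ B) :
    Runs B extract σ fun τ => ∃ M : Finset (Fin I.n), I.Feas M ∧
      σ.arr 16 0 ≤ (∑ a ∈ M, I.p a : ℕ) + 1 ∧
      ∀ a : Fin I.n, τ.arr 4 (a : ℕ) = if a ∈ M then 1 else 0 := by
  have hvtx0 : Vtx σ0 0 := ⟨le_rfl, hV.pos⟩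
  refine .cons (.assign ?_)
  generalize hσ1 : Store.setReg _ 24 _ = σ1
  have g24 : σ1.reg 24 = (I.n + 3 : ℕ) := by simp [← hσ1, h24]; ring
  have g19 : σ1.reg 19 = 0 := by simp [← hσ1, h19]
  have garr : σ1.arr = σ.arr := by rw [← hσ1]; rfl
  refine .cons (.imp (.forLt (I.n + 3) g24 hB (by decide) (by decide) (by decide)
    (fun i τ => ∃ M : Finset (Fin I.n),
      (∀ a : Fin I.n, τ.arr 4 (a : ℕ) = if a ∈ M then 1 else 0) ∧ Trace I σ0 M (τ.reg 19) ∧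
      Vtx σ0 (τ.reg 19) ∧ 1 ≤ σ.arr 16 (τ.reg 19) ∧
      σ.arr 16 0 ≤ (∑ a ∈ M, I.p a : ℕ) + σ.arr 16 (τ.reg 19) ∧
      ((∀ c, σ0.arr (itemA c) (τ.reg 19) = I.n + 1) ∨
        i ≤ M.card + ended I σ0 true (τ.reg 19) + ended I σ0 false (τ.reg 19))) ?_ ?_) ?_)
  · refine ⟨∅, ?_⟩
    simp only [Store.setReg_arr, Store.setReg_reg, garr, g19]
    exact ⟨by simp [h4], Trace.start hC hV, hvtx0, h1, by simp, .inr (by simp)⟩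
  · rintro i τ hi hr hsτ ⟨M, m1, m2, m3, m4, m5, m6⟩
    have e17 : τ.arr 17 = σ.arr 17 := by rw [hsτ.arr 17 (by decide), garr]
    have e12 : τ.arr 12 = σ0.arr 12 := by rw [hsτ.arr 12 (by decide), garr, hs.arr 12 (by decide)]
    have e13 : τ.arr 13 = σ0.arr 13 := by rw [hsτ.arr 13 (by decide), garr, hs.arr 13 (by decide)]
    refine .cons (.assign ?_)
    refine .cons (.write ?_)
    refine .cons (.write ?_)
    refine .nil ?_
    generalize hq : τ.reg 19 = q at *
    generalize hq' : σ.arr 17 q = q'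
    have hval : (Expr.read 17 (.reg 19)).eval τ = q' := by simp [hq, e17, hq']
    rw [hval]
    generalize hρ : Store.setReg _ 5 _ = ρ
    have r19 : ρ.reg 19 = q' := by simp [← hρ]
    have r4 : ∀ z, ρ.arr 4 z =
        if ∃ c, z = σ0.arr (itemA c) q' then 1 else τ.arr 4 z := by
      intro z
      simp only [← hρ, Store.setReg_arr, Store.setArr_arr, Expr.eval, Store.setReg_reg,
        Store.setArr_reg, e12, e13]
      simp only [Bool.exists_bool, itemA, cond_true, cond_false]
      by_cases h1 : z = σ0.arr 13 q' <;> by_cases h2 : z = σ0.arr 12 q' <;> simp [h1, h2]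
    have hmark : ∀ M' : Finset (Fin I.n),
        (∀ a, a ∈ M' ↔ a ∈ M ∨ ∃ c, ((a : ℕ) : ℤ) = σ0.arr (itemA c) q') →
        ∀ a : Fin I.n, ρ.arr 4 (a : ℕ) = if a ∈ M' then 1 else 0 := by
      intro M' hM' a
      rw [r4, m1]
      simp only [hM']
      by_cases h1 : ∃ c, ((a : ℕ) : ℤ) = σ0.arr (itemA c) q' <;> by_cases h2 : a ∈ M <;>
        simp [h1, h2]
    rcases hsound q m3 m4 with ⟨l1, l2, l3⟩ | ⟨c, l1, l2, l3, l4⟩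
    · -- The path has ended, and the current items are dummies.
      obtain rfl : q' = q := by rw [← hq', l3]
      refine ⟨M, hmark M fun a => ?_, by rwa [r19], by rwa [r19], by rwa [r19], by rwa [r19],
        .inl (by rwa [r19])⟩
      simp only [l1, exists_const]
      have := a.2
      refine (or_iff_left ?_).symm
      omega
    · rw [hq'] at l1 l2 l3 l4
      obtain ⟨M', k1, k2, k3, k4⟩ := m2.exists_step hC hV l2 m3 l1
      refine ⟨M', hmark M' k4, by rwa [r19], by rwa [r19], by rwa [r19], by rw [r19]; omega, ?_⟩
      rw [r19]
      right
      rcases m6 with m6 | m6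
      · -- No edge leaves a vertex where both classes are at their end.
        have h2 := l2.2.2.1
        have h3 := m2.edge_item hC l2 (hV.range c q' l1)
        rw [m6 c, hC.ord_end] at h2 h3
        rcases h3 with h3 | ⟨a, -, -, -, h3⟩
        · rw [h3, hC.ord_end] at h2; omega
        · omega
      · omega
  · -- At most `n` items and two ends of classes have been passed in `n + 3` steps.
    rintro τ ⟨M, m1, m2, m3, m4, m5, m6⟩
    have hcard : M.card ≤ I.n := by simpa using Finset.card_le_univ M
    have hfin : ∀ c, σ0.arr (itemA c) (τ.reg 19) = I.n + 1 := by
      rcases m6 with m6 | m6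
      · exact m6
      · exfalso
        have e1 : ∀ c, ended I σ0 c (τ.reg 19) ≤ 1 := fun c => by
          unfold ended; split_ifs <;> omega
        have := e1 true
        have := e1 false
        omega
    refine .nil ⟨M, m2.feas hfin, ?_, m1⟩
    rcases hsound _ m3 m4 with ⟨-, l2, -⟩ | ⟨c, l1, l2, -, -⟩
    · rwa [l2] at m5
    · have h2 := l2.2.2.1
      have h3 := m2.edge_item hC l2 (hV.range c _ l1)
      rw [hfin c, hC.ord_end] at h2 h3
      rcases h3 with h3 | ⟨a, -, -, -, h3⟩
      · rw [h3, hC.ord_end] at h2; omega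
      · omega

/-- The coordinates of the item in register `5` of a class with long sides in array `kA` and short
sides in array `sA`. It ends at the far side of the knapsack (array `lA`) and is placed next to the
marked items of its class with longer long sides (array `cA`). -/
def coordItem (kA sA lA cA : ℕ) : Cmd := block
  [.write lA (.reg 5) (.sub (.reg 1) (.read kA (.reg 5))),
   forLt 6 0 (guard
    [(.const 1, .read 4 (.reg 6)), (.read 3 (.reg 5), .read 3 (.reg 6)),
     (.read 3 (.reg 6), .read 3 (.reg 5)),
     (.add (.sub (.read 7 (.reg 5)) (.reg 5)) (.const 1), .sub (.read 7 (.reg 6)) (.reg 6))]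
    (addTo cA (.reg 5) (.read sA (.reg 6))))]

/-- Compute the coordinates of all items. -/
def coords : Cmd :=
  forLt 5 0 (.branch (.const 1) (.read 3 (.reg 5)) (coordItem 0 1 5 6) (coordItem 1 0 6 5))

namespace Instance

/-- The total size of the items of `M` of the class of `i` that come before `i` in its stack. -/
def base (M : Finset (Fin I.n)) (i : Fin I.n) : ℕ :=
  ∑ a : Fin I.n, if a ∈ M ∧ I.cls a = I.cls i ∧ I.ord i < I.ord a then I.size a else 0

theorem base_add_size {M : Finset (Fin I.n)} {i : Fin I.n} (hi : i ∈ M) :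
    I.base M i + I.size i = I.load M i := by
  have h1 : ∀ a, a ∈ M ∧ I.cls a = I.cls i ∧ I.ord i ≤ I.ord a ↔
      a = i ∨ (a ∈ M ∧ I.cls a = I.cls i ∧ I.ord i < I.ord a) := by
    intro a
    constructor
    · rintro ⟨h1, h2, h3⟩
      rcases h3.eq_or_lt with h4 | h4
      · exact .inl (ord_injective h4).symm
      · exact .inr ⟨h1, h2, h4⟩
    · rintro (rfl | ⟨h1, h2, h3⟩)
      exacts [⟨hi, rfl, le_rfl⟩, ⟨h1, h2, h3.le⟩]
  have h2 : M.filter (fun a => I.cls a = I.cls i ∧ I.ord i ≤ I.ord a) =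
      insert i (Finset.univ.filter fun a =>
        a ∈ M ∧ I.cls a = I.cls i ∧ I.ord i < I.ord a) := by
    ext a
    simp only [Finset.mem_filter, Finset.mem_insert, Finset.mem_univ, true_and]
    exact h1 a
  rw [load, h2, Finset.sum_insert (by simp), base, Finset.sum_filter, add_comm]

end Instance

theorem Instance.cls_eq_iff {a i : Fin I.n} : I.cls a = I.cls i ↔ (a ∈ I.hor ↔ i ∈ I.hor) := by
  simp [Instance.cls]

theorem runs_coordItem {kA sA lA cA : ℕ} {M : Finset (Fin I.n)} {i : Fin I.n} (hne : lA ≠ cA)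
    (hfix : ∀ x ∈ [3, 4, 7, sA], x ≠ lA ∧ x ≠ cA) (h5 : σ.reg 5 = (i : ℕ)) (h0 : σ.reg 0 = I.n)
    (h1 : σ.reg 1 = I.N) (hk : σ.arr kA (i : ℕ) = I.key i)
    (hs : ∀ a, I.cls a = I.cls i → σ.arr sA (a : ℕ) = I.size a)
    (h3 : ∀ a : Fin I.n, σ.arr 3 (a : ℕ) = if a ∈ I.hor then 1 else 0)
    (h7 : ∀ a : Fin I.n, σ.arr 7 (a : ℕ) = (I.n + 1) * I.key a)
    (h4 : ∀ a : Fin I.n, σ.arr 4 (a : ℕ) = if a ∈ M then 1 else 0)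
    (hc : σ.arr cA (i : ℕ) = 0) (hB : I.n + 3 ≤ B) :
    Runs B (coordItem kA sA lA cA) σ fun τ =>
      (∀ z, τ.arr lA z = if z = (i : ℕ) then (I.N : ℤ) - I.key i else σ.arr lA z) ∧
      ∀ z, τ.arr cA z = if z = (i : ℕ) then (I.base M i : ℤ) else σ.arr cA z := by
  simp only [List.mem_cons, List.not_mem_nil, or_false, forall_eq_or_imp, forall_eq] at hfix
  obtain ⟨f3, f4, f7, fs⟩ := hfix
  refine .cons (.write ?_)
  generalize hσ1 : Store.setArr _ lA _ _ = σ1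
  have garr : ∀ a, a ≠ lA → σ1.arr a = σ.arr a := by
    intro a ha; ext z; simp [← hσ1, ha]
  have gl : ∀ z, σ1.arr lA z = if z = (i : ℕ) then (I.N : ℤ) - I.key i else σ.arr lA z := by
    intro z; simp [← hσ1, h5, h1, hk]
  have greg : σ1.reg = σ.reg := by rw [← hσ1]; rfl
  clear hσ1
  let P : Fin I.n → Prop := fun a => a ∈ M ∧ I.cls a = I.cls i ∧ I.ord i < I.ord a
  let F : ℕ → ℕ := fun x => if hx : x < I.n then
    (if P ⟨x, hx⟩ then I.size ⟨x, hx⟩ else 0) else 0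
  refine .cons_frame (.forLt I.n (by rw [greg, h0]) (by omega) (by decide)
    (by simp [guard, addTo, Cmd.regs]) (by simp [guard, addTo, Cmd.regs])
    (fun j τ => ∀ z, τ.arr cA z =
      if z = (i : ℕ) then ((∑ x ∈ Finset.range j, F x : ℕ) : ℤ) else σ.arr cA z) ?_ ?_) ?_
  · intro z
    rw [Store.setReg_arr, garr cA hne.symm]
    split_ifs with hz
    · rw [hz, hc]; simp
    · rfl
  · intro j τ hj hr hsτ hI
    have hFj : F j = if P ⟨j, hj⟩ then I.size ⟨j, hj⟩ else 0 := dif_pos hj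
    have e5 : τ.reg 5 = (i : ℕ) := by
      rw [hsτ.reg 5 (by simp [guard, addTo, Cmd.regs]), greg, h5]
    have earr : ∀ a, a ≠ lA ∧ a ≠ cA → τ.arr a = σ.arr a := by
      intro a ha
      rw [hsτ.arr a (by simp [guard, addTo, Cmd.arrs, ha.2]), garr a ha.1]
    have hcond : (∀ p ∈ ([(.const 1, .read 4 (.reg 6)), (.read 3 (.reg 5), .read 3 (.reg 6)),
        (.read 3 (.reg 6), .read 3 (.reg 5)),
        (.add (.sub (.read 7 (.reg 5)) (.reg 5)) (.const 1), .sub (.read 7 (.reg 6)) (.reg 6))] :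
          List (Expr × Expr)), p.1.eval τ ≤ p.2.eval τ) ↔ P ⟨j, hj⟩ := by
      have a3 := h3 ⟨j, hj⟩
      have a4 := h4 ⟨j, hj⟩
      have a7 := h7 ⟨j, hj⟩
      have b3 := h3 i
      have b7 := h7 i
      have hi := i.2
      simp only at a3 a4 a7
      simp only [List.mem_cons, List.not_mem_nil, or_false, forall_eq_or_imp, forall_eq, Expr.eval,
        hr, e5, earr 3 f3, earr 4 f4, earr 7 f7, a3, a4, a7, b3, b7, P, Instance.cls_eq_iff]
      have hord : I.ord i < I.ord ⟨j, hj⟩ ↔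
          ((I.n : ℤ) + 1) * I.key i - (i : ℕ) + 1 ≤ (I.n + 1) * I.key ⟨j, hj⟩ - j := by
        unfold Instance.ord
        zify [hi.le, hj.le]
        constructor <;> intro h <;> linarith
      rw [hord]
      by_cases c1 : (⟨j, hj⟩ : Fin I.n) ∈ M <;> by_cases c2 : i ∈ I.hor <;>
        by_cases c3 : (⟨j, hj⟩ : Fin I.n) ∈ I.hor <;> simp [c1, c2, c3]
    refine .guard (fun h => ?_) (fun h => ?_)
    · have hP := hcond.1 h
      refine .addTo fun z => ?_
      have hsz := hs ⟨j, hj⟩ hP.2.1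
      simp only at hsz
      rw [Finset.sum_range_succ, hFj, if_pos hP]
      simp only [Store.setReg_arr, Store.setArr_arr, Expr.eval, e5, hr, true_and, earr sA fs, hI,
        hsz]
      split_ifs <;> push_cast <;> rfl
    · have hP : ¬ P ⟨j, hj⟩ := fun hP => h (hcond.2 hP)
      intro z
      rw [Finset.sum_range_succ, hFj, if_neg hP, add_zero]
      exact hI z
  · intro τ hτ hsτ
    refine .nil ⟨fun z => ?_, fun z => ?_⟩
    · rw [hsτ.arr lA (by simp [forLt, guard, addTo, Cmd.arrs, hne]), gl]
    · have hF : ∑ x ∈ Finset.range I.n, F x = I.base M i := by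
        rw [Finset.sum_range]
        refine Finset.sum_congr rfl fun a _ => ?_
        simp [F, P]
      rw [hτ, hF]

theorem runs_coords {M : Finset (Fin I.n)} (h0 : σ.reg 0 = I.n) (h1 : σ.reg 1 = I.N)
    (hw : ∀ a : Fin I.n, σ.arr 0 (a : ℕ) = I.w a) (hh : ∀ a : Fin I.n, σ.arr 1 (a : ℕ) = I.h a)
    (h3 : ∀ a : Fin I.n, σ.arr 3 (a : ℕ) = if a ∈ I.hor then 1 else 0)
    (h7 : ∀ a : Fin I.n, σ.arr 7 (a : ℕ) = (I.n + 1) * I.key a)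
    (h4 : ∀ a : Fin I.n, σ.arr 4 (a : ℕ) = if a ∈ M then 1 else 0)
    (h5 : ∀ z, σ.arr 5 z = 0) (h6 : ∀ z, σ.arr 6 z = 0) (hB : I.n + 3 ≤ B) :
    Runs B coords σ fun τ => ∀ i : Fin I.n,
      τ.arr (bif I.cls i then 5 else 6) (i : ℕ) = (I.N : ℤ) - I.key i ∧
      τ.arr (bif I.cls i then 6 else 5) (i : ℕ) = I.base M i := by
  refine .imp (.forLt I.n h0 (by omega) (by decide) (by decide) (by decide)
    (fun j τ => (∀ z : ℤ, j ≤ z → τ.arr 5 z = 0 ∧ τ.arr 6 z = 0) ∧ ∀ i : Fin I.n, (i : ℕ) < j →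
      τ.arr (bif I.cls i then 5 else 6) (i : ℕ) = (I.N : ℤ) - I.key i ∧
      τ.arr (bif I.cls i then 6 else 5) (i : ℕ) = I.base M i) ?_ ?_)
      fun τ hτ i => hτ.2 i i.2
  · exact ⟨fun z _ => ⟨h5 z, h6 z⟩, by simp⟩
  · rintro j τ hj hr hs ⟨hI1, hI2⟩
    have e0 : τ.reg 0 = I.n := by rw [hs.reg 0 (by decide), h0]
    have e1 : τ.reg 1 = I.N := by rw [hs.reg 1 (by decide), h1]
    have a0 : τ.arr 0 = σ.arr 0 := hs.arr 0 (by decide)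
    have a1 : τ.arr 1 = σ.arr 1 := hs.arr 1 (by decide)
    have a3 : τ.arr 3 = σ.arr 3 := hs.arr 3 (by decide)
    have a4 : τ.arr 4 = σ.arr 4 := hs.arr 4 (by decide)
    have a7 : τ.arr 7 = σ.arr 7 := hs.arr 7 (by decide)
    have h3j := h3 ⟨j, hj⟩
    simp only at h3j
    have hpost : ∀ (b : Bool) (ρ : Store), I.cls ⟨j, hj⟩ = b →
        (∀ z, ρ.arr (bif b then 5 else 6) z =
          if z = j then (I.N : ℤ) - I.key ⟨j, hj⟩ else τ.arr (bif b then 5 else 6) z) →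
        (∀ z, ρ.arr (bif b then 6 else 5) z =
          if z = j then (I.base M ⟨j, hj⟩ : ℤ) else τ.arr (bif b then 6 else 5) z) →
        (∀ z : ℤ, (j + 1 : ℕ) ≤ z → ρ.arr 5 z = 0 ∧ ρ.arr 6 z = 0) ∧
          ∀ i : Fin I.n, (i : ℕ) < j + 1 →
          ρ.arr (bif I.cls i then 5 else 6) (i : ℕ) = (I.N : ℤ) - I.key i ∧
          ρ.arr (bif I.cls i then 6 else 5) (i : ℕ) = I.base M i := by
      intro b ρ hb p1 p2
      have hold : ∀ z : ℤ, z ≠ j → ρ.arr 5 z = τ.arr 5 z ∧ ρ.arr 6 z = τ.arr 6 z := by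
        intro z hz
        have q1 := p1 z
        have q2 := p2 z
        rw [if_neg hz] at q1 q2
        cases b
        exacts [⟨q2, q1⟩, ⟨q1, q2⟩]
      constructor
      · intro z hz
        push_cast at hz
        rw [(hold z (by omega)).1, (hold z (by omega)).2]
        exact hI1 z (by omega)
      · intro i hi
        by_cases hij : (i : ℕ) = j
        · obtain rfl : i = ⟨j, hj⟩ := Fin.ext hij
          rw [hb, p1, p2, if_pos rfl, if_pos rfl]
          exact ⟨rfl, rfl⟩
        · have hne : ((i : ℕ) : ℤ) ≠ j := by exact_mod_cast hij
          have := hI2 i (by omega)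
          rw [← this.1, ← this.2]
          cases I.cls i
          exacts [⟨(hold _ hne).2, (hold _ hne).1⟩, hold _ hne]
    refine .branch (fun h => ?_) (fun h => ?_)
    · have hcls : (⟨j, hj⟩ : Fin I.n) ∈ I.hor := by
        by_contra hn
        simp [hr, a3, h3j, hn] at h
      have hsame : ∀ a, I.cls a = I.cls ⟨j, hj⟩ → a ∈ I.hor := fun a ha =>
        (Instance.cls_eq_iff.1 ha).2 hcls
      refine (runs_coordItem (M := M) (i := ⟨j, hj⟩) (by decide) (by decide) hr e0 e1
        ?_ ?_ (by rwa [a3]) (by rwa [a7]) (by rwa [a4]) (hI1 j le_rfl).2 hB).imp ?_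
      · rw [a0, hw, Instance.key, if_pos hcls]
      · intro a ha
        rw [a1, hh, Instance.size, if_pos (hsame a ha)]
      · rintro ρ ⟨p1, p2⟩
        exact hpost true _ (by simpa [Instance.cls] using hcls) p1 p2
    · have hcls : (⟨j, hj⟩ : Fin I.n) ∉ I.hor := by
        intro hn
        simp [hr, a3, h3j, hn] at h
      have hsame : ∀ a, I.cls a = I.cls ⟨j, hj⟩ → a ∉ I.hor := fun a ha ha' =>
        hcls ((Instance.cls_eq_iff.1 ha).1 ha')
      refine (runs_coordItem (M := M) (i := ⟨j, hj⟩) (by decide) (by decide) hr e0 e1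
        ?_ ?_ (by rwa [a3]) (by rwa [a7]) (by rwa [a4]) (hI1 j le_rfl).1 hB).imp ?_
      · rw [a1, hh, Instance.key, if_neg hcls]
      · intro a ha
        rw [a0, hw, Instance.size, if_neg (hsame a ha)]
      · rintro ρ ⟨p1, p2⟩
        exact hpost false _ (by simpa [Instance.cls] using hcls) p1 p2

end LPack

namespace LPack

/-! ### The scheme -/

theorem polyBdd_listSize (d : ℕ) : PolyBdd fun n => listSize n d := by
  have hn := PolyBdd.id.add (.const 1)
  induction d with
  | zero => exact (PolyBdd.const 1).add ((PolyBdd.const 2).mul (PolyBdd.id.mul (hn.pow 2)))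
  | succ d ih => exact ih.add (ih.mul ih)

/-- A bound for the number of iterations of every loop. -/
def iterBound (k n : ℕ) : ℕ :=
  vertCount n (listSize n ((2 * k + 2) * (2 * k + 2))) + listSize n ((2 * k + 2) * (2 * k + 2)) +
    n + 2 * k + 3

theorem polyBdd_iterBound (k : ℕ) : PolyBdd (iterBound k) := by
  have hm := polyBdd_listSize ((2 * k + 2) * (2 * k + 2))
  have hn := PolyBdd.id.add (.const 2)
  exact (((((PolyBdd.const 1).add (hn.mul (hn.mul (hm.mul hm)))).add hm).add .id).add
    (.const (2 * k))).add (.const 3)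

/-- The approximation scheme. -/
def scheme : Cmd := block [prepare, genUnits, genSums, genVerts, search, extract, coords]

theorem Ctx.same {I : Instance} {σ τ : Store} {R A : List ℕ} (h : Ctx I σ) (hs : Same R A σ τ)
    (hR : ∀ x ∈ [10, 11, 12], x ∉ R) (hA : ∀ a ∈ [2, 7, 8, 9, 10], a ∉ A) : Ctx I τ := by
  simp only [List.mem_cons, List.not_mem_nil, or_false, forall_eq_or_imp, forall_eq] at hR hA
  obtain ⟨R1, R2, R3⟩ := hR
  obtain ⟨A1, A2, A3, A4, A5⟩ := hA
  have e1 : ∀ c, τ.arr (ordA c) = σ.arr (ordA c) := by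
    intro c; cases c
    exacts [hs.arr 10 A5, hs.arr 9 A4]
  have e2 : ∀ c, τ.reg (capR c) = σ.reg (capR c) := by
    intro c; cases c
    exacts [hs.reg 12 R3, hs.reg 11 R2]
  constructor <;> simp only [e1, e2, hs.reg 10 R1, hs.arr 2 A1, hs.arr 7 A2, hs.arr 8 A3]
  exacts [h.key, h.key_start, h.key_end, h.size, h.size_end, h.ord, h.ord_start, h.ord_end,
    h.profit, h.profit_end, h.cap, h.width]

variable {I : Instance} {k : ℕ}

/-- The computed set of items is feasible and nearly optimal among the feasible sets, and the
coordinates are those of the two stacks. -/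
theorem runs_scheme : Runs (iterBound k I.n) scheme (input I k) fun τ =>
    ∃ M : Finset (Fin I.n), I.Feas M ∧
      (∀ M', I.Feas M' → k * ∑ a ∈ M', I.p a ≤ (k + 1) * ∑ a ∈ M, I.p a) ∧
      (∀ a : Fin I.n, τ.arr 4 (a : ℕ) = if a ∈ M then 1 else 0) ∧
      ∀ i : Fin I.n, τ.arr (bif I.cls i then 5 else 6) (i : ℕ) = (I.N : ℤ) - I.key i ∧
        τ.arr (bif I.cls i then 6 else 5) (i : ℕ) = I.base M i := by
  have hB : I.n + 3 ≤ iterBound k I.n := by unfold iterBound; omega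
  have hBm : listSize I.n ((2 * k + 2) * (2 * k + 2)) ≤ iterBound k I.n := by
    unfold iterBound; omega
  have hBv : vertCount I.n (listSize I.n ((2 * k + 2) * (2 * k + 2))) ≤ iterBound k I.n := by
    unfold iterBound; omega
  have hBk : 2 * k + 2 ≤ iterBound k I.n := by unfold iterBound; omega
  generalize iterBound k I.n = B at *
  refine .cons_frame (runs_prepare hB) ?_
  rintro σ1 ⟨hC1, p9⟩ s1
  have a0 : σ1.arr 0 = toArr I.w := s1.arr 0 (by decide)
  have a1 : σ1.arr 1 = toArr I.h := s1.arr 1 (by decide)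
  refine .cons_frame (runs_genUnits hB (s1.reg 0 (by decide)) p9 (fun a => by rw [a0, toArr_coe])
    (fun a => by rw [a1, toArr_coe]) (by rw [s1.arr 11 (by decide)]; rfl)) ?_
  rintro σ2 ⟨u1, u2, u3⟩ s2
  refine .cons_frame (runs_genSums (by rw [s2.reg 4 (by decide), s1.reg 4 (by decide)]; rfl) hBk hBm
    u1 u2 u3) ?_
  rintro σ3 ⟨v1, v2⟩ s3
  have t3 := (s1.append s2).append s3
  refine .cons_frame (runs_genVerts (t3.reg 0 (by decide)) (by rw [s3.reg 9 (by decide), s2.reg 9 (by decide), p9]) v1 hB hBm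
    (by rw [t3.arr 14 (by decide)]; rfl) (by rw [t3.arr 15 (by decide)]; rfl)) ?_
  rintro σ4 ⟨w24, w16, hV⟩ s4
  have t4 := t3.append s4
  have hC4 : Ctx I σ4 := (((hC1.same s2 (by decide) (by decide)).same s3 (by decide)
    (by decide)).same s4 (by decide) (by decide))
  have a2 : σ4.arr 2 = toArr I.p := t4.arr 2 (by decide)
  refine .cons_frame (runs_search hV (fun z => by rw [a2]; exact toArr_nonneg _ _)
    (by rw [s4.reg 9 (by decide), s3.reg 9 (by decide), s2.reg 9 (by decide), p9]) w24 hB w16 hBv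
    (fun z => by rw [t4.arr 16 (by decide)]; rfl)) ?_
  rintro σ5 ⟨hsound, hopt⟩ s5
  have t5 := t4.append s5
  have hbest : ∀ M', I.Feas M' → ∃ g : ℕ, (g : ℤ) + 1 ≤ σ5.arr 16 0 ∧
      k * ∑ a ∈ M', I.p a ≤ (k + 1) * g := by
    intro M' hM'
    obtain ⟨g, hg1, hg2⟩ := exists_reach hC4 hV k (fun s hs => v2 s (sums_mono (terms_lt _ _).le hs))
      hM'
    exact ⟨g, hopt 0 g ⟨le_rfl, hV.pos⟩ hg1, hg2⟩
  have hempty : I.Feas ∅ := ⟨by simp, by simp, by simp⟩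
  obtain ⟨g0, hg0, -⟩ := hbest ∅ hempty
  refine .cons_frame (runs_extract hC4 hV (s5.mono (by decide) (by decide)) hsound (by omega)
    (by rw [s5.reg 24 (by decide), w24]) (by rw [t5.reg 19 (by decide)]; rfl)
    (fun z => by rw [t5.arr 4 (by decide)]; rfl) hB) ?_
  rintro σ6 ⟨M, hM, hMp, h4⟩ s6
  have t6 := t5.append s6
  have hC6 : Ctx I σ6 := (hC4.same s5 (by decide) (by decide)).same s6 (by decide) (by decide)
  refine .cons_frame (runs_coords (M := M) (t6.reg 0 (by decide)) (t6.reg 1 (by decide))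
    (fun a => by rw [t6.arr 0 (by decide)]; exact toArr_coe _ _)
    (fun a => by rw [t6.arr 1 (by decide)]; exact toArr_coe _ _)
    (fun a => by rw [t6.arr 3 (by decide)]; simp only [input]; rw [toArr_coe]; push_cast; rfl)
    hC6.key h4 (fun z => by rw [t6.arr 5 (by decide)]; rfl)
    (fun z => by rw [t6.arr 6 (by decide)]; rfl) hB) ?_
  intro τ hτ s7
  refine .nil ⟨M, hM, fun M' hM' => ?_, fun a => by rw [s7.arr 4 (by decide), h4], hτ⟩
  obtain ⟨g, hg1, hg2⟩ := hbest M' hM'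
  refine hg2.trans (Nat.mul_le_mul_left _ ?_)
  have : (g : ℤ) ≤ (∑ a ∈ M, I.p a : ℕ) := by omega
  exact_mod_cast this

end LPack

/-- A polynomial-time approximation scheme for L-packing: one program, given an instance and `k ≥ 1`,
computes an L-packing whose profit is optimal up to the factor `1 + 1 / k`, in a number of steps that
for every fixed `k` is polynomial in the number of items alone. If one of the two arms is not thicker
than `N / 2`, the guarantee holds even against all packings of horizontal and vertical items in
their boxes, however they are arranged. -/
theorem theorem1 :
    ∃ P : LPack.Cmd, ∀ k : ℕ, 1 ≤ k → ∃ C : ℕ, ∀ I : LPack.Instance,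
      ∃ (t : ℕ) (σ : LPack.Store),
        LPack.Exec P (LPack.input I k) t σ ∧
        t ≤ C * (I.n + 1) ^ C ∧
        (LPack.output I σ).IsLPacking ∧
        (∀ Q : LPack.Placement I, Q.IsLPacking →
          (Q.profit : ℝ) ≤ (1 + 1 / (k : ℝ)) * ((LPack.output I σ).profit : ℝ)) ∧
        ((2 * I.hL ≤ I.N ∨ 2 * I.wL ≤ I.N) →
          ∀ Q : LPack.Placement I, Q.IsBoxPacking →
            (Q.profit : ℝ) ≤ (1 + 1 / (k : ℝ)) * ((LPack.output I σ).profit : ℝ)) := by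
  refine ⟨LPack.scheme, fun k hk => ?_⟩
  obtain ⟨C, hC⟩ := LPack.scheme.polyBdd_bnd.comp (LPack.polyBdd_iterBound k)
  refine ⟨C, fun I => ?_⟩
  obtain ⟨t, σ, hexec, ht, M, hM, hopt, h4, hcoord⟩ := LPack.runs_scheme (I := I) (k := k)
  have hitems : (LPack.output I σ).items = M := by
    ext a
    simp [LPack.output, h4]
  have hbound : ∀ Q : LPack.Placement I, I.Feas Q.items →
      (Q.profit : ℝ) ≤ (1 + 1 / (k : ℝ)) * ((LPack.output I σ).profit : ℝ) := by
    intro Q hQ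
    have h1 := hopt _ hQ
    rw [← hitems] at h1
    have h2 : (k : ℝ) * Q.profit ≤ (k + 1) * (LPack.output I σ).profit := by exact_mod_cast h1
    have hk0 : (0 : ℝ) < k := by exact_mod_cast hk
    rw [one_add_div hk0.ne', div_mul_eq_mul_div, le_div_iff₀ hk0]
    linarith
  refine ⟨t, σ, hexec, ht.trans (hC I.n), ?_, fun Q hQ => hbound Q hQ.feas, fun hthin Q hQ => ?_⟩
  · refine LPack.Placement.isLPacking_of_feas (by rwa [hitems]) (fun i hi => ?_) fun i hi => ?_
    · rw [hitems] at hi ⊢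
      rw [← LPack.Instance.base_add_size hi]
      have h := (hcoord i).2
      push_cast
      congr 1
      cases hc : I.cls i <;> rw [hc] at h <;>
        simpa [LPack.Placement.across, LPack.output] using congrArg (Int.cast : ℤ → ℝ) h
    · have h := (hcoord i).1
      have h' : (LPack.output I σ).along (I.cls i) i = (I.N : ℝ) - I.key i := by
        cases hc : I.cls i <;> rw [hc] at h <;>
          simpa [LPack.Placement.along, LPack.output] using congrArg (Int.cast : ℤ → ℝ) h
      rw [h', sub_add_cancel]
  · rcases hthin with h | h
    · exact hbound Q (hQ.feas_of_thin (c := true) h)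
    · exact hbound Q (hQ.feas_of_thin (c := false) h)
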